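/- **Setting.** For $r\ge 1$ let $L_{r}(u)=\sum_{k=0}^{r}(-1)^{r-k}\binom{r}{k}\binom{r+k}{k}u^k$ be the shifted Legendre polynomials, $K_r(t)=\int_0^tL_{r-1}(u)\,du$ and $K=(K_2,\dots,K_\ell)^t$. Let $\Theta\subset\mathbb R^d$, $\mathcal A\subset\mathbb R^s$, $\Phi\subset(0,1)\times\Theta\times\mathcal A$, let $P_1(\cdot|\theta)$, $\theta\in\Theta$, be probability measures on $\mathbb R$ with distribution functions $\mathbb F_1(\cdot|\theta)$, and let $m:\mathcal A\to\mathbb R^{\ell-1}$. The observations $X_1,X_2,\dots$ are i.i.d. with law $P_T$ and distribution function $\mathbb F_T$, where, for some $\phi^*=(\lambda^*,\theta^*,\alpha^*)\in\Phi$, $$P_T=\lambda^*P_1(\cdot|\theta^*)+(1-\lambda^*)P_0,$$ and the probability measure $P_0$ satisfies the L-moment constraints $\int_0^1K(u)\,d\mathbf F_0^{-1}(u)=m(\alpha^*)$; here $\mathbf F_0^{-1}$ is the quantile measure of $P_0$, i.e. the Stieltjes measure on $(0,1)$ of its quantile function. Let $\varphi:\mathbb R\to[0,\infty]$ be convex with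 $\varphi(1)=0$ and finite in a neighbourhood of $1$, and suppose that its convex conjugate $\psi(t)=\sup_x\{tx-\varphi(x)\}$ is finite and $\mathcal C^2$ in a neighbourhood of $0$, with the normalization $\psi''(0)=1$. With $\mathbb F_n$ the empirical distribution function of $X_1,\dots,X_n$, put for $\phi=(\lambda,\theta,\alpha)$ $$\mathbb F_0(y|\phi)=\tfrac1{1-\lambda}\mathbb F_T(y)-\tfrac\lambda{1-\lambda}\mathbb F_1(y|\theta),\qquad \hat{\mathbb F}_0(y|\phi)=\tfrac1{1-\lambda}\mathbb F_n(y)-\tfrac\lambda{1-\lambda}\mathbb F_1(y|\theta),$$ $$H_n(\phi,\xi)=\xi^tm(\alpha)-\int_{\mathbb R}\psi\big(\xi^tK(\hat{\mathbb F}_0(y|\phi))\big)\,dy .$$ Let the random vectors $\hat\phi$ and $\xi_n(\hat\phi)$ (depending on $n$) satisfy, almost surely for all large $n$, $$\hat\phi\in\arg\inf_{\phi\in\Phi}\ \sup_{\xi\in\mathbb R^{\ell-1}}H_n(\phi,\xi),\qquad \xi_n(\hat\phi)\in\arg\sup_{\xi\in\mathbb R^{\ell-1}}H_n(\hat\phi,\xi).$$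 **Matrices.** Let $J=J_{\phi^*,\xi^*}$ be the $(\ell-1)\times(1+d+s)$ matrix whose blocks of columns, corresponding to $\lambda,\theta,\alpha$, are $$-\int\frac{\mathbb F_T(y)-\mathbb F_1(y|\theta^*)}{(1-\lambda^*)^2}K'(\mathbb F_0(y|\phi^*))\,dy,\qquad \frac{\lambda^*}{1-\lambda^*}\int K'(\mathbb F_0(y|\phi^*))\,\nabla_\theta\mathbb F_1(y|\theta^*)^t\,dy,\qquad \nabla m(\alpha^*),$$ the last one being the Jacobian matrix of $m$ at $\alpha^*$. Let $$A=J_{\xi^*,\xi^*}=\int K(\mathbb F_0(y|\phi^*))K(\mathbb F_0(y|\phi^*))^t\,dy,\qquad \tilde\Sigma=(J^tA^{-1}J)^{-1},$$ $$H=-\tilde\Sigma J^tA^{-1},\qquad P=A^{-1}-A^{-1}J\tilde\Sigma J^tA^{-1},$$ and, for $r_1,r_2\in\{2,\dots,\ell\}$, $$\Sigma_{r_1,r_2}=\frac1{(1-\lambda^*)^2}\int\!\!\int\big(\mathbb F_T(\min(x,y))-\mathbb F_T(x)\mathbb F_T(y)\big)\,L_{r_1-1}(\mathbb F_0(x|\phi^*))\,L_{r_2-1}(\mathbb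 F_0(y|\phi^*))\,dy\,dx .$$ **Theorem.** Suppose that $\mathbb E|X_i|<\infty$, that $$\int\sqrt{\mathbb F_T(y)(1-\mathbb F_T(y))}\,dy<\infty,\qquad \int\!\!\int\big(\mathbb F_T(\min(x,y))-\mathbb F_T(x)\mathbb F_T(y)\big)\,dx\,dy<\infty,$$ and that: 1. $(\hat\phi,\xi_n(\hat\phi))\to(\phi^*,0)$ in probability; 2. $\phi^*$ is an interior point of $\Phi$; 3. $m$ is of class $\mathcal C^2$ on $\mathcal A$; 4. for $\theta$ in a neighbourhood of $\theta^*$, $\mathbb F_1(y|\theta)$ is twice differentiable in $\theta$ for every $y$, and $\|\nabla_\theta\mathbb F_1(y|\theta)\|\le B_1(y)$ with $B_1$ integrable; 5. for $\theta$ in a neighbourhood of $\theta^*$, $\|\nabla_\theta\mathbb F_1(y|\theta)\nabla_\theta\mathbb F_1(y|\theta)^t\|\le B_{2,2}(y)$, and the matrix of second derivatives of $\mathbb F_1(y|\theta)$ in $\theta$ has norm at most $B_{2,1}(y)$, with $B_{2,1},B_{2,2}$ integrable; 6. $y\mapsto\mathbb F_T(y)-\mathbb F_1(y|\theta^*)$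 is integrable; 7. $A$ and $J^tA^{-1}J$ are invertible. Then $$\begin{pmatrix}\sqrt n(\hat\phi-\phi^*)\\ \sqrt n\,\xi_n(\hat\phi)\end{pmatrix}\ \longrightarrow\ \mathcal N\left(0,\ \begin{pmatrix}H\\P\end{pmatrix}\Sigma\begin{pmatrix}H^t&P^t\end{pmatrix}\right)\quad\text{in law.}$$ -/

import Mathlib

open MeasureTheory ProbabilityTheory Filter Topology Set
open scoped ENNReal NNReal Matrix

noncomputable section

namespace LMomMixture

/-! ### L-moment polynomials -/

/-- The shifted Legendre polynomial `L_r`. -/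
def legendre (r : ℕ) (u : ℝ) : ℝ :=
  ∑ k ∈ Finset.range (r + 1),
    (-1 : ℝ) ^ (r - k) * (r.choose k : ℝ) * ((r + k).choose k : ℝ) * u ^ k

/-- The integrated shifted Legendre polynomial `K_r(t) = ∫₀ᵗ L_{r-1}(u) du` (used for `r ≥ 2`). -/
def K (r : ℕ) (t : ℝ) : ℝ := ∫ u in (0 : ℝ)..t, legendre (r - 1) u

/-! ### Quantile measures -/

/-- The quantile function `F⁻¹(u) = inf {x : F(x) ≥ u}` of a law on `ℝ`. -/
def quantileFun (P : Measure ℝ) (u : ℝ) : ℝ := sInf {x : ℝ | u ≤ cdf P x}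

/-- The quantile measure `B ↦ ∫₀¹ 1_B dF⁻¹`, the Stieltjes measure on `(0,1)` of the quantile
function. It is built as the image under `F` of Lebesgue measure on `{0 < F < 1}`; the two lemmas
below show that it lives on `(0,1)` and that `[a,b)` has mass `F⁻¹(b) - F⁻¹(a)`, which
determines it. -/
def quantileMeasure (P : Measure ℝ) : Measure ℝ :=
  (volume.restrict {x : ℝ | 0 < cdf P x ∧ cdf P x < 1}).map (cdf P)

lemma quantileFun_le_iff (P : Measure ℝ) {u x : ℝ} (h0 : 0 < u) (h1 : u < 1) :
    quantileFun P u ≤ x ↔ u ≤ cdf P x := by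
  have hne : {x : ℝ | u ≤ cdf P x}.Nonempty := by
    obtain ⟨z, hz⟩ := ((tendsto_cdf_atTop P).eventually (lt_mem_nhds h1)).exists
    exact ⟨z, hz.le⟩
  have hbdd : BddBelow {x : ℝ | u ≤ cdf P x} := by
    obtain ⟨z, hz⟩ := ((tendsto_cdf_atBot P).eventually (gt_mem_nhds h0)).exists
    refine ⟨z, fun y hy => ?_⟩
    by_contra hlt
    exact absurd (lt_of_le_of_lt (hy.trans (monotone_cdf P (not_le.1 hlt).le)) hz) (lt_irrefl _)
  constructor
  · intro h
    have hright : Tendsto (cdf P) (𝓝[>] x) (𝓝 (cdf P x)) :=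
      ((cdf P).right_continuous x).mono_left (nhdsWithin_mono x Ioi_subset_Ici_self)
    refine ge_of_tendsto hright ?_
    filter_upwards [self_mem_nhdsWithin] with y hy
    obtain ⟨z, hz, hzy⟩ := exists_lt_of_csInf_lt hne (lt_of_le_of_lt h hy)
    exact le_trans hz (monotone_cdf P hzy.le)
  · intro h
    exact csInf_le hbdd h

lemma quantileMeasure_Ico (P : Measure ℝ) {a b : ℝ} (ha : 0 < a) (hab : a ≤ b) (hb : b < 1) :
    quantileMeasure P (Ico a b) = ENNReal.ofReal (quantileFun P b - quantileFun P a) := by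
  have hm : Measurable (cdf P) := (monotone_cdf P).measurable
  rw [quantileMeasure, Measure.map_apply hm measurableSet_Ico,
    Measure.restrict_apply (hm measurableSet_Ico), ← Real.volume_Ico]
  congr 1
  ext x
  have h1 := quantileFun_le_iff P (x := x) ha (lt_of_le_of_lt hab hb)
  have h2 := quantileFun_le_iff P (x := x) (lt_of_lt_of_le ha hab) hb
  simp only [mem_inter_iff, mem_preimage, mem_Ico, mem_ofPred_eq, h1, ← not_le, h2]
  constructor
  · tauto
  · rintro ⟨h3, h4⟩
    exact ⟨⟨h3, h4⟩, fun h => absurd (h3.trans h) (not_le.2 ha),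
      fun h => h4 (hb.le.trans h)⟩

lemma quantileMeasure_compl_Ioo (P : Measure ℝ) : quantileMeasure P (Ioo 0 1)ᶜ = 0 := by
  have hm : Measurable (cdf P) := (monotone_cdf P).measurable
  rw [quantileMeasure, Measure.map_apply hm measurableSet_Ioo.compl,
    Measure.restrict_apply (hm measurableSet_Ioo.compl)]
  have : (cdf P ⁻¹' (Ioo 0 1)ᶜ) ∩ {x : ℝ | 0 < cdf P x ∧ cdf P x < 1} = ∅ := by
    ext x
    simp
  rw [this, measure_empty]

/-- The class of σ-finite measures `Q ≪ Q₀` with `∫ K dQ = c`, where `K = (K_2, …, K_ℓ)`.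
Coordinate `i : Fin (ℓ - 1)` stands for the order `r = i + 2`. -/
def constraintClass {ℓ : ℕ} (Q₀ : Measure ℝ) (c : EuclideanSpace ℝ (Fin (ℓ - 1))) :
    Set (Measure ℝ) :=
  {Q | SigmaFinite Q ∧ Q ≪ Q₀ ∧
    ∀ i : Fin (ℓ - 1), Integrable (K (i + 2)) Q ∧ ∫ u, K (i + 2) u ∂Q = c i}

/-! ### Parameters `φ = (λ, θ, α)` -/

/-- Index type of the coordinates of `φ = (λ, θ, α) ∈ ℝ × ℝᵈ × ℝˢ`. -/
abbrev ParIdx (d s : ℕ) := Unit ⊕ Fin d ⊕ Fin s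

/-- The space `ℝ^{1+d+s}` of the parameters `φ`. -/
abbrev Par (d s : ℕ) := EuclideanSpace ℝ (ParIdx d s)

variable {d s : ℕ}

/-- The proportion `λ`. -/
def Par.lam (φ : Par d s) : ℝ := φ (Sum.inl ())

/-- The parameter `θ` of the parametric component. -/
def Par.theta (φ : Par d s) : EuclideanSpace ℝ (Fin d) :=
  WithLp.toLp 2 fun j => φ (Sum.inr (Sum.inl j))

/-- The parameter `α` of the constraints. -/
def Par.alpha (φ : Par d s) : EuclideanSpace ℝ (Fin s) :=
  WithLp.toLp 2 fun k => φ (Sum.inr (Sum.inr k))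

/-! ### Divergence generator and convex conjugate -/

/-- `f` generates a divergence: an extended-valued nonnegative convex function that vanishes at `1`
and whose domain is a neighbourhood of `1`. -/
structure IsDivergenceGenerator (f : ℝ → ℝ≥0∞) : Prop where
  convex : ConvexOn ℝ≥0 univ f
  one : f 1 = 0
  dom : {x | f x < ∞} ∈ 𝓝 (1 : ℝ)

/-- The convex conjugate `ψ(t) = sup_x (t x - f(x))`, with values in `(-∞, ∞]`. -/
def conjugate (f : ℝ → ℝ≥0∞) (t : ℝ) : EReal := ⨆ x : ℝ, ((t * x : ℝ) : EReal) - (f x : EReal)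

/-- Lebesgue integral over `ℝ` of an extended real function: integral of the positive part minus
integral of the negative part. -/
def extIntegral (g : ℝ → EReal) : EReal :=
  ((∫⁻ y, (g y).toENNReal : ℝ≥0∞) : EReal) - ((∫⁻ y, (-g y).toENNReal : ℝ≥0∞) : EReal)

/-! ### Criterion function -/

/-- The empirical distribution function of the first `n` observations. -/
def empCdf {Ω : Type*} (X : ℕ → Ω → ℝ) (n : ℕ) (ω : Ω) (y : ℝ) : ℝ :=
  (n : ℝ)⁻¹ * ∑ i ∈ Finset.range n, (Iic y).indicator (fun _ => (1 : ℝ)) (X i ω)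

/-- `F(y)/(1-λ) - λ F₁(y|θ)/(1-λ)`. With `F = F_T` this is `F₀(y|φ)`, and with `F = F_n` it is the
plug-in version of it. -/
def F0 (P₁ : EuclideanSpace ℝ (Fin d) → Measure ℝ) (F : ℝ → ℝ) (φ : Par d s) (y : ℝ) : ℝ :=
  1 / (1 - φ.lam) * F y - φ.lam / (1 - φ.lam) * cdf (P₁ φ.theta) y

/-- `H(φ, ξ) = ξᵗ m(α) - ∫ ψ(ξᵗ K(F₀(y|φ))) dy`. With `F = F_n` this is `H_n`. -/
def criterion {ℓ : ℕ} (f : ℝ → ℝ≥0∞) (P₁ : EuclideanSpace ℝ (Fin d) → Measure ℝ)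
    (m : EuclideanSpace ℝ (Fin s) → EuclideanSpace ℝ (Fin (ℓ - 1))) (F : ℝ → ℝ)
    (φ : Par d s) (ξ : EuclideanSpace ℝ (Fin (ℓ - 1))) : EReal :=
  ((∑ i, ξ i * m φ.alpha i : ℝ) : EReal) -
    extIntegral fun y => conjugate f (∑ i : Fin (ℓ - 1), ξ i * K (i + 2) (F0 P₁ F φ y))

/-! ### The matrices of the limit law -/

/-- The gradient `∇_θ F₁(y|θ)`. -/
def gradF1 (P₁ : EuclideanSpace ℝ (Fin d) → Measure ℝ) (y : ℝ) (θ : EuclideanSpace ℝ (Fin d)) :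
    EuclideanSpace ℝ (Fin d) :=
  gradient (fun t => (cdf (P₁ t) y : ℝ)) θ

/-- `J_{φ,ξ}`, of size `(ℓ-1) × (1+d+s)`. -/
def Jphixi {ℓ : ℕ} (P₁ : EuclideanSpace ℝ (Fin d) → Measure ℝ)
    (m : EuclideanSpace ℝ (Fin s) → EuclideanSpace ℝ (Fin (ℓ - 1))) (F : ℝ → ℝ) (φ : Par d s) :
    Matrix (Fin (ℓ - 1)) (ParIdx d s) ℝ :=
  Matrix.of fun i => Sum.elim
    (fun _ => -∫ y, (1 / (1 - φ.lam) ^ 2 * F y - 1 / (1 - φ.lam) ^ 2 * cdf (P₁ φ.theta) y) *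
      deriv (K (i + 2)) (F0 P₁ F φ y))
    (Sum.elim
      (fun j => φ.lam / (1 - φ.lam) *
        ∫ y, gradF1 P₁ y φ.theta j * deriv (K (i + 2)) (F0 P₁ F φ y))
      (fun k => fderiv ℝ m φ.alpha (EuclideanSpace.single k 1) i))

/-- `J_{ξ,ξ} = ∫ K(F₀) K(F₀)ᵗ dy`. -/
def Jxixi (ℓ : ℕ) (P₁ : EuclideanSpace ℝ (Fin d) → Measure ℝ) (F : ℝ → ℝ) (φ : Par d s) :
    Matrix (Fin (ℓ - 1)) (Fin (ℓ - 1)) ℝ :=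
  Matrix.of fun i j => ∫ y, K (i + 2) (F0 P₁ F φ y) * K (j + 2) (F0 P₁ F φ y)

/-- The limit covariance `Σ` of `√n (∫ K(F̂₀(y|φ)) dy - ∫ K(F₀(y|φ)) dy)`. The polynomial
`∑_{k<r} c_{r,k} u^k` is `legendre (r - 1)`. -/
def covSigma (ℓ : ℕ) (P₁ : EuclideanSpace ℝ (Fin d) → Measure ℝ) (F : ℝ → ℝ) (φ : Par d s) :
    Matrix (Fin (ℓ - 1)) (Fin (ℓ - 1)) ℝ :=
  Matrix.of fun i j => 1 / (1 - φ.lam) ^ 2 *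
    ∫ x, ∫ y, (F (min x y) - F x * F y) *
      legendre (i + 1) (F0 P₁ F φ x) * legendre (j + 1) (F0 P₁ F φ y)

variable {q : ℕ} {ι : Type} [Fintype ι] [DecidableEq ι]

/-- `Σ̃ = (Jᵗ A⁻¹ J)⁻¹` for `J = J_{φ,ξ}` and `A = J_{ξ,ξ}`. -/
def sigmaTilde (J : Matrix (Fin q) ι ℝ) (A : Matrix (Fin q) (Fin q) ℝ) : Matrix ι ι ℝ :=
  (Jᵀ * A⁻¹ * J)⁻¹

/-- `H = -Σ̃ Jᵗ A⁻¹`. -/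
def matH (J : Matrix (Fin q) ι ℝ) (A : Matrix (Fin q) (Fin q) ℝ) : Matrix ι (Fin q) ℝ :=
  -(sigmaTilde J A * Jᵀ * A⁻¹)

/-- `P = A⁻¹ - A⁻¹ J Σ̃ Jᵗ A⁻¹`. -/
def matP (J : Matrix (Fin q) ι ℝ) (A : Matrix (Fin q) (Fin q) ℝ) : Matrix (Fin q) (Fin q) ℝ :=
  A⁻¹ - A⁻¹ * J * sigmaTilde J A * Jᵀ * A⁻¹

/-- The stacked matrix `(H ; P)`. -/
def matHP (J : Matrix (Fin q) ι ℝ) (A : Matrix (Fin q) (Fin q) ℝ) :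
    Matrix (ι ⊕ Fin q) (Fin q) ℝ :=
  Matrix.fromRows (matH J A) (matP J A)

/-- The covariance matrix `(H ; P) S (Hᵗ Pᵗ)`. -/
def limitCov (J : Matrix (Fin q) ι ℝ) (A S : Matrix (Fin q) (Fin q) ℝ) :
    Matrix (ι ⊕ Fin q) (ι ⊕ Fin q) ℝ :=
  matHP J A * S * (matHP J A)ᵀ

end LMomMixture

end

/-!
The estimator solves the minimax problem `inf_φ sup_ξ H_n(φ, ξ)`. Its law is found by linearising
the two first-order conditions at the true point `(φ*, 0)`, where the only random input is the
empirical distribution function `F_n`.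

*Deterministic part.* The model is abstracted into `PluginProblem`, a minimax problem depending on
a nuisance function `F` close to `F₀` in `L¹`; limits are taken along the filter
`PluginProblem.nhd` of triples `(F, φ, ξ)` tending to `(F₀, φ₀, 0)`. The criterion need not be
finite, let alone smooth, away from `ξ = 0`, since `ψ` is only controlled near `0`. Convexity makes
up for this: the quadratic minorant of `ψ` near a point extends to a minorant of Huber type on the
whole line (`IsLocalConjugate`, `exists_isLocalConjugate`), so that the criterion lies below its
tangent plane in `ξ` by a quadratic margin for small increments and by a linear one for large ones
(`PluginProblem.eventually_crit_le`). The supremum over `ξ` at a neighbouring `φ` then exceeds the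
value at the current multiplier only to second order (`PluginProblem.eventually_iSup_crit_le`), and
comparing suprema at `φ` and at nearby points gives the envelope condition `∂_φ H = 0` without an
implicit function theorem (`PluginProblem.eventually_deriv_eq_zero`). Together with `∂_ξ H = 0`
this yields, up to relative errors tending to `0`, `A ξ - J (φ - φ₀) = g` and `Jᵗ ξ = 0`, where
`g = M(φ₀) - ∫ k(T(F, φ₀))` is the residual of the constraints at the true parameter. Solving the
block system gives `(φ - φ₀, ξ) = (H ; P) g + o(|g|)` (`PluginProblem.eventually_expansion`).

*The model.* `exists_pluginProblem` checks that the mixture model is an instance. The L-moment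
constraints for `P₀` become `m(α*) = ∫ K(F₀(y|φ*)) dy` because the quantile measure is an image of
Lebesgue measure under the distribution function (`quantileMeasure_integral`); this uses
`K_r(0) = K_r(1) = 0`, the second equality coming from Rodrigues' formula (`K_one`).

*Probabilistic part.* As `F₀(y|φ*)` is affine in the nuisance function, a second-order Taylor
expansion of `K` shows that `g` at `F = F_n` is an average of centred i.i.d. vectors up to a
multiple of `∫ (F_n - F_T)²`, which is `O(1/n)` in `L¹` (`PluginProblem.abs_res_add_le`,
`integrable_sq_empCdf`), while `√n ∫ |F_n - F_T|` is bounded in `L¹` by `∫ √(F_T (1 - F_T))`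
(`integrable_dist_empCdf`). Fubini's theorem identifies the covariance of the i.i.d. vectors with
`Σ` (`integral_influence_mul`). The central limit theorem in several dimensions follows from the
one on the line by the Cramér–Wold device (`tendstoInDistribution_inv_sqrt_smul_sum`), and
Slutsky's lemma concludes (`PluginProblem.tendstoInDistribution_minimax`).
-/

noncomputable section

namespace LMomMixture

section

/-! ### The convex conjugate near the origin -/

lemma measurable_conjugate (f : ℝ → ℝ≥0∞) : Measurable (conjugate f) := by
  refine LowerSemicontinuous.measurable (lowerSemicontinuous_iSup fun x => ?_)
  refine Continuous.lowerSemicontinuous ?_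
  rcases eq_or_ne (f x) ∞ with h | h
  · simp only [h, EReal.coe_ennreal_top, EReal.sub_top]
    exact continuous_const
  · have : ∀ t : ℝ,
        ((t * x : ℝ) : EReal) - (f x : EReal) = ((t * x - (f x).toReal : ℝ) : EReal) := by
      intro t
      rw [EReal.coe_sub, EReal.coe_ennreal_toReal h]
    simp only [this]
    exact continuous_coe_real_ereal.comp (by fun_prop)

lemma le_conjugate (f : ℝ → ℝ≥0∞) {x : ℝ} (hx : f x ≠ ∞) (t : ℝ) :
    ((t * x - (f x).toReal : ℝ) : EReal) ≤ conjugate f t := by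
  refine le_trans (le_of_eq ?_) (le_iSup (fun x : ℝ => ((t * x : ℝ) : EReal) - (f x : EReal)) x)
  rw [EReal.coe_sub, EReal.coe_ennreal_toReal hx]

lemma conjugate_le (f : ℝ → ℝ≥0∞) {t : ℝ} {a : EReal}
    (h : ∀ x, f x ≠ ∞ → ((t * x - (f x).toReal : ℝ) : EReal) ≤ a) : conjugate f t ≤ a := by
  refine iSup_le fun x => ?_
  rcases eq_or_ne (f x) ∞ with hx | hx
  · simp [hx, EReal.sub_top]
  · refine le_trans (le_of_eq ?_) (h x hx)
    rw [EReal.coe_sub, EReal.coe_ennreal_toReal hx]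

lemma self_le_conjugate {f : ℝ → ℝ≥0∞} (h1 : f 1 = 0) (t : ℝ) : (t : EReal) ≤ conjugate f t := by
  simpa [h1] using le_conjugate f (x := 1) (by simp [h1]) t

lemma conjugate_zero {f : ℝ → ℝ≥0∞} (h1 : f 1 = 0) : conjugate f 0 = 0 := by
  refine le_antisymm (conjugate_le f fun x _ => ?_) (by simpa using self_le_conjugate h1 0)
  simp only [zero_mul, zero_sub]
  exact_mod_cast neg_nonpos.2 ENNReal.toReal_nonneg

lemma conjugate_ne_bot {f : ℝ → ℝ≥0∞} (h1 : f 1 = 0) (t : ℝ) : conjugate f t ≠ ⊥ := fun h => by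
  have := self_le_conjugate h1 t
  rw [h] at this
  exact absurd this (by simp)

lemma conjugate_convex (f : ℝ → ℝ≥0∞) {s t a S T U : ℝ} (ha0 : 0 ≤ a) (ha1 : a ≤ 1)
    (hs : conjugate f s = S) (ht : conjugate f t = T)
    (hu : conjugate f ((1 - a) * s + a * t) = U) : U ≤ (1 - a) * S + a * T := by
  rw [← EReal.coe_le_coe_iff, ← hu]
  refine conjugate_le f fun x hx => ?_
  have h1 := le_conjugate f hx s
  have h2 := le_conjugate f hx t
  rw [hs, EReal.coe_le_coe_iff] at h1
  rw [ht, EReal.coe_le_coe_iff] at h2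
  rw [EReal.coe_le_coe_iff]
  nlinarith [mul_le_mul_of_nonneg_left h1 (sub_nonneg.2 ha1), mul_le_mul_of_nonneg_left h2 ha0]

/-- Local behaviour at the origin of an extended-valued convex function `ψ` with `ψ(0) = 0`,
`ψ'(0) = ψ''(0) = 1`: on `(-r, r)` it is finite and differentiable, its derivative has difference
quotients within `1/2` of `1`, and the quadratic lower bound on the Bregman remainder that follows
extends, by convexity, to a bound of Huber type valid on the whole line. -/
structure IsLocalConjugate (ψ : ℝ → EReal) (r κ : ℝ) : Prop where
  r_pos : 0 < r
  r_le : r ≤ 1 / 2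
  κ_pos : 0 < κ
  meas : Measurable ψ
  coe : ∀ t, |t| < r → ψ t = ((ψ t).toReal : EReal)
  diff : ∀ t, |t| < r → DifferentiableAt ℝ (fun t => (ψ t).toReal) t
  zero : (ψ 0).toReal = 0
  deriv_zero : deriv (fun t => (ψ t).toReal) 0 = 1
  slope : ∀ s t, |s| < r → |t| < r →
    |deriv (fun t => (ψ t).toReal) s - deriv (fun t => (ψ t).toReal) t - (s - t)| ≤ |s - t| / 2
  small : ∀ ε > 0, ∃ δ > 0, ∀ t, |t| < δ → |deriv (fun t => (ψ t).toReal) t - 1 - t| ≤ ε * |t|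
  lower : ∀ t, |t| < r → ∀ w, (((ψ t).toReal + deriv (fun t => (ψ t).toReal) t * w
    + κ * min (w ^ 2) |w| : ℝ) : EReal) ≤ ψ (t + w)

/-- Bregman remainder bound from a lower bound on the difference quotients of the derivative. -/
lemma bregman_lower {p p' : ℝ → ℝ} {a b c : ℝ} {s t : ℝ} (hs : s ∈ Ioo a b) (ht : t ∈ Ioo a b)
    (hd : ∀ x ∈ Ioo a b, HasDerivAt p (p' x) x)
    (hsl : ∀ x ∈ Ioo a b, ∀ y ∈ Ioo a b, x ≤ y → c * (y - x) ≤ p' y - p' x) :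
    p t + p' t * (s - t) + c / 2 * (s - t) ^ 2 ≤ p s := by
  -- the difference of the two sides has derivative `p' x - p' t - c (x - t)`, which has the sign of
  -- `x - t`
  let D : ℝ → ℝ := fun x => p x - p t - p' t * (x - t) - c / 2 * (x - t) ^ 2
  have hD : ∀ x ∈ Ioo a b, HasDerivAt D (p' x - p' t - c * (x - t)) x := by
    intro x hx
    have h1 := (((hd x hx).sub_const (p t)).sub
      (((hasDerivAt_id x).sub_const t).const_mul (p' t))).sub
      ((((hasDerivAt_id x).sub_const t).pow 2).const_mul (c / 2))
    refine h1.congr_deriv ?_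
    simp; ring
  suffices h : 0 ≤ D s by simp only [D] at h; linarith
  have hDt : D t = 0 := by simp [D]
  rw [← hDt]
  rcases le_total t s with hts | hts
  · have hsub : Icc t s ⊆ Ioo a b := fun x hx => ⟨ht.1.trans_le hx.1, hx.2.trans_lt hs.2⟩
    refine monotoneOn_of_deriv_nonneg (convex_Icc t s)
      (fun x hx => (hD x (hsub hx)).continuousAt.continuousWithinAt)
      (fun x hx => (hD x (hsub (interior_subset hx))).differentiableAt.differentiableWithinAt)
      (fun x hx => ?_) (left_mem_Icc.2 hts) (right_mem_Icc.2 hts) hts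
    have hx' := interior_subset hx
    rw [(hD x (hsub hx')).deriv]
    linarith [hsl t ht x (hsub hx') hx'.1]
  · have hsub : Icc s t ⊆ Ioo a b := fun x hx => ⟨hs.1.trans_le hx.1, hx.2.trans_lt ht.2⟩
    refine antitoneOn_of_deriv_nonpos (convex_Icc s t)
      (fun x hx => (hD x (hsub hx)).continuousAt.continuousWithinAt)
      (fun x hx => (hD x (hsub (interior_subset hx))).differentiableAt.differentiableWithinAt)
      (fun x hx => ?_) (left_mem_Icc.2 hts) (right_mem_Icc.2 hts) hts
    have hx' := interior_subset hx
    rw [(hD x (hsub hx')).deriv]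
    linarith [hsl x (hsub hx') t ht hx'.2]

/-- The companion upper bound, by the same argument applied to `-p`. -/
lemma bregman_upper {p p' : ℝ → ℝ} {a b c : ℝ} {s t : ℝ} (hs : s ∈ Ioo a b) (ht : t ∈ Ioo a b)
    (hd : ∀ x ∈ Ioo a b, HasDerivAt p (p' x) x)
    (hsl : ∀ x ∈ Ioo a b, ∀ y ∈ Ioo a b, x ≤ y → p' y - p' x ≤ c * (y - x)) :
    p s ≤ p t + p' t * (s - t) + c / 2 * (s - t) ^ 2 := by
  have := bregman_lower (p := fun x => -p x) (p' := fun x => -p' x) (c := -c) hs ht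
    (fun x hx => (hd x hx).neg) (fun x hx y hy hxy => by linarith [hsl x hx y hy hxy])
  linarith

/-- The convex conjugate of a divergence generator has the local properties used below. Its slope at
`0` is `1` because `t ≤ ψ(t)` with equality at `0`, as `f 1 = 0`; the two-point slope condition is
strict differentiability of `ψ'` at `0`. -/
lemma exists_isLocalConjugate {f : ℝ → ℝ≥0∞} (h1 : f 1 = 0)
    (hfin : ∀ᶠ t in 𝓝 (0 : ℝ), conjugate f t ≠ ⊤)
    (hC2 : ContDiffAt ℝ 2 (fun t => (conjugate f t).toReal) 0)
    (hnorm : iteratedDeriv 2 (fun t => (conjugate f t).toReal) 0 = 1) :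
    ∃ r κ, IsLocalConjugate (conjugate f) r κ := by
  set p : ℝ → ℝ := fun t => (conjugate f t).toReal with hp
  have hcoe : ∀ᶠ t in 𝓝 (0 : ℝ), conjugate f t = (p t : EReal) :=
    hfin.mono fun t ht => (EReal.coe_toReal ht (conjugate_ne_bot h1 t)).symm
  have hp0 : p 0 = 0 := by simp [hp, conjugate_zero h1]
  have hdiff : ∀ᶠ t in 𝓝 (0 : ℝ), DifferentiableAt ℝ p t := by
    have := (hC2.of_le (m := 1) (by norm_num)).eventually (by simp)
    exact this.mono fun t ht => ht.differentiableAt (by simp)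
  have hd1 : deriv p 0 = 1 := by
    have hmin : IsLocalMin (fun t => p t - t) 0 := by
      filter_upwards [hcoe] with t ht
      have := self_le_conjugate h1 t
      rw [ht, EReal.coe_le_coe_iff] at this
      simp only [hp0]; linarith
    have h := hmin.hasDerivAt_eq_zero ((hdiff.self_of_nhds.hasDerivAt).sub (hasDerivAt_id 0))
    linarith
  have hstrict : HasStrictDerivAt (deriv p) 1 0 := by
    have h2 : ContDiffAt ℝ 1 (deriv p) 0 := hC2.derivWithin (by norm_num)
    have h3 := h2.hasStrictDerivAt (by simp)
    have h4 : deriv (deriv p) 0 = 1 := by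
      rw [← hnorm, iteratedDeriv_succ, iteratedDeriv_one]
    rwa [h4] at h3
  have hsl : ∀ ε > 0, ∀ᶠ q : ℝ × ℝ in 𝓝 ((0 : ℝ), (0 : ℝ)),
      |deriv p q.1 - deriv p q.2 - (q.1 - q.2)| ≤ ε * |q.1 - q.2| := by
    intro ε hε
    have := (hstrict.hasStrictFDerivAt.isLittleO).def hε
    filter_upwards [this] with q hq
    simpa [Real.norm_eq_abs] using hq
  obtain ⟨r1, hr1, H1⟩ := Metric.eventually_nhds_iff.1 (hcoe.and hdiff)
  obtain ⟨r2, hr2, H2⟩ := Metric.eventually_nhds_iff.1 (hsl (1 / 2) (by norm_num))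
  set r0 := min (min r1 r2) 1 with hr0
  have hr0pos : 0 < r0 := by positivity
  have hr01 : r0 ≤ r1 := (min_le_left _ _).trans (min_le_left _ _)
  have hr02 : r0 ≤ r2 := (min_le_left _ _).trans (min_le_right _ _)
  have hcoe' : ∀ t, |t| < r0 → conjugate f t = (p t : EReal) := fun t ht =>
    (H1 (by simpa [Real.dist_eq] using ht.trans_le hr01)).1
  have hdiff' : ∀ t, |t| < r0 → DifferentiableAt ℝ p t := fun t ht =>
    (H1 (by simpa [Real.dist_eq] using ht.trans_le hr01)).2
  have hslope' : ∀ s t, |s| < r0 → |t| < r0 → |deriv p s - deriv p t - (s - t)| ≤ |s - t| / 2 := by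
    intro s t hs ht
    have := @H2 (s, t) (by
      rw [Prod.dist_eq]; simp [hs.trans_le hr02, ht.trans_le hr02])
    simp only at this
    linarith
  have hlow : ∀ s t, |s| < r0 → |t| < r0 →
      p t + deriv p t * (s - t) + 1 / 4 * (s - t) ^ 2 ≤ p s := by
    intro s t hs ht
    have := bregman_lower (p := p) (p' := deriv p) (a := -r0) (b := r0) (c := 1 / 2)
      (abs_lt.1 hs) (abs_lt.1 ht) (fun x hx => (hdiff' x (abs_lt.2 hx)).hasDerivAt)
      (fun x hx y hy hxy => by
        have := hslope' y x (abs_lt.2 hy) (abs_lt.2 hx)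
        rw [abs_of_nonneg (sub_nonneg.2 hxy)] at this
        linarith [(abs_le.1 this).1])
    linarith
  refine ⟨r0 / 2, r0 / 8, by positivity, by have : r0 ≤ 1 := min_le_right _ _; linarith,
    by positivity, measurable_conjugate f, fun t ht => hcoe' t (by linarith),
    fun t ht => hdiff' t (by linarith), hp0, hd1,
    fun s t hs ht => hslope' s t (by linarith) (by linarith), ?_, ?_⟩
  · intro ε hε
    obtain ⟨δ, hδ, H⟩ := Metric.eventually_nhds_iff.1 (hsl ε hε)
    refine ⟨δ, hδ, fun t ht => ?_⟩
    have := @H (t, 0) (by rw [Prod.dist_eq]; simp [ht])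
    simpa [hd1] using this
  · intro t ht w
    rcases lt_or_ge |w| (r0 / 2) with hw | hw
    · have htw : |t + w| < r0 := (abs_add_le _ _).trans_lt (by linarith)
      rw [hcoe' _ htw, EReal.coe_le_coe_iff]
      have h2 := hlow (t + w) t htw (by linarith)
      have h3 : min (w ^ 2) |w| ≤ w ^ 2 := min_le_left _ _
      have : r0 ≤ 1 := min_le_right _ _
      have h4 : 0 ≤ w ^ 2 := sq_nonneg w
      simp only [add_sub_cancel_left] at h2
      nlinarith
    · -- far away, convexity along the segment from `t` through a point at distance `r0 / 2`
      rcases eq_or_ne (conjugate f (t + w)) ⊤ with htop | htop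
      · rw [htop]; exact le_top
      have hc := (EReal.coe_toReal htop (conjugate_ne_bot h1 (t + w))).symm
      rw [hc, EReal.coe_le_coe_iff]
      have hwpos : 0 < |w| := lt_of_lt_of_le (by positivity) hw
      obtain ⟨a, haw⟩ : ∃ a, a = (r0 / 2) / |w| := ⟨_, rfl⟩
      have ha0 : 0 < a := by rw [haw]; positivity
      have ha1 : a ≤ 1 := by rw [haw, div_le_one hwpos]; exact hw
      have haabs : |a * w| = r0 / 2 := by
        rw [abs_mul, abs_of_pos ha0, haw, div_mul_cancel₀ _ hwpos.ne']
      have hmid : |t + a * w| < r0 := (abs_add_le _ _).trans_lt (by linarith)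
      have hconv := conjugate_convex f (s := t) (t := t + w) (a := a) ha0.le ha1
        (hcoe' t (by linarith)) hc
        (by rw [show (1 - a) * t + a * (t + w) = t + a * w by ring]; exact hcoe' _ hmid)
      have h2 := hlow (t + a * w) t hmid (by linarith)
      have h3 : min (w ^ 2) |w| ≤ |w| := min_le_right _ _
      have h5 : (a * w) ^ 2 = (r0 / 2) * (a * |w|) := by
        rw [← sq_abs, haabs, ← haabs, abs_mul, abs_of_pos ha0]; ring
      simp only [add_sub_cancel_left] at h2
      rw [h5] at h2
      have h6 : a * (p t + deriv p t * w + 1 / 4 * (r0 / 2) * |w|) ≤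
          a * (conjugate f (t + w)).toReal := by nlinarith
      have h7 := le_of_mul_le_mul_left h6 ha0
      have h8 := mul_le_mul_of_nonneg_left h3 hr0pos.le
      show p t + deriv p t * w + r0 / 8 * min (w ^ 2) |w| ≤ (conjugate f (t + w)).toReal
      linarith

/-! ### Consequences of the local behaviour -/

section

variable {ψ : ℝ → EReal} {r κ : ℝ}

lemma IsLocalConjugate.abs_deriv_le (h : IsLocalConjugate ψ r κ) {t : ℝ} (ht : |t| < r) :
    |deriv (fun t => (ψ t).toReal) t| ≤ 2 := by
  have := h.slope t 0 ht (by simpa using h.r_pos)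
  rw [h.deriv_zero, sub_zero] at this
  have h2 := h.r_le
  rw [abs_le] at this ⊢
  rw [abs_lt] at ht
  have h3 : |t| ≤ r := (abs_lt.2 ht).le
  constructor <;> linarith [this.1, this.2]

lemma IsLocalConjugate.abs_le (h : IsLocalConjugate ψ r κ) {t : ℝ} (ht : |t| < r) :
    |(ψ t).toReal| ≤ 2 * |t| := by
  have := (convex_Ioo (-r) r).norm_image_sub_le_of_norm_deriv_le (f := fun t => (ψ t).toReal)
    (C := 2) (x := 0) (y := t) (fun x hx => h.diff x (abs_lt.2 hx))
    (fun x hx => by simpa using h.abs_deriv_le (abs_lt.2 hx))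
    ⟨by linarith [h.r_pos], h.r_pos⟩ (abs_lt.1 ht)
  simpa [h.zero] using this

lemma IsLocalConjugate.abs_deriv_sub_le (h : IsLocalConjugate ψ r κ) {s t : ℝ} (hs : |s| < r)
    (ht : |t| < r) :
    |deriv (fun t => (ψ t).toReal) s - deriv (fun t => (ψ t).toReal) t| ≤ 2 * |s - t| := by
  have := h.slope s t hs ht
  have h2 := abs_add_le
    (deriv (fun t => (ψ t).toReal) s - deriv (fun t => (ψ t).toReal) t - (s - t)) (s - t)
  rw [sub_add_cancel] at h2
  linarith [abs_nonneg (s - t)]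

lemma IsLocalConjugate.upper (h : IsLocalConjugate ψ r κ) {t w : ℝ} (ht : |t| < r)
    (htw : |t + w| < r) :
    (ψ (t + w)).toReal ≤
      (ψ t).toReal + deriv (fun t => (ψ t).toReal) t * w + w ^ 2 := by
  have := bregman_upper (p := fun t => (ψ t).toReal) (p' := deriv (fun t => (ψ t).toReal))
    (a := -r) (b := r) (c := 3 / 2) (abs_lt.1 htw) (abs_lt.1 ht)
    (fun x hx => (h.diff x (abs_lt.2 hx)).hasDerivAt)
    (fun x hx y hy hxy => by
      have := h.slope y x (abs_lt.2 hy) (abs_lt.2 hx)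
      rw [abs_of_nonneg (sub_nonneg.2 hxy)] at this
      linarith [(_root_.abs_le.1 this).2])
  simp only [add_sub_cancel_left] at this
  nlinarith [sq_nonneg w]

end

/-! ### The extended integral -/

lemma extIntegral_mono {g h : ℝ → EReal} (hgh : ∀ y, g y ≤ h y) :
    extIntegral g ≤ extIntegral h := by
  refine EReal.sub_le_sub ?_ ?_
  · exact EReal.coe_ennreal_le_coe_ennreal_iff.2
      (lintegral_mono fun y => EReal.toENNReal_le_toENNReal (hgh y))
  · exact EReal.coe_ennreal_le_coe_ennreal_iff.2
      (lintegral_mono fun y => EReal.toENNReal_le_toENNReal (EReal.neg_le_neg_iff.2 (hgh y)))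

lemma extIntegral_coe {g : ℝ → ℝ} (hg : Integrable g) :
    extIntegral (fun y => (g y : EReal)) = ((∫ y, g y : ℝ) : EReal) := by
  have hfin1 : ∫⁻ y, ENNReal.ofReal (g y) ≠ ∞ := hg.lintegral_lt_top.ne
  have hfin2 : ∫⁻ y, ENNReal.ofReal (-g y) ≠ ∞ := hg.neg.lintegral_lt_top.ne
  rw [integral_eq_lintegral_pos_part_sub_lintegral_neg_part hg, extIntegral, EReal.coe_sub,
    EReal.coe_ennreal_toReal hfin1, EReal.coe_ennreal_toReal hfin2]
  congr 2

end

section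

/-! ### Plug-in minimax problems -/

/-- Functions with values in `[0, 1]` at finite `L¹` distance from `F₀`. -/
structure Admissible (F₀ F : ℝ → ℝ) : Prop where
  meas : Measurable F
  mem : ∀ y, F y ∈ Icc (0 : ℝ) 1
  int : Integrable (fun y => F y - F₀ y)

/-- The data of a minimax problem `inf_φ sup_ξ` with criterion
`H(φ, ξ) = ξᵗ M(φ) - ∫ ψ(ξᵗ k(T(F, φ)(y))) dy`, where `F` is a nuisance function to be replaced by
an estimator of `F₀`. The transform `T` is differentiable in `φ` near `φ₀`, uniformly bounded, and
`L¹`-continuous in `(F, φ)` at `(F₀, φ₀)` together with its derivative. -/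
structure PluginProblem (ι : Type) [Fintype ι] (q : ℕ) where
  /-- the transform `T(F, φ)` of the nuisance function -/
  T : (ℝ → ℝ) → EuclideanSpace ℝ ι → ℝ → ℝ
  /-- the true nuisance function -/
  F₀ : ℝ → ℝ
  /-- the true parameter -/
  φ₀ : EuclideanSpace ℝ ι
  /-- the constraint function -/
  M : EuclideanSpace ℝ ι → EuclideanSpace ℝ (Fin q)
  /-- the kernels of the constraints -/
  k : Fin q → ℝ → ℝ
  /-- the convex function -/
  ψ : ℝ → EReal
  /-- radius of the neighbourhood of `φ₀` on which the assumptions hold -/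
  ρ : ℝ
  /-- bound on the values of `T` -/
  R : ℝ
  /-- Lipschitz constant of `T` in the nuisance function -/
  C : ℝ
  /-- bound on the kernels, their derivatives, and the Lipschitz constants of these -/
  B : ℝ
  /-- radius of the neighbourhood of `0` on which `ψ` is controlled -/
  r : ℝ
  /-- constant of the Huber type lower bound on `ψ` -/
  κ : ℝ
  /-- envelope of the derivative of `T` at `F₀` -/
  g : ℝ → ℝ
  hψ : IsLocalConjugate ψ r κ
  ρ_pos : 0 < ρ
  B_nonneg : 0 ≤ B
  F₀_meas : Measurable F₀
  F₀_mem : ∀ y, F₀ y ∈ Icc (0 : ℝ) 1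
  g_int : Integrable g
  T_meas : ∀ F, Admissible F₀ F → ∀ φ ∈ Metric.ball φ₀ ρ, Measurable (T F φ)
  T_bound : ∀ F, Admissible F₀ F → ∀ φ ∈ Metric.ball φ₀ ρ, ∀ y, |T F φ y| ≤ R
  T_diff : ∀ F, Admissible F₀ F → ∀ φ ∈ Metric.ball φ₀ ρ, ∀ y,
    DifferentiableAt ℝ (fun φ => T F φ y) φ
  T_deriv_le : ∀ F, Admissible F₀ F → ∀ φ ∈ Metric.ball φ₀ ρ, ∀ y,
    ‖fderiv ℝ (fun φ => T F φ y) φ‖ ≤ C * |F y - F₀ y| + g y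
  T_base : ∀ F, Admissible F₀ F → ∀ y, |T F φ₀ y - T F₀ φ₀ y| ≤ C * |F y - F₀ y|
  T_cont : ∀ v, ∃ (η : EuclideanSpace ℝ ι → ℝ) (L : ℝ), Tendsto η (𝓝 φ₀) (𝓝 0) ∧
    ∀ F, Admissible F₀ F → ∀ φ ∈ Metric.ball φ₀ ρ,
      ∫ y, |fderiv ℝ (fun φ => T F φ y) φ v - fderiv ℝ (fun φ => T F₀ φ y) φ₀ v| ≤
        L * (∫ y, |F y - F₀ y|) + η φ
  k_diff : ∀ i, ContDiff ℝ 1 (k i)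
  k_bound : ∀ i u, |u| ≤ R → |k i u| ≤ B
  dk_bound : ∀ i u, |u| ≤ R → |deriv (k i) u| ≤ B
  dk_lip : ∀ i u v, |u| ≤ R → |v| ≤ R → |deriv (k i) u - deriv (k i) v| ≤ B * |u - v|
  k_int : ∀ i, Integrable (fun y => k i (T F₀ φ₀ y))
  M_diff : ∀ φ ∈ Metric.ball φ₀ ρ, DifferentiableAt ℝ M φ
  M_cont : ContinuousAt (fderiv ℝ M) φ₀

namespace PluginProblem

variable {ι : Type} [Fintype ι] {q : ℕ} (S : PluginProblem ι q)

/-- The real-valued version of `ψ`. -/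
def psi (t : ℝ) : ℝ := (S.ψ t).toReal

/-- The `L¹` distance to the true nuisance function. -/
def dist₀ (F : ℝ → ℝ) : ℝ := ∫ y, |F y - S.F₀ y|

/-- The linear combination `ξᵗ k(u)`. -/
def lin (ξ : EuclideanSpace ℝ (Fin q)) (u : ℝ) : ℝ := ∑ i, ξ i * S.k i u

/-- The envelope `C |F - F₀| + g` of the derivative of `T`. -/
def env (F : ℝ → ℝ) (y : ℝ) : ℝ := S.C * |F y - S.F₀ y| + S.g y

/-- The derivative of `T(F, φ)(y)` in `φ`. -/
def D (F : ℝ → ℝ) (φ : EuclideanSpace ℝ ι) (y : ℝ) : EuclideanSpace ℝ ι →L[ℝ] ℝ :=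
  fderiv ℝ (fun φ => S.T F φ y) φ

/-- The criterion, with values in the extended reals. -/
def crit (F : ℝ → ℝ) (φ : EuclideanSpace ℝ ι) (ξ : EuclideanSpace ℝ (Fin q)) : EReal :=
  ((∑ i, ξ i * S.M φ i : ℝ) : EReal) - extIntegral fun y => S.ψ (∑ i, ξ i * S.k i (S.T F φ y))

/-- The criterion as a real number, meaningful near `(φ₀, 0)`. -/
def h (F : ℝ → ℝ) (φ : EuclideanSpace ℝ ι) (ξ : EuclideanSpace ℝ (Fin q)) : ℝ :=
  ∑ i, ξ i * S.M φ i - ∫ y, S.psi (S.lin ξ (S.T F φ y))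

/-- The partial gradient of the criterion in `ξ`. -/
def N (F : ℝ → ℝ) (φ : EuclideanSpace ℝ ι) (ξ : EuclideanSpace ℝ (Fin q)) (i : Fin q) : ℝ :=
  S.M φ i - ∫ y, deriv S.psi (S.lin ξ (S.T F φ y)) * S.k i (S.T F φ y)

/-- The residual `M(φ₀) - ∫ k(T(F, φ₀))` of the constraints at the true parameter. -/
def res (F : ℝ → ℝ) (i : Fin q) : ℝ := S.M S.φ₀ i - ∫ y, S.k i (S.T F S.φ₀ y)

/-- The derivative at `φ₀` of `M(φ) - ∫ k(T(F₀, φ))`. -/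
def Jlin (i : Fin q) (v : EuclideanSpace ℝ ι) : ℝ :=
  fderiv ℝ S.M S.φ₀ v i - ∫ y, deriv (S.k i) (S.T S.F₀ S.φ₀ y) * S.D S.F₀ S.φ₀ y v

/-- The Gram matrix `∫ k kᵗ` of the kernels at the truth. -/
def A : Matrix (Fin q) (Fin q) ℝ :=
  Matrix.of fun i j => ∫ y, S.k i (S.T S.F₀ S.φ₀ y) * S.k j (S.T S.F₀ S.φ₀ y)

/-- Radius of the multipliers `ξ` for which `ξᵗ k` stays where `ψ` is controlled. -/
def r₁ : ℝ := S.r / (q * S.B + 1)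

variable {S} {F : ℝ → ℝ} {φ φ' : EuclideanSpace ℝ ι} {ξ : EuclideanSpace ℝ (Fin q)}

lemma admissible_F₀ : Admissible S.F₀ S.F₀ := ⟨S.F₀_meas, S.F₀_mem, by simp⟩

lemma φ₀_mem : S.φ₀ ∈ Metric.ball S.φ₀ S.ρ := Metric.mem_ball_self S.ρ_pos

lemma dist₀_nonneg : 0 ≤ S.dist₀ F := integral_nonneg fun _ => abs_nonneg _

lemma integrable_env (hF : Admissible S.F₀ F) : Integrable (S.env F) :=
  (hF.int.abs.const_mul S.C).add S.g_int

lemma integral_env (hF : Admissible S.F₀ F) :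
    ∫ y, S.env F y = S.C * S.dist₀ F + ∫ y, S.g y := by
  unfold env dist₀
  rw [integral_add (hF.int.abs.const_mul S.C) S.g_int, integral_const_mul]

lemma T_lip (hF : Admissible S.F₀ F) (hφ : φ ∈ Metric.ball S.φ₀ S.ρ)
    (hφ' : φ' ∈ Metric.ball S.φ₀ S.ρ) (y : ℝ) :
    |S.T F φ y - S.T F φ' y| ≤ S.env F y * ‖φ - φ'‖ := by
  have := (convex_ball S.φ₀ S.ρ).norm_image_sub_le_of_norm_fderiv_le
    (f := fun φ => S.T F φ y) (fun x hx => S.T_diff F hF x hx y)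
    (fun x hx => S.T_deriv_le F hF x hx y) hφ' hφ
  simpa [env] using this

lemma T_near (hF : Admissible S.F₀ F) (hφ : φ ∈ Metric.ball S.φ₀ S.ρ) (y : ℝ) :
    |S.T F φ y - S.T S.F₀ S.φ₀ y| ≤ S.env F y * ‖φ - S.φ₀‖ + S.C * |F y - S.F₀ y| := by
  have h1 := T_lip hF hφ φ₀_mem y
  have h2 := S.T_base F hF y
  have h3 := abs_add_le (S.T F φ y - S.T F S.φ₀ y) (S.T F S.φ₀ y - S.T S.F₀ S.φ₀ y)
  rw [sub_add_sub_cancel] at h3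
  linarith

lemma integrable_T_sub (hF : Admissible S.F₀ F) (hφ : φ ∈ Metric.ball S.φ₀ S.ρ) :
    Integrable (fun y => S.T F φ y - S.T S.F₀ S.φ₀ y) := by
  refine Integrable.mono' (((integrable_env hF).mul_const ‖φ - S.φ₀‖).add
    (hF.int.abs.const_mul S.C)) ?_ (ae_of_all _ fun y => ?_)
  · exact ((S.T_meas F hF φ hφ).sub
      (S.T_meas _ admissible_F₀ _ φ₀_mem)).aestronglyMeasurable
  · simpa using T_near hF hφ y

lemma integral_T_sub_le (hF : Admissible S.F₀ F) (hφ : φ ∈ Metric.ball S.φ₀ S.ρ) :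
    ∫ y, |S.T F φ y - S.T S.F₀ S.φ₀ y| ≤
      (S.C * S.dist₀ F + ∫ y, S.g y) * ‖φ - S.φ₀‖ + S.C * S.dist₀ F := by
  refine (integral_mono (integrable_T_sub hF hφ).abs
    (((integrable_env hF).mul_const ‖φ - S.φ₀‖).add (hF.int.abs.const_mul S.C))
    (fun y => T_near hF hφ y)).trans_eq ?_
  rw [← integral_env hF]
  simp only [Pi.add_apply]
  rw [integral_add ((integrable_env hF).mul_const _) (hF.int.abs.const_mul S.C),
    integral_mul_const, integral_const_mul, dist₀]

lemma hasDerivAt_k (i : Fin q) (u : ℝ) : HasDerivAt (S.k i) (deriv (S.k i) u) u :=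
  ((S.k_diff i).differentiable (by simp) u).hasDerivAt

lemma continuous_deriv_k (i : Fin q) : Continuous (deriv (S.k i)) :=
  (S.k_diff i).continuous_deriv (by simp)

lemma k_lip (i : Fin q) {u v : ℝ} (hu : |u| ≤ S.R) (hv : |v| ≤ S.R) :
    |S.k i u - S.k i v| ≤ S.B * |u - v| := by
  have := (convex_Icc (-S.R) S.R).norm_image_sub_le_of_norm_deriv_le (f := S.k i)
    (C := S.B) (x := v) (y := u) (fun x _ => (hasDerivAt_k i x).differentiableAt)
    (fun x hx => by simpa using S.dk_bound i x (abs_le.2 hx)) (abs_le.1 hv) (abs_le.1 hu)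
  simpa using this

/-- The second-order Taylor bound for the kernels. -/
lemma k_taylor (i : Fin q) {u v : ℝ} (hu : |u| ≤ S.R) (hv : |v| ≤ S.R) :
    |S.k i u - S.k i v - deriv (S.k i) v * (u - v)| ≤ S.B * |u - v| ^ 2 := by
  have hsub : uIcc v u ⊆ Icc (-S.R) S.R := by
    exact uIcc_subset_Icc (abs_le.1 hv) (abs_le.1 hu)
  have := (convex_uIcc v u).norm_image_sub_le_of_norm_deriv_le
    (f := fun x => S.k i x - deriv (S.k i) v * x)
    (C := S.B * |u - v|) (x := v) (y := u)
    (fun x _ => by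
      exact ((hasDerivAt_k i x).sub ((hasDerivAt_id x).const_mul _)).differentiableAt)
    (fun x hx => by
      have h1 : HasDerivAt (fun x => S.k i x - deriv (S.k i) v * x)
          (deriv (S.k i) x - deriv (S.k i) v) x := by
        exact ((hasDerivAt_k i x).sub
          ((hasDerivAt_id x).const_mul (deriv (S.k i) v))).congr_deriv (by simp)
      rw [h1.deriv]
      refine (S.dk_lip i x v (abs_le.2 (hsub hx)) hv).trans ?_
      exact mul_le_mul_of_nonneg_left (abs_sub_left_of_mem_uIcc hx) S.B_nonneg)
    left_mem_uIcc right_mem_uIcc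
  simp only [Real.norm_eq_abs] at this
  calc _ = |S.k i u - deriv (S.k i) v * u - (S.k i v - deriv (S.k i) v * v)| := by ring_nf
    _ ≤ _ := this
    _ = _ := by ring

lemma measurable_k_T (hF : Admissible S.F₀ F) (hφ : φ ∈ Metric.ball S.φ₀ S.ρ) (i : Fin q) :
    Measurable (fun y => S.k i (S.T F φ y)) :=
  (S.k_diff i).continuous.measurable.comp (S.T_meas F hF φ hφ)

lemma integrable_k_sub (hF : Admissible S.F₀ F) (hφ : φ ∈ Metric.ball S.φ₀ S.ρ) (i : Fin q) :
    Integrable (fun y => S.k i (S.T F φ y) - S.k i (S.T S.F₀ S.φ₀ y)) := by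
  refine Integrable.mono' ((integrable_T_sub hF hφ).abs.const_mul S.B)
    ((measurable_k_T hF hφ i).sub
      (measurable_k_T admissible_F₀ φ₀_mem i)).aestronglyMeasurable (ae_of_all _ fun y => ?_)
  exact k_lip i (S.T_bound F hF φ hφ y) (S.T_bound _ admissible_F₀ _ φ₀_mem y)

lemma integrable_k (hF : Admissible S.F₀ F) (hφ : φ ∈ Metric.ball S.φ₀ S.ρ) (i : Fin q) :
    Integrable (fun y => S.k i (S.T F φ y)) := by
  exact ((integrable_k_sub hF hφ i).add (S.k_int i)).congr (ae_of_all _ fun y => by simp)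

lemma integrable_k_mul (hF : Admissible S.F₀ F) (hφ : φ ∈ Metric.ball S.φ₀ S.ρ) (i j : Fin q) :
    Integrable (fun y => S.k i (S.T F φ y) * S.k j (S.T F φ y)) :=
  (integrable_k hF hφ j).bdd_mul (measurable_k_T hF hφ i).aestronglyMeasurable
    (ae_of_all _ fun y => S.k_bound i _ (S.T_bound F hF φ hφ y))

lemma abs_apply_le_norm (ξ : EuclideanSpace ℝ (Fin q)) (i : Fin q) : |ξ i| ≤ ‖ξ‖ := by
  simpa using PiLp.norm_apply_le ξ i

lemma abs_lin_le (ξ : EuclideanSpace ℝ (Fin q)) {u : ℝ} (hu : |u| ≤ S.R) :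
    |S.lin ξ u| ≤ q * S.B * ‖ξ‖ := by
  refine (Finset.abs_sum_le_sum_abs _ _).trans ?_
  refine (Finset.sum_le_sum (g := fun _ => ‖ξ‖ * S.B) fun i _ => ?_).trans_eq ?_
  · rw [abs_mul]
    exact mul_le_mul (abs_apply_le_norm ξ i) (S.k_bound i u hu) (abs_nonneg _) (norm_nonneg _)
  · simp; ring

lemma r₁_pos : 0 < S.r₁ := div_pos S.hψ.r_pos (by have := S.B_nonneg; positivity)

lemma abs_lin_lt (hξ : ‖ξ‖ < S.r₁) {u : ℝ} (hu : |u| ≤ S.R) : |S.lin ξ u| < S.r := by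
  have hB : 0 ≤ (q : ℝ) * S.B := by have := S.B_nonneg; positivity
  refine (abs_lin_le ξ hu).trans_lt ?_
  rw [r₁, lt_div_iff₀ (by positivity)] at hξ
  nlinarith [norm_nonneg ξ]

lemma lin_add (ξ w : EuclideanSpace ℝ (Fin q)) (u : ℝ) :
    S.lin (ξ + w) u = S.lin ξ u + S.lin w u := by
  simp [lin, add_mul, Finset.sum_add_distrib]

lemma lin_smul (c : ℝ) (w : EuclideanSpace ℝ (Fin q)) (u : ℝ) :
    S.lin (c • w) u = c * S.lin w u := by
  simp [lin, Finset.mul_sum, mul_assoc]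

lemma lin_zero (u : ℝ) : S.lin 0 u = 0 := by simp [lin]

lemma hasDerivAt_lin (ξ : EuclideanSpace ℝ (Fin q)) (u : ℝ) :
    HasDerivAt (S.lin ξ) (∑ i, ξ i * deriv (S.k i) u) u := by
  unfold lin
  exact HasDerivAt.fun_sum fun i _ => (hasDerivAt_k i u).const_mul _

lemma measurable_psi : Measurable S.psi := S.hψ.meas.ereal_toReal

lemma measurable_lin_T (hF : Admissible S.F₀ F) (hφ : φ ∈ Metric.ball S.φ₀ S.ρ)
    (ξ : EuclideanSpace ℝ (Fin q)) : Measurable (fun y => S.lin ξ (S.T F φ y)) :=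
  Finset.measurable_fun_sum _ fun i _ => (measurable_k_T hF hφ i).const_mul _

lemma integrable_lin (hF : Admissible S.F₀ F) (hφ : φ ∈ Metric.ball S.φ₀ S.ρ)
    (ξ : EuclideanSpace ℝ (Fin q)) : Integrable (fun y => S.lin ξ (S.T F φ y)) :=
  integrable_finsetSum _ fun i _ => (integrable_k hF hφ i).const_mul _

lemma integrable_lin_sq (hF : Admissible S.F₀ F) (hφ : φ ∈ Metric.ball S.φ₀ S.ρ)
    (ξ : EuclideanSpace ℝ (Fin q)) : Integrable (fun y => S.lin ξ (S.T F φ y) ^ 2) := by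
  simp only [sq]
  exact (integrable_lin hF hφ ξ).bdd_mul (measurable_lin_T hF hφ ξ).aestronglyMeasurable
    (ae_of_all _ fun y => abs_lin_le ξ (S.T_bound F hF φ hφ y))

lemma integrable_psi (hF : Admissible S.F₀ F) (hφ : φ ∈ Metric.ball S.φ₀ S.ρ) (hξ : ‖ξ‖ < S.r₁) :
    Integrable (fun y => S.psi (S.lin ξ (S.T F φ y))) := by
  refine Integrable.mono' ((integrable_lin hF hφ ξ).abs.const_mul 2)
    (measurable_psi.comp (measurable_lin_T hF hφ ξ)).aestronglyMeasurable (ae_of_all _ fun y => ?_)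
  exact S.hψ.abs_le (abs_lin_lt hξ (S.T_bound F hF φ hφ y))

lemma integrable_deriv_psi_mul (hF : Admissible S.F₀ F) (hφ : φ ∈ Metric.ball S.φ₀ S.ρ)
    (hξ : ‖ξ‖ < S.r₁) {a : ℝ → ℝ} (ha : Integrable a) :
    Integrable (fun y => deriv S.psi (S.lin ξ (S.T F φ y)) * a y) :=
  ha.bdd_mul ((measurable_deriv _).comp (measurable_lin_T hF hφ ξ)).aestronglyMeasurable
    (ae_of_all _ fun y => S.hψ.abs_deriv_le (abs_lin_lt hξ (S.T_bound F hF φ hφ y)))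

lemma crit_eq (hF : Admissible S.F₀ F) (hφ : φ ∈ Metric.ball S.φ₀ S.ρ) (hξ : ‖ξ‖ < S.r₁) :
    S.crit F φ ξ = (S.h F φ ξ : EReal) := by
  have h1 : (fun y => S.ψ (∑ i, ξ i * S.k i (S.T F φ y))) =
      fun y => ((S.psi (S.lin ξ (S.T F φ y)) : ℝ) : EReal) :=
    funext fun y => S.hψ.coe _ (abs_lin_lt hξ (S.T_bound F hF φ hφ y))
  rw [crit, h1, extIntegral_coe (integrable_psi hF hφ hξ), h, EReal.coe_sub]

/-- Any pointwise lower bound of the integrand bounds the criterion from above, whether or not the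
criterion is finite. -/
lemma crit_le {a : ℝ → ℝ} (ha : Integrable a)
    (hle : ∀ y, (a y : EReal) ≤ S.ψ (S.lin ξ (S.T F φ y))) :
    S.crit F φ ξ ≤ ((∑ i, ξ i * S.M φ i - ∫ y, a y : ℝ) : EReal) := by
  rw [EReal.coe_sub, ← extIntegral_coe ha]
  exact EReal.sub_le_sub le_rfl (extIntegral_mono hle)

end PluginProblem

end

section

/-! ### Convergence of the coefficients of the estimating equations -/

/-- If `u_p → 0` in `L¹` along a filter while staying uniformly bounded, then `∫ |u_p d| → 0` for
every integrable `d`. -/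
lemma tendsto_integral_abs_mul_of_bounded {P : Type*} {l : Filter P} {u : P → ℝ → ℝ} {c : ℝ}
    (hu : ∀ᶠ p in l, Integrable (u p) ∧ ∀ y, |u p y| ≤ c)
    (hlim : Tendsto (fun p => ∫ y, |u p y|) l (𝓝 0)) {d : ℝ → ℝ} (hd : Integrable d) :
    Tendsto (fun p => ∫ y, |u p y| * |d y|) l (𝓝 0) := by
  -- truncate `d` at a high level `n`
  have htail : Tendsto (fun n : ℕ => ∫ y, {y | (n : ℝ) < |d y|}.indicator (fun y => |d y|) y) atTop
      (𝓝 0) := by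
    have := tendsto_integral_of_dominated_convergence (μ := volume)
      (F := fun (n : ℕ) y => {y | (n : ℝ) < |d y|}.indicator (fun y => |d y|) y)
      (f := fun _ => 0) (fun y => |d y|)
      (fun n => (hd.abs.aestronglyMeasurable).indicator₀
        (nullMeasurableSet_lt aemeasurable_const hd.abs.aemeasurable)) hd.abs
      (fun n => ae_of_all _ fun y => by
        by_cases h : y ∈ {y | (n : ℝ) < |d y|} <;> simp [h])
      (ae_of_all _ fun y => by
        refine tendsto_const_nhds.congr' ?_
        filter_upwards [eventually_ge_atTop ⌈|d y|⌉₊] with n hn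
        rw [indicator_of_notMem]
        simpa using Nat.ceil_le.1 hn)
    simpa using this
  rw [Metric.tendsto_nhds]
  intro ε hε
  have hc : 0 < |c| + 1 := by positivity
  obtain ⟨n, hn⟩ := (htail.eventually_lt_const
    (show (0 : ℝ) < ε / (2 * (|c| + 1)) by positivity)).exists
  have hn1 : (0 : ℝ) < n + 1 := by positivity
  filter_upwards [hu, hlim.eventually_lt_const (show (0 : ℝ) < ε / (2 * (n + 1)) by positivity)]
    with p hp hp2
  have hle : ∀ y, |u p y| * |d y| ≤
      n * |u p y| + (|c| + 1) * {y | (n : ℝ) < |d y|}.indicator (fun y => |d y|) y := by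
    intro y
    by_cases h : y ∈ {y | (n : ℝ) < |d y|}
    · rw [indicator_of_mem h]
      have h1 : |u p y| * |d y| ≤ (|c| + 1) * |d y| :=
        mul_le_mul_of_nonneg_right ((hp.2 y).trans (by linarith [le_abs_self c])) (abs_nonneg _)
      have h2 : 0 ≤ (n : ℝ) * |u p y| := by positivity
      linarith
    · rw [indicator_of_notMem h]
      have h1 : |d y| ≤ n := not_lt.1 h
      nlinarith [abs_nonneg (u p y)]
  have hind : Integrable ({y | (n : ℝ) < |d y|}.indicator (fun y => |d y|)) :=
    hd.abs.indicator₀ (nullMeasurableSet_lt aemeasurable_const hd.abs.aemeasurable)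
  have h0 : 0 ≤ ∫ y, |u p y| * |d y| := integral_nonneg fun y => by positivity
  rw [Real.dist_eq, sub_zero, abs_of_nonneg h0]
  have h1 : ∫ y, |u p y| * |d y| ≤ n * (∫ y, |u p y|) +
      (|c| + 1) * ∫ y, {y | (n : ℝ) < |d y|}.indicator (fun y => |d y|) y := by
    rw [← integral_const_mul, ← integral_const_mul, ← integral_add (hp.1.abs.const_mul _)
      (hind.const_mul _)]
    exact integral_mono_of_nonneg (ae_of_all _ fun y => by positivity)
      ((hp.1.abs.const_mul _).add (hind.const_mul _)) (ae_of_all _ hle)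
  have h2 : (|c| + 1) * ∫ y, {y | (n : ℝ) < |d y|}.indicator (fun y => |d y|) y < ε / 2 := by
    rw [lt_div_iff₀ (by positivity)] at hn
    linarith
  have h3 : n * (∫ y, |u p y|) ≤ ε / 2 := by
    rw [lt_div_iff₀ (by positivity)] at hp2
    have : 0 ≤ ∫ y, |u p y| := integral_nonneg fun y => abs_nonneg _
    nlinarith
  linarith

/-- The derivative at `0` of a family of measurable functions is measurable. -/
lemma measurable_of_hasDerivAt {f : ℝ → ℝ → ℝ} {f' : ℝ → ℝ}
    (hm : ∀ᶠ t in 𝓝 (0 : ℝ), Measurable (f t))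
    (hd : ∀ y, HasDerivAt (fun t => f t y) (f' y) 0) : Measurable f' := by
  obtain ⟨a, ha, H⟩ := Metric.eventually_nhds_iff.1 hm
  -- the derivative is a limit of difference quotients along the steps `a / (n + 2)`
  let t : ℕ → ℝ := fun n => a / (n + 2)
  have ht : ∀ n, 0 < t n := fun n => by positivity
  have hta : ∀ n, t n < a := fun n => by
    have : (0 : ℝ) ≤ n := by positivity
    rw [div_lt_iff₀ (by positivity)]
    nlinarith
  have hlim : Tendsto t atTop (𝓝[≠] 0) := by
    refine tendsto_nhdsWithin_iff.2 ⟨?_, Eventually.of_forall fun n => (ht n).ne'⟩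
    exact tendsto_const_nhds.div_atTop
      (tendsto_atTop_add_const_right _ _ tendsto_natCast_atTop_atTop)
  refine measurable_of_tendsto_metrizable
    (f := fun n y => (t n)⁻¹ • (f (t n) y - f 0 y)) (fun n => ?_) ?_
  · refine Measurable.const_mul ((H ?_).sub (H (by simpa using ha))) _
    simpa [abs_of_pos (ht n)] using hta n
  · rw [tendsto_pi_nhds]
    intro y
    simpa [Function.comp_def] using (hd y).tendsto_slope_zero.comp hlim

namespace PluginProblem

variable {ι : Type} [Fintype ι] {q : ℕ} (S : PluginProblem ι q)

/-- The filter of triples `(F, φ, ξ)` with `F` admissible and converging to `F₀` in `L¹`, `φ → φ₀`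
and `ξ → 0`. -/
def nhd : Filter ((ℝ → ℝ) × EuclideanSpace ℝ ι × EuclideanSpace ℝ (Fin q)) :=
  comap (fun p => (S.dist₀ p.1, p.2.1, p.2.2)) (𝓝 (0, S.φ₀, 0)) ⊓ 𝓟 {p | Admissible S.F₀ p.1}

variable {S} {F : ℝ → ℝ} {φ φ' : EuclideanSpace ℝ ι} {ξ : EuclideanSpace ℝ (Fin q)}

lemma eventually_nhd_iff {Q : (ℝ → ℝ) × EuclideanSpace ℝ ι × EuclideanSpace ℝ (Fin q) → Prop} :
    (∀ᶠ p in S.nhd, Q p) ↔ ∃ δ > 0, ∀ F φ ξ, Admissible S.F₀ F → S.dist₀ F < δ →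
      ‖φ - S.φ₀‖ < δ → ‖ξ‖ < δ → Q (F, φ, ξ) := by
  rw [nhd, eventually_inf_principal, eventually_comap, Metric.eventually_nhds_iff]
  refine exists_congr fun δ => and_congr_right fun hδ => ⟨fun H F φ ξ hF h1 h2 h3 => ?_,
    fun H x hx p hp hpF => ?_⟩
  · refine @H (S.dist₀ F, φ, ξ) ?_ (F, φ, ξ) rfl hF
    rw [Prod.dist_eq, Prod.dist_eq, max_lt_iff, max_lt_iff]
    simp only [dist_eq_norm, sub_zero, Real.norm_of_nonneg (dist₀_nonneg (S := S))]
    exact ⟨h1, h2, h3⟩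
  · rw [← hp, Prod.dist_eq, Prod.dist_eq, max_lt_iff, max_lt_iff] at hx
    simp only [dist_eq_norm, sub_zero, Real.norm_of_nonneg (dist₀_nonneg (S := S))] at hx
    exact H p.1 p.2.1 p.2.2 hpF hx.1 hx.2.1 hx.2.2

lemma eventually_admissible : ∀ᶠ p in S.nhd, Admissible S.F₀ p.1 :=
  mem_inf_of_right (mem_principal_self _)

lemma tendsto_nhd : Tendsto
    (fun p : (ℝ → ℝ) × EuclideanSpace ℝ ι × EuclideanSpace ℝ (Fin q) =>
      (S.dist₀ p.1, p.2.1, p.2.2)) S.nhd (𝓝 (0, S.φ₀, 0)) :=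
  tendsto_comap.mono_left inf_le_left

lemma tendsto_dist₀ : Tendsto
    (fun p : (ℝ → ℝ) × EuclideanSpace ℝ ι × EuclideanSpace ℝ (Fin q) => S.dist₀ p.1)
    S.nhd (𝓝 0) :=
  (continuous_fst.tendsto _).comp tendsto_nhd

lemma tendsto_par : Tendsto
    (fun p : (ℝ → ℝ) × EuclideanSpace ℝ ι × EuclideanSpace ℝ (Fin q) => p.2.1)
    S.nhd (𝓝 S.φ₀) :=
  ((continuous_fst.comp continuous_snd).tendsto _).comp (tendsto_nhd (S := S))

lemma tendsto_mult : Tendsto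
    (fun p : (ℝ → ℝ) × EuclideanSpace ℝ ι × EuclideanSpace ℝ (Fin q) => p.2.2)
    S.nhd (𝓝 0) :=
  ((continuous_snd.comp continuous_snd).tendsto _).comp (tendsto_nhd (S := S))

lemma tendsto_norm_mult : Tendsto
    (fun p : (ℝ → ℝ) × EuclideanSpace ℝ ι × EuclideanSpace ℝ (Fin q) => ‖p.2.2‖)
    S.nhd (𝓝 0) := by
  simpa using (tendsto_mult (S := S)).norm

lemma eventually_ball : ∀ᶠ p in S.nhd, p.2.1 ∈ Metric.ball S.φ₀ S.ρ :=
  tendsto_par (Metric.ball_mem_nhds _ S.ρ_pos)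

lemma eventually_lt_r₁ : ∀ᶠ p in S.nhd, ‖p.2.2‖ < S.r₁ :=
  tendsto_norm_mult.eventually_lt_const r₁_pos

lemma tendsto_integral_T_sub : Tendsto
    (fun p : (ℝ → ℝ) × EuclideanSpace ℝ ι × EuclideanSpace ℝ (Fin q) =>
      ∫ y, |S.T p.1 p.2.1 y - S.T S.F₀ S.φ₀ y|) S.nhd (𝓝 0) := by
  have h1 : Tendsto (fun p : (ℝ → ℝ) × EuclideanSpace ℝ ι × EuclideanSpace ℝ (Fin q) =>
      (S.C * S.dist₀ p.1 + ∫ y, S.g y) * ‖p.2.1 - S.φ₀‖ + S.C * S.dist₀ p.1) S.nhd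
      (𝓝 ((S.C * 0 + ∫ y, S.g y) * ‖S.φ₀ - S.φ₀‖ + S.C * 0)) :=
    (((tendsto_dist₀.const_mul _).add_const _).mul (tendsto_par.sub_const _).norm).add
      (tendsto_dist₀.const_mul _)
  simp only [sub_self, norm_zero, mul_zero, add_zero] at h1
  refine squeeze_zero' (Eventually.of_forall fun p => integral_nonneg fun y => abs_nonneg _) ?_ h1
  filter_upwards [eventually_admissible, eventually_ball] with p hp hb
  exact integral_T_sub_le hp hb

lemma exists_segment_mem_ball (hφ : φ ∈ Metric.ball S.φ₀ S.ρ) (v : EuclideanSpace ℝ ι) :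
    ∀ᶠ t : ℝ in 𝓝 0, φ + t • v ∈ Metric.ball S.φ₀ S.ρ := by
  have hc : Continuous fun t : ℝ => φ + t • v := by fun_prop
  exact hc.continuousAt (Metric.isOpen_ball.mem_nhds (by simpa using hφ))

lemma hasDerivAt_T_line (hF : Admissible S.F₀ F) {v : EuclideanSpace ℝ ι} {t : ℝ}
    (hφ : φ + t • v ∈ Metric.ball S.φ₀ S.ρ) (y : ℝ) :
    HasDerivAt (fun t : ℝ => S.T F (φ + t • v) y) (S.D F (φ + t • v) y v) t := by
  have h1 := (S.T_diff F hF _ hφ y).hasFDerivAt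
  have h2 : HasDerivAt (fun t : ℝ => φ + t • v) v t := by
    simpa using ((hasDerivAt_id t).smul_const v).const_add φ
  exact h1.comp_hasDerivAt t h2

lemma measurable_D (hF : Admissible S.F₀ F) (hφ : φ ∈ Metric.ball S.φ₀ S.ρ)
    (v : EuclideanSpace ℝ ι) : Measurable (fun y => S.D F φ y v) := by
  refine measurable_of_hasDerivAt (f := fun t y => S.T F (φ + t • v) y)
    ((exists_segment_mem_ball hφ v).mono fun t ht => S.T_meas F hF _ ht) fun y => ?_
  simpa using hasDerivAt_T_line hF (φ := φ) (v := v) (t := 0) (by simpa using hφ) y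

lemma abs_D_le (hF : Admissible S.F₀ F) (hφ : φ ∈ Metric.ball S.φ₀ S.ρ)
    (v : EuclideanSpace ℝ ι) (y : ℝ) : |S.D F φ y v| ≤ S.env F y * ‖v‖ :=
  ((S.D F φ y).le_opNorm v).trans
    (mul_le_mul_of_nonneg_right (S.T_deriv_le F hF φ hφ y) (norm_nonneg _))

lemma integrable_D (hF : Admissible S.F₀ F) (hφ : φ ∈ Metric.ball S.φ₀ S.ρ)
    (v : EuclideanSpace ℝ ι) : Integrable (fun y => S.D F φ y v) :=
  Integrable.mono' ((integrable_env hF).mul_const _) (measurable_D hF hφ v).aestronglyMeasurable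
    (ae_of_all _ (abs_D_le hF hφ v))

variable (S) in
/-- The integral part of the derivative of the partial gradient in `ξ` along `v`. -/
def G (F : ℝ → ℝ) (φ : EuclideanSpace ℝ ι) (ξ : EuclideanSpace ℝ (Fin q)) (i : Fin q)
    (v : EuclideanSpace ℝ ι) : ℝ :=
  ∫ y, deriv S.psi (S.lin ξ (S.T F φ y)) * (deriv (S.k i) (S.T F φ y) * S.D F φ y v)

lemma integrable_dk_mul (hF : Admissible S.F₀ F) (hφ : φ ∈ Metric.ball S.φ₀ S.ρ) (i : Fin q)
    (v : EuclideanSpace ℝ ι) :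
    Integrable (fun y => deriv (S.k i) (S.T F φ y) * S.D F φ y v) :=
  (integrable_D hF hφ v).bdd_mul
    ((continuous_deriv_k i).measurable.comp (S.T_meas F hF φ hφ)).aestronglyMeasurable
    (ae_of_all _ fun y => S.dk_bound i _ (S.T_bound F hF φ hφ y))

lemma deriv_psi_zero : deriv S.psi 0 = 1 := S.hψ.deriv_zero

lemma G_zero (i : Fin q) (v : EuclideanSpace ℝ ι) :
    S.G F φ 0 i v = ∫ y, deriv (S.k i) (S.T F φ y) * S.D F φ y v := by
  simp [G, lin_zero, deriv_psi_zero]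

lemma sum_single_eq (v : EuclideanSpace ℝ ι) [DecidableEq ι] :
    v = ∑ j, v j • EuclideanSpace.single j (1 : ℝ) := by
  ext j
  simp [Finset.sum_apply, Pi.single_apply]

lemma G_eq_sum [DecidableEq ι] (hF : Admissible S.F₀ F) (hφ : φ ∈ Metric.ball S.φ₀ S.ρ)
    (hξ : ‖ξ‖ < S.r₁) (i : Fin q) (v : EuclideanSpace ℝ ι) :
    S.G F φ ξ i v = ∑ j, v j * S.G F φ ξ i (EuclideanSpace.single j 1) := by
  simp only [G, ← integral_const_mul]
  rw [← integral_finsetSum _ fun j _ =>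
    (integrable_deriv_psi_mul hF hφ hξ (integrable_dk_mul hF hφ i _)).const_mul _]
  congr 1
  ext y
  conv_lhs => rw [sum_single_eq v, map_sum]
  simp only [map_smul, smul_eq_mul, Finset.mul_sum]
  exact Finset.sum_congr rfl fun j _ => by ring

lemma abs_deriv_psi_lin_sub_one_le (hξ : ‖ξ‖ < S.r₁) {u : ℝ} (hu : |u| ≤ S.R) :
    |deriv S.psi (S.lin ξ u) - 1| ≤ 2 * |S.lin ξ u| := by
  have := S.hψ.abs_deriv_sub_le (abs_lin_lt hξ hu) (t := 0) (by simpa using S.hψ.r_pos)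
  rw [S.hψ.deriv_zero, sub_zero] at this
  exact this

lemma tendsto_G (i : Fin q) (v : EuclideanSpace ℝ ι) :
    Tendsto (fun p => S.G p.1 p.2.1 p.2.2 i v) S.nhd (𝓝 (S.G S.F₀ S.φ₀ 0 i v)) := by
  obtain ⟨η, L, hη, hcont⟩ := S.T_cont v
  have hd : Integrable (fun y => S.D S.F₀ S.φ₀ y v) := integrable_D admissible_F₀ φ₀_mem v
  have hV := tendsto_integral_abs_mul_of_bounded (c := 2 * S.R)
    (u := fun (p : (ℝ → ℝ) × EuclideanSpace ℝ ι × EuclideanSpace ℝ (Fin q)) y =>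
      S.T p.1 p.2.1 y - S.T S.F₀ S.φ₀ y) (l := S.nhd) (by
        filter_upwards [eventually_admissible, eventually_ball] with p hp hb
        refine ⟨integrable_T_sub hp hb, fun y => ?_⟩
        have h1 := S.T_bound _ hp _ hb y
        have h2 := S.T_bound _ admissible_F₀ _ φ₀_mem y
        have h3 := abs_sub (S.T p.1 p.2.1 y) (S.T S.F₀ S.φ₀ y)
        linarith) tendsto_integral_T_sub hd
  have hlim : Tendsto (fun p : (ℝ → ℝ) × EuclideanSpace ℝ ι × EuclideanSpace ℝ (Fin q) =>
      2 * S.B * (L * S.dist₀ p.1 + η p.2.1)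
      + (2 * (q * S.B * ‖p.2.2‖) * S.B) * (∫ y, |S.D S.F₀ S.φ₀ y v|)
      + S.B * ∫ y, |S.T p.1 p.2.1 y - S.T S.F₀ S.φ₀ y| * |S.D S.F₀ S.φ₀ y v|) S.nhd
      (𝓝 (2 * S.B * (L * 0 + 0) + (2 * (q * S.B * 0) * S.B) * (∫ y, |S.D S.F₀ S.φ₀ y v|)
        + S.B * 0)) :=
    ((((tendsto_dist₀.const_mul L).add (hη.comp tendsto_par)).const_mul _).add
      ((((tendsto_norm_mult.const_mul _).const_mul 2).mul_const _).mul_const _)).add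
      (hV.const_mul _)
  simp only [mul_zero, add_zero, zero_mul] at hlim
  rw [tendsto_iff_dist_tendsto_zero]
  refine squeeze_zero' (Eventually.of_forall fun p => dist_nonneg) ?_ hlim
  filter_upwards [eventually_admissible, eventually_ball, eventually_lt_r₁] with p hp hb hr
  have hi1 := integrable_deriv_psi_mul hp hb hr (integrable_dk_mul hp hb i v)
  have hi2 := integrable_dk_mul (S := S) admissible_F₀ φ₀_mem i v
  have hDi : Integrable (fun y => S.D p.1 p.2.1 y v - S.D S.F₀ S.φ₀ y v) :=
    (integrable_D hp hb v).sub hd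
  have hVi : Integrable (fun y => |S.T p.1 p.2.1 y - S.T S.F₀ S.φ₀ y| * |S.D S.F₀ S.φ₀ y v|) := by
    refine hd.abs.bdd_mul (c := 2 * S.R) (integrable_T_sub hp hb).abs.aestronglyMeasurable
      (ae_of_all _ fun y => ?_)
    have h1 := S.T_bound _ hp _ hb y
    have h2 := S.T_bound _ admissible_F₀ _ φ₀_mem y
    have h3 := abs_sub (S.T p.1 p.2.1 y) (S.T S.F₀ S.φ₀ y)
    rw [Real.norm_eq_abs, abs_abs]
    linarith
  rw [G_zero, Real.dist_eq, G, ← integral_sub hi1 hi2]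
  refine (abs_integral_le_integral_abs).trans ?_
  have hpt : ∀ y, |deriv S.psi (S.lin p.2.2 (S.T p.1 p.2.1 y)) *
        (deriv (S.k i) (S.T p.1 p.2.1 y) * S.D p.1 p.2.1 y v)
        - deriv (S.k i) (S.T S.F₀ S.φ₀ y) * S.D S.F₀ S.φ₀ y v| ≤
      2 * S.B * |S.D p.1 p.2.1 y v - S.D S.F₀ S.φ₀ y v|
      + (2 * (q * S.B * ‖p.2.2‖) * S.B) * |S.D S.F₀ S.φ₀ y v|
      + S.B * (|S.T p.1 p.2.1 y - S.T S.F₀ S.φ₀ y| * |S.D S.F₀ S.φ₀ y v|) := by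
    intro y
    have hu := S.T_bound _ hp _ hb y
    have hu0 := S.T_bound _ admissible_F₀ _ φ₀_mem y
    have e1 : |deriv S.psi (S.lin p.2.2 (S.T p.1 p.2.1 y))| ≤ 2 :=
      S.hψ.abs_deriv_le (abs_lin_lt hr hu)
    have e2 : |deriv S.psi (S.lin p.2.2 (S.T p.1 p.2.1 y)) - 1| ≤ 2 * (q * S.B * ‖p.2.2‖) :=
      (abs_deriv_psi_lin_sub_one_le hr hu).trans
        (mul_le_mul_of_nonneg_left (abs_lin_le _ hu) zero_le_two)
    have e3 := S.dk_bound i _ hu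
    have e4 := S.dk_lip i _ _ hu hu0
    generalize deriv S.psi (S.lin p.2.2 (S.T p.1 p.2.1 y)) = a at *
    generalize deriv (S.k i) (S.T p.1 p.2.1 y) = b at *
    generalize deriv (S.k i) (S.T S.F₀ S.φ₀ y) = b₀ at *
    generalize S.D p.1 p.2.1 y v = x at *
    generalize S.D S.F₀ S.φ₀ y v = x₀ at *
    have hB := S.B_nonneg
    -- `x - x₀` is small in `L¹`, `a - 1` is small uniformly, and `b - b₀` is only small in `L¹`:
    -- the last product is the one that needs the uniform bound on `b - b₀`
    calc |a * (b * x) - b₀ * x₀| = |a * b * (x - x₀) + ((a - 1) * b * x₀ + (b - b₀) * x₀)| := by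
          ring_nf
      _ ≤ |a| * |b| * |x - x₀| + (|a - 1| * |b| * |x₀| + |b - b₀| * |x₀|) := by
          refine (abs_add_le _ _).trans (add_le_add ?_ ((abs_add_le _ _).trans ?_))
          · rw [abs_mul, abs_mul]
          · rw [abs_mul, abs_mul, abs_mul]
      _ ≤ 2 * S.B * |x - x₀| + ((2 * (q * S.B * ‖p.2.2‖)) * S.B * |x₀| +
          (S.B * |S.T p.1 p.2.1 y - S.T S.F₀ S.φ₀ y|) * |x₀|) := by
          gcongr
      _ = _ := by ring
  refine (integral_mono (hi1.sub hi2).abs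
    (((hDi.abs.const_mul _).add (hd.abs.const_mul _)).add (hVi.const_mul _)) hpt).trans ?_
  rw [integral_add' ((hDi.abs.const_mul _).add (hd.abs.const_mul _)) (hVi.const_mul _),
    integral_add' (hDi.abs.const_mul _) (hd.abs.const_mul _), integral_const_mul,
    integral_const_mul, integral_const_mul]
  gcongr
  · have := S.B_nonneg; positivity
  · exact hcont _ hp _ hb

/-- The derivative of `M(φ) - ∫ k(T(F, φ))`, with the weights `ψ'(ξᵗ k)`, is uniformly close to its
value at the truth. -/
lemma eventually_G_near {c : ℝ} (hc : 0 < c) : ∀ᶠ p in S.nhd, ∀ i v,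
    |fderiv ℝ S.M p.2.1 v i - S.G p.1 p.2.1 p.2.2 i v - S.Jlin i v| ≤ c * ‖v‖ := by
  classical
  have hJ : ∀ i v, S.Jlin i v = fderiv ℝ S.M S.φ₀ v i - S.G S.F₀ S.φ₀ 0 i v := fun i v => by
    rw [G_zero, Jlin]
  have hM : Tendsto (fun p : (ℝ → ℝ) × EuclideanSpace ℝ ι × EuclideanSpace ℝ (Fin q) =>
      ‖fderiv ℝ S.M p.2.1 - fderiv ℝ S.M S.φ₀‖) S.nhd (𝓝 0) := by
    have := ((S.M_cont.tendsto.comp tendsto_par).sub_const (fderiv ℝ S.M S.φ₀)).norm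
    simpa [Function.comp_def] using this
  have hG : Tendsto (fun p : (ℝ → ℝ) × EuclideanSpace ℝ ι × EuclideanSpace ℝ (Fin q) =>
      ∑ i, ∑ j, |S.G p.1 p.2.1 p.2.2 i (EuclideanSpace.single j 1) -
        S.G S.F₀ S.φ₀ 0 i (EuclideanSpace.single j 1)|) S.nhd (𝓝 0) := by
    have : Tendsto (fun p : (ℝ → ℝ) × EuclideanSpace ℝ ι × EuclideanSpace ℝ (Fin q) =>
      ∑ i, ∑ j, |S.G p.1 p.2.1 p.2.2 i (EuclideanSpace.single j 1) -
        S.G S.F₀ S.φ₀ 0 i (EuclideanSpace.single j 1)|) S.nhd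
        (𝓝 (∑ i : Fin q, ∑ j : ι, |S.G S.F₀ S.φ₀ 0 i (EuclideanSpace.single j 1) -
          S.G S.F₀ S.φ₀ 0 i (EuclideanSpace.single j 1)|)) :=
      tendsto_finsetSum _ fun i _ => tendsto_finsetSum _ fun j _ =>
        ((tendsto_G i _).sub_const _).abs
    simpa using this
  filter_upwards [eventually_admissible, eventually_ball, eventually_lt_r₁,
    hM.eventually_lt_const (half_pos hc), hG.eventually_lt_const (half_pos hc)]
    with p hp hb hr h1 h2 i v
  have e1 : |fderiv ℝ S.M p.2.1 v i - fderiv ℝ S.M S.φ₀ v i| ≤ c / 2 * ‖v‖ := by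
    have h3 : |((fderiv ℝ S.M p.2.1 - fderiv ℝ S.M S.φ₀) v) i| ≤
        ‖(fderiv ℝ S.M p.2.1 - fderiv ℝ S.M S.φ₀) v‖ := abs_apply_le_norm _ i
    have h4 := (fderiv ℝ S.M p.2.1 - fderiv ℝ S.M S.φ₀).le_opNorm v
    have h5 := mul_le_mul_of_nonneg_right h1.le (norm_nonneg v)
    simpa using (h3.trans h4).trans h5
  have e2 : |S.G p.1 p.2.1 p.2.2 i v - S.G S.F₀ S.φ₀ 0 i v| ≤ c / 2 * ‖v‖ := by
    rw [G_eq_sum hp hb hr, G_eq_sum admissible_F₀ φ₀_mem (by simpa using r₁_pos),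
      ← Finset.sum_sub_distrib]
    refine (Finset.abs_sum_le_sum_abs _ _).trans ?_
    have h6 : ∑ j, |S.G p.1 p.2.1 p.2.2 i (EuclideanSpace.single j 1) -
        S.G S.F₀ S.φ₀ 0 i (EuclideanSpace.single j 1)| ≤ c / 2 :=
      (Finset.single_le_sum (f := fun i => ∑ j, |S.G p.1 p.2.1 p.2.2 i (EuclideanSpace.single j 1) -
        S.G S.F₀ S.φ₀ 0 i (EuclideanSpace.single j 1)|)
        (fun i _ => Finset.sum_nonneg fun j _ => abs_nonneg _) (Finset.mem_univ i)).trans h2.le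
    refine le_trans ?_ (mul_le_mul_of_nonneg_right h6 (norm_nonneg v))
    rw [Finset.sum_mul]
    refine Finset.sum_le_sum fun j _ => ?_
    rw [← mul_sub, abs_mul, mul_comm]
    exact mul_le_mul_of_nonneg_left (by simpa using PiLp.norm_apply_le v j) (abs_nonneg _)
  rw [hJ]
  have := abs_sub (fderiv ℝ S.M p.2.1 v i - fderiv ℝ S.M S.φ₀ v i)
    (S.G p.1 p.2.1 p.2.2 i v - S.G S.F₀ S.φ₀ 0 i v)
  calc _ = |fderiv ℝ S.M p.2.1 v i - fderiv ℝ S.M S.φ₀ v i -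
        (S.G p.1 p.2.1 p.2.2 i v - S.G S.F₀ S.φ₀ 0 i v)| := by ring_nf
    _ ≤ _ := by linarith

lemma tendsto_gram (i j : Fin q) : Tendsto
    (fun p : (ℝ → ℝ) × EuclideanSpace ℝ ι × EuclideanSpace ℝ (Fin q) =>
      ∫ y, S.k i (S.T p.1 p.2.1 y) * S.k j (S.T p.1 p.2.1 y)) S.nhd (𝓝 (S.A i j)) := by
  have hlim := (tendsto_integral_T_sub (S := S)).const_mul (2 * S.B * S.B)
  rw [mul_zero] at hlim
  rw [tendsto_iff_dist_tendsto_zero]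
  refine squeeze_zero' (Eventually.of_forall fun p => dist_nonneg) ?_ hlim
  filter_upwards [eventually_admissible, eventually_ball] with p hp hb
  rw [Real.dist_eq, A, Matrix.of_apply, ← integral_sub (integrable_k_mul hp hb i j)
    (integrable_k_mul admissible_F₀ φ₀_mem i j), ← integral_const_mul]
  refine (abs_integral_le_integral_abs).trans (integral_mono
    ((integrable_k_mul hp hb i j).sub (integrable_k_mul admissible_F₀ φ₀_mem i j)).abs
    ((integrable_T_sub hp hb).abs.const_mul _) fun y => ?_)
  have hu := S.T_bound _ hp _ hb y
  have hu0 := S.T_bound _ admissible_F₀ _ φ₀_mem y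
  have e1 := k_lip i hu hu0
  have e2 := k_lip j hu hu0
  have e3 := S.k_bound i _ hu
  have e4 := S.k_bound j _ hu0
  show |_ - _| ≤ 2 * S.B * S.B * |_|
  generalize S.k i (S.T p.1 p.2.1 y) = a at *
  generalize S.k j (S.T p.1 p.2.1 y) = b at *
  generalize S.k i (S.T S.F₀ S.φ₀ y) = a₀ at *
  generalize S.k j (S.T S.F₀ S.φ₀ y) = b₀ at *
  have hB := S.B_nonneg
  calc |a * b - a₀ * b₀| = |a * (b - b₀) + (a - a₀) * b₀| := by ring_nf
    _ ≤ |a| * |b - b₀| + |a - a₀| * |b₀| := by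
        rw [← abs_mul, ← abs_mul]; exact abs_add_le _ _
    _ ≤ S.B * (S.B * |S.T p.1 p.2.1 y - S.T S.F₀ S.φ₀ y|) +
        (S.B * |S.T p.1 p.2.1 y - S.T S.F₀ S.φ₀ y|) * S.B := by gcongr
    _ = _ := by ring

lemma integral_lin_mul_k (hF : Admissible S.F₀ F) (hφ : φ ∈ Metric.ball S.φ₀ S.ρ)
    (w : EuclideanSpace ℝ (Fin q)) (i : Fin q) :
    ∫ y, S.lin w (S.T F φ y) * S.k i (S.T F φ y) =
      ∑ j, w j * ∫ y, S.k i (S.T F φ y) * S.k j (S.T F φ y) := by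
  simp only [← integral_const_mul]
  rw [← integral_finsetSum _ fun j _ => (integrable_k_mul hF hφ i j).const_mul _]
  congr 1
  ext y
  rw [lin, Finset.sum_mul]
  exact Finset.sum_congr rfl fun j _ => by ring

lemma integrable_lin_mul_k (hF : Admissible S.F₀ F) (hφ : φ ∈ Metric.ball S.φ₀ S.ρ)
    (w : EuclideanSpace ℝ (Fin q)) (i : Fin q) :
    Integrable (fun y => S.lin w (S.T F φ y) * S.k i (S.T F φ y)) :=
  (integrable_k hF hφ i).bdd_mul (measurable_lin_T hF hφ w).aestronglyMeasurable
    (ae_of_all _ fun y => abs_lin_le w (S.T_bound F hF φ hφ y))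

lemma eventually_gram_near {c : ℝ} (hc : 0 < c) : ∀ᶠ p in S.nhd, ∀ i (w : EuclideanSpace ℝ (Fin q)),
    |(∫ y, S.lin w (S.T p.1 p.2.1 y) * S.k i (S.T p.1 p.2.1 y)) - ∑ j, S.A i j * w j| ≤
      c * ‖w‖ := by
  have hG : Tendsto (fun p : (ℝ → ℝ) × EuclideanSpace ℝ ι × EuclideanSpace ℝ (Fin q) =>
      ∑ i, ∑ j, |(∫ y, S.k i (S.T p.1 p.2.1 y) * S.k j (S.T p.1 p.2.1 y)) - S.A i j|)
      S.nhd (𝓝 0) := by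
    have : Tendsto (fun p : (ℝ → ℝ) × EuclideanSpace ℝ ι × EuclideanSpace ℝ (Fin q) =>
      ∑ i, ∑ j, |(∫ y, S.k i (S.T p.1 p.2.1 y) * S.k j (S.T p.1 p.2.1 y)) - S.A i j|) S.nhd
        (𝓝 (∑ i : Fin q, ∑ j : Fin q, |S.A i j - S.A i j|)) :=
      tendsto_finsetSum _ fun i _ => tendsto_finsetSum _ fun j _ =>
        ((tendsto_gram i j).sub_const _).abs
    simpa using this
  filter_upwards [eventually_admissible, eventually_ball, hG.eventually_lt_const hc]
    with p hp hb h2 i w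
  have h6 : ∑ j, |(∫ y, S.k i (S.T p.1 p.2.1 y) * S.k j (S.T p.1 p.2.1 y)) - S.A i j| ≤ c :=
    (Finset.single_le_sum
      (f := fun i => ∑ j, |(∫ y, S.k i (S.T p.1 p.2.1 y) * S.k j (S.T p.1 p.2.1 y)) - S.A i j|)
      (fun i _ => Finset.sum_nonneg fun j _ => abs_nonneg _) (Finset.mem_univ i)).trans h2.le
  rw [integral_lin_mul_k hp hb, ← Finset.sum_sub_distrib]
  refine (Finset.abs_sum_le_sum_abs _ _).trans
    (le_trans ?_ (mul_le_mul_of_nonneg_right h6 (norm_nonneg w)))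
  rw [Finset.sum_mul]
  refine Finset.sum_le_sum fun j _ => ?_
  rw [mul_comm (w j), ← sub_mul, abs_mul]
  exact mul_le_mul_of_nonneg_left (abs_apply_le_norm w j) (abs_nonneg _)

/-- To first order in `ξ`, the partial gradient of the criterion moves by `-A ξ`. -/
lemma eventually_deriv_psi_near {c : ℝ} (hc : 0 < c) : ∀ᶠ p in S.nhd, ∀ i,
    |(∫ y, (deriv S.psi (S.lin p.2.2 (S.T p.1 p.2.1 y)) - 1) * S.k i (S.T p.1 p.2.1 y)) -
      ∑ j, S.A i j * p.2.2 j| ≤ c * ‖p.2.2‖ := by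
  -- `K₁` bounds `∫ |k i|` uniformly in `i` and near `(F₀, φ₀)`
  let K₁ : ℝ := ∑ i, (∫ y, |S.k i (S.T S.F₀ S.φ₀ y)|) + 1
  have hK₁ : 0 < K₁ := add_pos_of_nonneg_of_pos
    (Finset.sum_nonneg fun i _ => integral_nonneg fun y => abs_nonneg _) one_pos
  have hb0 : 0 < (q * S.B + 1) * K₁ := by have := S.B_nonneg; positivity
  obtain ⟨δ, hδ, Hδ⟩ := S.hψ.small (c / 2 / ((q * S.B + 1) * K₁)) (by positivity)
  have hsmall : Tendsto (fun p : (ℝ → ℝ) × EuclideanSpace ℝ ι × EuclideanSpace ℝ (Fin q) =>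
      q * S.B * ‖p.2.2‖) S.nhd (𝓝 0) := by
    simpa using tendsto_norm_mult.const_mul (q * S.B)
  have hL1 : Tendsto (fun p : (ℝ → ℝ) × EuclideanSpace ℝ ι × EuclideanSpace ℝ (Fin q) =>
      S.B * ∫ y, |S.T p.1 p.2.1 y - S.T S.F₀ S.φ₀ y|) S.nhd (𝓝 0) := by
    simpa using tendsto_integral_T_sub.const_mul S.B
  filter_upwards [eventually_admissible, eventually_ball, eventually_lt_r₁,
    eventually_gram_near (half_pos hc), hsmall.eventually_lt_const hδ,
    hL1.eventually_lt_const one_pos] with p hp hb hr hg hs hl i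
  have hkint := integrable_k hp hb i
  have hi1 : Integrable (fun y => (deriv S.psi (S.lin p.2.2 (S.T p.1 p.2.1 y)) - 1) *
      S.k i (S.T p.1 p.2.1 y)) := by
    exact ((integrable_deriv_psi_mul hp hb hr hkint).sub hkint).congr
      (ae_of_all _ fun y => by simp [sub_mul])
  have hi2 := integrable_lin_mul_k hp hb p.2.2 i
  have hkbd : ∫ y, |S.k i (S.T p.1 p.2.1 y)| ≤ K₁ := by
    have h1 : ∫ y, |S.k i (S.T p.1 p.2.1 y)| ≤ (∫ y, |S.k i (S.T S.F₀ S.φ₀ y)|) +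
        S.B * ∫ y, |S.T p.1 p.2.1 y - S.T S.F₀ S.φ₀ y| := by
      rw [← integral_const_mul, ← integral_add (S.k_int i).abs
        ((integrable_T_sub hp hb).abs.const_mul _)]
      refine integral_mono hkint.abs ((S.k_int i).abs.add
        ((integrable_T_sub hp hb).abs.const_mul _)) fun y => ?_
      have h2 := k_lip i (S.T_bound _ hp _ hb y) (S.T_bound _ admissible_F₀ _ φ₀_mem y)
      have h3 := abs_add_le (S.k i (S.T S.F₀ S.φ₀ y))
        (S.k i (S.T p.1 p.2.1 y) - S.k i (S.T S.F₀ S.φ₀ y))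
      rw [add_sub_cancel] at h3
      show |_| ≤ |_| + S.B * |_|
      linarith
    have h2 := Finset.single_le_sum (f := fun i => ∫ y, |S.k i (S.T S.F₀ S.φ₀ y)|)
      (fun i _ => integral_nonneg fun y => abs_nonneg _) (Finset.mem_univ i)
    simp only [K₁]
    linarith
  have e1 : |(∫ y, (deriv S.psi (S.lin p.2.2 (S.T p.1 p.2.1 y)) - 1) * S.k i (S.T p.1 p.2.1 y)) -
      ∫ y, S.lin p.2.2 (S.T p.1 p.2.1 y) * S.k i (S.T p.1 p.2.1 y)| ≤ c / 2 * ‖p.2.2‖ := by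
    rw [← integral_sub hi1 hi2]
    refine (abs_integral_le_integral_abs).trans ?_
    have hpt : ∀ y, |(deriv S.psi (S.lin p.2.2 (S.T p.1 p.2.1 y)) - 1) * S.k i (S.T p.1 p.2.1 y) -
        S.lin p.2.2 (S.T p.1 p.2.1 y) * S.k i (S.T p.1 p.2.1 y)| ≤
        (c / 2 / K₁ * ‖p.2.2‖) * |S.k i (S.T p.1 p.2.1 y)| := by
      intro y
      have hu := S.T_bound _ hp _ hb y
      have h1 := abs_lin_le p.2.2 hu
      have h2 := Hδ _ (h1.trans_lt hs)
      rw [← sub_mul, abs_mul]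
      refine mul_le_mul_of_nonneg_right (h2.trans ?_) (abs_nonneg _)
      have h3 : |S.lin p.2.2 (S.T p.1 p.2.1 y)| ≤ (q * S.B + 1) * ‖p.2.2‖ := by
        linarith [norm_nonneg p.2.2]
      refine (mul_le_mul_of_nonneg_left h3 (by positivity)).trans_eq ?_
      have : (q : ℝ) * S.B + 1 ≠ 0 := by have := S.B_nonneg; positivity
      field_simp
    refine (integral_mono (hi1.sub hi2).abs (hkint.abs.const_mul _) hpt).trans ?_
    rw [integral_const_mul]
    refine (mul_le_mul_of_nonneg_left hkbd (by positivity)).trans_eq ?_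
    field_simp
  have e2 := hg i p.2.2
  have := abs_add_le
    ((∫ y, (deriv S.psi (S.lin p.2.2 (S.T p.1 p.2.1 y)) - 1) * S.k i (S.T p.1 p.2.1 y)) -
      ∫ y, S.lin p.2.2 (S.T p.1 p.2.1 y) * S.k i (S.T p.1 p.2.1 y))
    ((∫ y, S.lin p.2.2 (S.T p.1 p.2.1 y) * S.k i (S.T p.1 p.2.1 y)) - ∑ j, S.A i j * p.2.2 j)
  rw [sub_add_sub_cancel] at this
  linarith

end PluginProblem

end

section

/-! ### First-order conditions -/

/-- A positive definite quadratic form on `ℝ^q` dominates a multiple of the squared norm. -/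
lemma exists_pos_mul_norm_sq_le {q : ℕ} {A : Matrix (Fin q) (Fin q) ℝ} (hA : A.PosDef) :
    ∃ c > 0, ∀ w : EuclideanSpace ℝ (Fin q), c * ‖w‖ ^ 2 ≤ ∑ i, w i * ∑ j, A i j * w j := by
  have hpos : ∀ w : EuclideanSpace ℝ (Fin q), w ≠ 0 → 0 < ∑ i, w i * ∑ j, A i j * w j := by
    intro w hw
    have h0 : w.ofLp ≠ 0 := by simpa using hw
    simpa [dotProduct, Matrix.mulVec] using hA.dotProduct_mulVec_pos h0
  have hcont : Continuous fun w : EuclideanSpace ℝ (Fin q) => ∑ i, w i * ∑ j, A i j * w j := by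
    fun_prop
  rcases (Metric.sphere (0 : EuclideanSpace ℝ (Fin q)) 1).eq_empty_or_nonempty with he | hne
  · refine ⟨1, one_pos, fun w => ?_⟩
    have hw : w = 0 := by
      by_contra h
      have : ‖w‖⁻¹ • w ∈ Metric.sphere (0 : EuclideanSpace ℝ (Fin q)) 1 := by
        simp [norm_smul, h]
      rw [he] at this
      exact this
    simp [hw]
  · obtain ⟨w₀, hw₀, hmin⟩ := (isCompact_sphere (0 : EuclideanSpace ℝ (Fin q)) 1).exists_isMinOn hne
      hcont.continuousOn
    have hw₀' : w₀ ≠ 0 := by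
      rintro rfl
      simp at hw₀
    refine ⟨_, hpos w₀ hw₀', fun w => ?_⟩
    rcases eq_or_ne w 0 with rfl | hw
    · simp
    have hn : ‖w‖ ≠ 0 := norm_ne_zero_iff.2 hw
    have hmem : ‖w‖⁻¹ • w ∈ Metric.sphere (0 : EuclideanSpace ℝ (Fin q)) 1 := by
      simp [norm_smul, hw]
    have h1 := hmin hmem
    have h2 : ∑ i, (‖w‖⁻¹ • w) i * ∑ j, A i j * (‖w‖⁻¹ • w) j =
        (‖w‖⁻¹) ^ 2 * ∑ i, w i * ∑ j, A i j * w j := by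
      simp only [PiLp.smul_apply, smul_eq_mul, Finset.mul_sum]
      exact Finset.sum_congr rfl fun i _ => Finset.sum_congr rfl fun j _ => by ring
    simp only [mem_ofPred_eq] at h1
    rw [h2] at h1
    calc _ ≤ ((‖w‖⁻¹) ^ 2 * ∑ i, w i * ∑ j, A i j * w j) * ‖w‖ ^ 2 :=
          mul_le_mul_of_nonneg_right h1 (sq_nonneg _)
      _ = _ := by field_simp

namespace PluginProblem

variable {ι : Type} [Fintype ι] {q : ℕ} {S : PluginProblem ι q} {F : ℝ → ℝ}
  {φ φ' : EuclideanSpace ℝ ι} {ξ : EuclideanSpace ℝ (Fin q)}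

lemma integral_lin_sq (hF : Admissible S.F₀ F) (hφ : φ ∈ Metric.ball S.φ₀ S.ρ)
    (w : EuclideanSpace ℝ (Fin q)) :
    ∫ y, S.lin w (S.T F φ y) ^ 2 = ∑ i, w i * ∫ y, S.lin w (S.T F φ y) * S.k i (S.T F φ y) := by
  simp only [← integral_const_mul]
  rw [← integral_finsetSum _ fun i _ => (integrable_lin_mul_k hF hφ w i).const_mul _]
  congr 1
  ext y
  rw [sq]
  nth_rewrite 2 [lin]
  rw [Finset.mul_sum]
  exact Finset.sum_congr rfl fun j _ => by ring

variable (S) in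
lemma posSemidef_A : S.A.PosSemidef := by
  refine Matrix.PosSemidef.of_dotProduct_mulVec_nonneg ?_ fun x => ?_
  · ext i j
    simp [A, mul_comm]
  · let w : EuclideanSpace ℝ (Fin q) := WithLp.toLp 2 x
    have h1 : star x ⬝ᵥ S.A *ᵥ x = ∫ y, S.lin w (S.T S.F₀ S.φ₀ y) ^ 2 := by
      rw [integral_lin_sq admissible_F₀ φ₀_mem]
      simp only [integral_lin_mul_k admissible_F₀ φ₀_mem, dotProduct, Matrix.mulVec, star_trivial]
      exact Finset.sum_congr rfl fun i _ => by
        congr 1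
        exact Finset.sum_congr rfl fun j _ => by simp [A, w, mul_comm]
    rw [h1]
    exact integral_nonneg fun y => sq_nonneg _

lemma eventually_lin_sq_ge (hA : IsUnit S.A) : ∃ c > 0, ∀ᶠ p in S.nhd,
    ∀ w : EuclideanSpace ℝ (Fin q), c * ‖w‖ ^ 2 ≤ ∫ y, S.lin w (S.T p.1 p.2.1 y) ^ 2 := by
  obtain ⟨c, hc, H⟩ := exists_pos_mul_norm_sq_le (S.posSemidef_A.posDef_iff_isUnit.2 hA)
  refine ⟨c / 2, half_pos hc, ?_⟩
  filter_upwards [eventually_admissible, eventually_ball,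
    eventually_gram_near (show 0 < c / (2 * (q + 1)) by positivity)] with p hp hb hg w
  rw [integral_lin_sq hp hb]
  have h1 : |(∑ i, w i * ∫ y, S.lin w (S.T p.1 p.2.1 y) * S.k i (S.T p.1 p.2.1 y)) -
      ∑ i, w i * ∑ j, S.A i j * w j| ≤ ∑ _i : Fin q, c / (2 * (q + 1)) * ‖w‖ ^ 2 := by
    rw [← Finset.sum_sub_distrib]
    refine (Finset.abs_sum_le_sum_abs _ _).trans (Finset.sum_le_sum fun i _ => ?_)
    rw [← mul_sub, abs_mul]
    calc _ ≤ ‖w‖ * (c / (2 * (q + 1)) * ‖w‖) :=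
          mul_le_mul (abs_apply_le_norm w i) (hg i w) (abs_nonneg _) (norm_nonneg _)
      _ = _ := by ring
  have h2 : ∑ _i : Fin q, c / (2 * (q + 1)) * ‖w‖ ^ 2 ≤ c / 2 * ‖w‖ ^ 2 := by
    rw [Finset.sum_const, Finset.card_univ, Fintype.card_fin, nsmul_eq_mul, ← mul_assoc]
    refine mul_le_mul_of_nonneg_right ?_ (sq_nonneg _)
    rw [mul_div_assoc', div_le_div_iff₀ (by positivity) (by positivity)]
    nlinarith
  have h3 := (abs_le.1 (h1.trans h2)).1
  linarith [H w]

/-- The criterion lies below its tangent plane in `ξ`, by a quadratic margin near the point of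
tangency and by a linear one far from it. This holds for all increments `w`, although the criterion
is controlled near `ξ = 0` only. -/
lemma eventually_crit_le (hA : IsUnit S.A) : ∃ c > 0, ∀ᶠ p in S.nhd,
    ∀ w : EuclideanSpace ℝ (Fin q), S.crit p.1 p.2.1 (p.2.2 + w) ≤
      ((S.h p.1 p.2.1 p.2.2 + ∑ i, w i * S.N p.1 p.2.1 p.2.2 i
        - c * (‖w‖ ^ 2 / max 1 ‖w‖) : ℝ) : EReal) := by
  obtain ⟨c, hc, H⟩ := eventually_lin_sq_ge hA
  have hb0 : 0 < q * S.B + 1 := by have := S.B_nonneg; positivity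
  have hκ := S.hψ.κ_pos
  refine ⟨S.κ / (q * S.B + 1) * c, by positivity, ?_⟩
  filter_upwards [eventually_admissible, eventually_ball, eventually_lt_r₁, H] with p hp hb hr hq w
  set b := q * S.B + 1 with hbdef
  -- as `x = wᵗ k` satisfies `|x| ≤ b M` with `1 ≤ b M`, one has `min (x²) |x| ≥ x² / (b M)`, which
  -- integrates to a quadratic form in `w`
  set M := max 1 ‖w‖ with hM
  have hM1 : 1 ≤ M := le_max_left _ _
  have hMw : ‖w‖ ≤ M := le_max_right _ _
  have hi1 := integrable_psi hp hb hr
  have hi2 := integrable_deriv_psi_mul hp hb hr (integrable_lin hp hb w)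
  have hi3 := (integrable_lin_sq hp hb w).const_mul (S.κ / (b * M))
  have hi12 : Integrable (fun y => S.psi (S.lin p.2.2 (S.T p.1 p.2.1 y)) +
      deriv S.psi (S.lin p.2.2 (S.T p.1 p.2.1 y)) * S.lin w (S.T p.1 p.2.1 y)) := hi1.add hi2
  refine (crit_le (a := fun y => S.psi (S.lin p.2.2 (S.T p.1 p.2.1 y)) +
    deriv S.psi (S.lin p.2.2 (S.T p.1 p.2.1 y)) * S.lin w (S.T p.1 p.2.1 y) +
    S.κ / (b * M) * S.lin w (S.T p.1 p.2.1 y) ^ 2) (hi12.add hi3) fun y => ?_).trans ?_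
  · have hu := S.T_bound _ hp _ hb y
    rw [lin_add]
    refine le_trans (EReal.coe_le_coe_iff.2 ?_) (S.hψ.lower _ (abs_lin_lt hr hu) _)
    refine add_le_add le_rfl ?_
    have h1 : |S.lin w (S.T p.1 p.2.1 y)| ≤ b * M := by
      refine (abs_lin_le w hu).trans ?_
      have := S.B_nonneg
      have h3 : (q : ℝ) * S.B * ‖w‖ ≤ q * S.B * M := by gcongr
      linarith
    have hbM : 1 ≤ b * M := by
      have : 1 ≤ b := by
        have := S.B_nonneg
        rw [hbdef]
        linarith [show 0 ≤ (q : ℝ) * S.B by positivity]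
      nlinarith
    generalize S.lin w (S.T p.1 p.2.1 y) = x at *
    rw [div_mul_eq_mul_div, mul_div_assoc]
    refine mul_le_mul_of_nonneg_left ?_ hκ.le
    rw [div_le_iff₀ (by linarith)]
    rcases min_cases (x ^ 2) |x| with h | h
    · rw [h.1]; nlinarith [sq_nonneg x]
    · rw [h.1, ← sq_abs, sq]
      exact mul_le_mul_of_nonneg_left h1 (abs_nonneg _)
  · rw [EReal.coe_le_coe_iff, integral_add hi12 hi3, integral_add hi1 hi2,
      integral_const_mul, h]
    have e1 : ∫ y, deriv S.psi (S.lin p.2.2 (S.T p.1 p.2.1 y)) * S.lin w (S.T p.1 p.2.1 y) =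
        ∑ i, w i * ∫ y, deriv S.psi (S.lin p.2.2 (S.T p.1 p.2.1 y)) * S.k i (S.T p.1 p.2.1 y) := by
      simp only [← integral_const_mul]
      rw [← integral_finsetSum _ fun i _ =>
        (integrable_deriv_psi_mul hp hb hr (integrable_k hp hb i)).const_mul _]
      congr 1
      ext y
      nth_rewrite 2 [lin]
      rw [Finset.mul_sum]
      exact Finset.sum_congr rfl fun j _ => by ring
    have e2 : ∑ i, (p.2.2 + w) i * S.M p.2.1 i =
        ∑ i, p.2.2 i * S.M p.2.1 i + ∑ i, w i * S.M p.2.1 i := by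
      simp [add_mul, Finset.sum_add_distrib]
    have e3 : ∑ i, w i * S.N p.1 p.2.1 p.2.2 i = ∑ i, w i * S.M p.2.1 i -
        ∑ i, w i * ∫ y, deriv S.psi (S.lin p.2.2 (S.T p.1 p.2.1 y)) * S.k i (S.T p.1 p.2.1 y) := by
      rw [← Finset.sum_sub_distrib]
      exact Finset.sum_congr rfl fun j _ => by rw [N, mul_sub]
    have e4 : S.κ / b * c * (‖w‖ ^ 2 / M) ≤
        S.κ / (b * M) * ∫ y, S.lin w (S.T p.1 p.2.1 y) ^ 2 := by
      have hM0 : 0 < M := by linarith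
      calc S.κ / b * c * (‖w‖ ^ 2 / M) = S.κ / (b * M) * (c * ‖w‖ ^ 2) := by field_simp
        _ ≤ _ := mul_le_mul_of_nonneg_left (hq w) (by positivity)
    rw [e1, e2, e3]
    linarith

/-- A point where the partial gradient in `ξ` is small is nearly a maximiser: the supremum of the
criterion exceeds its value there by at most a multiple of the squared gradient. -/
lemma eventually_iSup_crit_le (hA : IsUnit S.A) : ∃ c > 0, ∀ᶠ p in S.nhd,
    ∑ i, |S.N p.1 p.2.1 p.2.2 i| ≤ c → ⨆ ξ, S.crit p.1 p.2.1 ξ ≤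
      ((S.h p.1 p.2.1 p.2.2 + (∑ i, |S.N p.1 p.2.1 p.2.2 i|) ^ 2 / c : ℝ) : EReal) := by
  obtain ⟨c, hc, H⟩ := eventually_crit_le hA
  refine ⟨c, hc, ?_⟩
  filter_upwards [H] with p hp hn
  refine iSup_le fun ξ => ?_
  have h1 := hp (ξ - p.2.2)
  rw [add_sub_cancel] at h1
  refine h1.trans (EReal.coe_le_coe_iff.2 ?_)
  set w := ξ - p.2.2
  set n := ∑ i, |S.N p.1 p.2.1 p.2.2 i| with hndef
  have hn0 : 0 ≤ n := Finset.sum_nonneg fun i _ => abs_nonneg _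
  have h2 : ∑ i, w i * S.N p.1 p.2.1 p.2.2 i ≤ n * ‖w‖ := by
    rw [hndef, Finset.sum_mul]
    refine Finset.sum_le_sum fun i _ => (le_abs_self _).trans ?_
    rw [abs_mul, mul_comm]
    exact mul_le_mul_of_nonneg_left (abs_apply_le_norm w i) (abs_nonneg _)
  have h3 : n * ‖w‖ - c * (‖w‖ ^ 2 / max 1 ‖w‖) ≤ n ^ 2 / c := by
    have hw := norm_nonneg w
    rcases le_total ‖w‖ 1 with h | h
    · rw [max_eq_left h, div_one, le_div_iff₀ hc]
      nlinarith [sq_nonneg (n - c * ‖w‖), mul_nonneg hn0 hw, sq_nonneg (n - 2 * c * ‖w‖)]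
    · rw [max_eq_right h, sq ‖w‖, mul_self_div_self]
      have : 0 ≤ n ^ 2 / c := by positivity
      nlinarith
  linarith

/-- First-order condition in `ξ`. -/
lemma N_eq_zero_of_isMaxOn (hF : Admissible S.F₀ F) (hφ : φ ∈ Metric.ball S.φ₀ S.ρ)
    (hξ : ‖ξ‖ < S.r₁) (hmax : IsMaxOn (S.crit F φ) univ ξ) (i : Fin q) : S.N F φ ξ i = 0 := by
  classical
  let e : EuclideanSpace ℝ (Fin q) := EuclideanSpace.single i 1
  have hnear : ∀ᶠ t : ℝ in 𝓝 0, ‖ξ + t • e‖ < S.r₁ := by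
    have hc : Continuous fun t : ℝ => ‖ξ + t • e‖ := by fun_prop
    exact hc.continuousAt.eventually_lt_const (by simpa using hξ)
  have hle : ∀ u, S.lin e u = S.k i u := fun u => by
    simp [lin, e]
  -- the quadratic majorant of `ψ` gives a minorant of the criterion along the `i`-th axis, touching
  -- it at `t = 0`
  have hmax' : IsLocalMax (fun t : ℝ => t * S.N F φ ξ i -
      t ^ 2 * ∫ y, S.k i (S.T F φ y) * S.k i (S.T F φ y)) 0 := by
    filter_upwards [hnear] with t ht
    have h1 : S.crit F φ (ξ + t • e) ≤ S.crit F φ ξ := hmax (mem_univ _)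
    rw [crit_eq hF hφ ht, crit_eq hF hφ hξ, EReal.coe_le_coe_iff] at h1
    have hi1 := integrable_psi hF hφ hξ
    have hi2 := integrable_deriv_psi_mul hF hφ hξ ((integrable_k hF hφ i).const_mul t)
    have hi3 := (integrable_k_mul hF hφ i i).const_mul (t ^ 2)
    have hi12 : Integrable (fun y => S.psi (S.lin ξ (S.T F φ y)) +
      deriv S.psi (S.lin ξ (S.T F φ y)) * (t * S.k i (S.T F φ y))) := hi1.add hi2
    have h2 : ∫ y, S.psi (S.lin (ξ + t • e) (S.T F φ y)) ≤ (∫ y, S.psi (S.lin ξ (S.T F φ y))) +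
        t * (∫ y, deriv S.psi (S.lin ξ (S.T F φ y)) * S.k i (S.T F φ y)) +
        t ^ 2 * ∫ y, S.k i (S.T F φ y) * S.k i (S.T F φ y) := by
      have e1 : t * (∫ y, deriv S.psi (S.lin ξ (S.T F φ y)) * S.k i (S.T F φ y)) =
          ∫ y, deriv S.psi (S.lin ξ (S.T F φ y)) * (t * S.k i (S.T F φ y)) := by
        rw [← integral_const_mul]
        congr 1; ext y; ring
      rw [e1, ← integral_const_mul, ← integral_add hi1 hi2, ← integral_add hi12 hi3]
      refine integral_mono (integrable_psi hF hφ ht) (hi12.add hi3) fun y => ?_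
      have hu := S.T_bound _ hF _ hφ y
      have h3 := abs_lin_lt ht hu
      show S.psi _ ≤ S.psi _ + _ * _ + _
      rw [lin_add, lin_smul, hle] at h3 ⊢
      have h6 : S.psi _ ≤ S.psi _ + deriv S.psi _ * _ + _ := S.hψ.upper (abs_lin_lt hξ hu) h3
      exact h6.trans_eq (by ring)
    have h4 : ∑ j, (ξ + t • e) j * S.M φ j = ∑ j, ξ j * S.M φ j + t * S.M φ i := by
      simp [add_mul, Finset.sum_add_distrib, e]
    rw [h, h, h4] at h1
    rw [N, zero_mul, mul_sub]
    simp only [ne_eq, OfNat.ofNat_ne_zero, not_false_eq_true, zero_pow, zero_mul, sub_zero]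
    linarith
  have hder : HasDerivAt (fun t : ℝ => t * S.N F φ ξ i -
      t ^ 2 * ∫ y, S.k i (S.T F φ y) * S.k i (S.T F φ y)) (S.N F φ ξ i) 0 := by
    refine (((hasDerivAt_id (0 : ℝ)).mul_const _).sub
      (((hasDerivAt_id (0 : ℝ)).pow 2).mul_const _)).congr_deriv ?_
    simp
  exact hmax'.hasDerivAt_eq_zero hder

/-- Differentiation under the integral sign along a line of parameters. -/
lemma hasDerivAt_integral_comp_T {κ κ' : ℝ → ℝ} {c : ℝ} (hκm : Measurable κ) (hκ'm : Measurable κ')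
    (hκ : ∀ u, |u| ≤ S.R → HasDerivAt κ (κ' u) u) (hc : ∀ u, |u| ≤ S.R → |κ' u| ≤ c)
    (hF : Admissible S.F₀ F) {v : EuclideanSpace ℝ ι} {t₀ : ℝ}
    (hφ : φ + t₀ • v ∈ Metric.ball S.φ₀ S.ρ)
    (hint : Integrable fun y => κ (S.T F (φ + t₀ • v) y)) :
    HasDerivAt (fun t : ℝ => ∫ y, κ (S.T F (φ + t • v) y))
      (∫ y, κ' (S.T F (φ + t₀ • v) y) * S.D F (φ + t₀ • v) y v) t₀ := by
  have hcont : Continuous fun t : ℝ => φ + t • v := by fun_prop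
  have hs : {t : ℝ | φ + t • v ∈ Metric.ball S.φ₀ S.ρ} ∈ 𝓝 t₀ :=
    hcont.continuousAt (Metric.isOpen_ball.mem_nhds hφ)
  refine (hasDerivAt_integral_of_dominated_loc_of_deriv_le (bound := fun y => c * (S.env F y * ‖v‖))
    (F' := fun t y => κ' (S.T F (φ + t • v) y) * S.D F (φ + t • v) y v)
    hs ?_ hint ?_ ?_ (((integrable_env hF).mul_const _).const_mul _) ?_).2
  · filter_upwards [hs] with t ht
    exact (hκm.comp (S.T_meas F hF _ ht)).aestronglyMeasurable
  · exact ((hκ'm.comp (S.T_meas F hF _ hφ)).mul (measurable_D hF hφ v)).aestronglyMeasurable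
  · refine ae_of_all _ fun y t ht => ?_
    have hu := S.T_bound F hF _ ht y
    rw [norm_mul]
    exact mul_le_mul (hc _ hu) (abs_D_le hF ht v y) (norm_nonneg _) ((abs_nonneg _).trans (hc _ hu))
  · refine ae_of_all _ fun y t ht => ?_
    exact (hκ _ (S.T_bound F hF _ ht y)).comp t (hasDerivAt_T_line hF ht y)

lemma hasDerivAt_M_line (i : Fin q) {v : EuclideanSpace ℝ ι} {t₀ : ℝ}
    (hφ : φ + t₀ • v ∈ Metric.ball S.φ₀ S.ρ) :
    HasDerivAt (fun t : ℝ => S.M (φ + t • v) i) (fderiv ℝ S.M (φ + t₀ • v) v i) t₀ := by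
  have h1 := (S.M_diff _ hφ).hasFDerivAt
  have h2 : HasDerivAt (fun t : ℝ => φ + t • v) v t₀ := by
    simpa using ((hasDerivAt_id t₀).smul_const v).const_add φ
  exact (EuclideanSpace.proj (𝕜 := ℝ) i).hasFDerivAt.comp_hasDerivAt t₀
    (h1.comp_hasDerivAt t₀ h2)

/-- The partial derivatives of the criterion in `φ`. -/
lemma hasDerivAt_h_line (hF : Admissible S.F₀ F) (hφ : φ ∈ Metric.ball S.φ₀ S.ρ)
    (hξ : ‖ξ‖ < S.r₁) (v : EuclideanSpace ℝ ι) :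
    HasDerivAt (fun t : ℝ => S.h F (φ + t • v) ξ)
      (∑ i, ξ i * (fderiv ℝ S.M φ v i - S.G F φ ξ i v)) 0 := by
  have hφ' : φ + (0 : ℝ) • v ∈ Metric.ball S.φ₀ S.ρ := by simpa using hφ
  have h1 : HasDerivAt (fun t : ℝ => ∑ i, ξ i * S.M (φ + t • v) i)
      (∑ i, ξ i * fderiv ℝ S.M φ v i) 0 := by
    refine HasDerivAt.fun_sum fun i _ => ?_
    simpa using (hasDerivAt_M_line i hφ').const_mul (ξ i)
  have hlinm : Measurable (S.lin ξ) :=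
    Finset.measurable_fun_sum _ fun i _ => (S.k_diff i).continuous.measurable.const_mul _
  have h2 := hasDerivAt_integral_comp_T (S := S) (κ := fun u => S.psi (S.lin ξ u))
    (κ' := fun u => deriv S.psi (S.lin ξ u) * ∑ i, ξ i * deriv (S.k i) u)
    (c := 2 * ∑ i, |ξ i| * S.B)
    (measurable_psi.comp hlinm)
    (((measurable_deriv _).comp hlinm).mul
      (Finset.measurable_fun_sum _ fun i _ => (continuous_deriv_k i).measurable.const_mul _))
    (fun u hu => ((S.hψ.diff _ (abs_lin_lt hξ hu)).hasDerivAt).comp u (hasDerivAt_lin ξ u))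
    (fun u hu => by
      rw [abs_mul]
      refine mul_le_mul (S.hψ.abs_deriv_le (abs_lin_lt hξ hu)) ?_ (abs_nonneg _) zero_le_two
      refine (Finset.abs_sum_le_sum_abs _ _).trans (Finset.sum_le_sum fun i _ => ?_)
      rw [abs_mul]
      exact mul_le_mul_of_nonneg_left (S.dk_bound i u hu) (abs_nonneg _))
    hF hφ' (by simpa using integrable_psi hF hφ hξ)
  refine (h1.sub h2).congr_deriv ?_
  simp only [mul_sub, Finset.sum_sub_distrib, zero_smul, add_zero]
  congr 1
  simp only [G, ← integral_const_mul]
  rw [← integral_finsetSum _ fun i _ =>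
    (integrable_deriv_psi_mul hF hφ hξ (integrable_dk_mul hF hφ i v)).const_mul _]
  congr 1
  ext y
  rw [Finset.mul_sum, Finset.sum_mul]
  exact Finset.sum_congr rfl fun i _ => by ring

/-- The partial gradient in `ξ` is Lipschitz in `φ`. -/
lemma exists_N_lip (hF : Admissible S.F₀ F) (hφ : φ ∈ Metric.ball S.φ₀ S.ρ)
    (hξ : ‖ξ‖ < S.r₁) (i : Fin q) :
    ∃ L, ∀ᶠ φ' in 𝓝 φ, |S.N F φ' ξ i - S.N F φ ξ i| ≤ L * ‖φ' - φ‖ := by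
  obtain ⟨L, hL⟩ := (S.M_diff φ hφ).isBigO_sub.bound
  refine ⟨L + (4 * (q * S.B * ‖ξ‖) * S.B + 2 * S.B) * ∫ y, S.env F y, ?_⟩
  filter_upwards [hL, Metric.isOpen_ball.mem_nhds hφ] with φ' h1 hφ'
  have hi := integrable_deriv_psi_mul hF hφ hξ (integrable_k hF hφ i)
  have hi' := integrable_deriv_psi_mul hF hφ' hξ (integrable_k hF hφ' i)
  have e1 : |S.M φ' i - S.M φ i| ≤ L * ‖φ' - φ‖ := by
    refine le_trans ?_ h1
    simpa using abs_apply_le_norm (S.M φ' - S.M φ) i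
  have e2 : |(∫ y, deriv S.psi (S.lin ξ (S.T F φ' y)) * S.k i (S.T F φ' y)) -
      ∫ y, deriv S.psi (S.lin ξ (S.T F φ y)) * S.k i (S.T F φ y)| ≤
      (4 * (q * S.B * ‖ξ‖) * S.B + 2 * S.B) * (∫ y, S.env F y) * ‖φ' - φ‖ := by
    rw [← integral_sub hi' hi, ← integral_const_mul, ← integral_mul_const]
    refine (abs_integral_le_integral_abs).trans (integral_mono (hi'.sub hi).abs
      (((integrable_env hF).const_mul _).mul_const _) fun y => ?_)
    have hu := S.T_bound F hF _ hφ y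
    have hu' := S.T_bound F hF _ hφ' y
    have hT := T_lip hF hφ' hφ y
    have f1 := k_lip i hu' hu
    have f2 : |S.lin ξ (S.T F φ' y) - S.lin ξ (S.T F φ y)| ≤
        q * S.B * ‖ξ‖ * |S.T F φ' y - S.T F φ y| := by
      rw [lin, lin, ← Finset.sum_sub_distrib]
      refine (Finset.abs_sum_le_sum_abs _ _).trans
        ((Finset.sum_le_sum (g := fun _ => ‖ξ‖ * (S.B * |S.T F φ' y - S.T F φ y|))
          fun j _ => ?_).trans_eq ?_)
      · rw [← mul_sub, abs_mul]
        exact mul_le_mul (abs_apply_le_norm ξ j) (k_lip j hu' hu) (abs_nonneg _) (norm_nonneg _)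
      · simp; ring
    have f3 : |deriv S.psi (S.lin ξ (S.T F φ' y)) - deriv S.psi (S.lin ξ (S.T F φ y))| ≤
        2 * |S.lin ξ (S.T F φ' y) - S.lin ξ (S.T F φ y)| :=
      S.hψ.abs_deriv_sub_le (abs_lin_lt hξ hu') (abs_lin_lt hξ hu)
    have f4 : |deriv S.psi (S.lin ξ (S.T F φ y))| ≤ 2 := S.hψ.abs_deriv_le (abs_lin_lt hξ hu)
    have f5 := S.k_bound i _ hu'
    have hB := S.B_nonneg
    show |_ - _| ≤ _
    calc |deriv S.psi (S.lin ξ (S.T F φ' y)) * S.k i (S.T F φ' y) -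
          deriv S.psi (S.lin ξ (S.T F φ y)) * S.k i (S.T F φ y)|
        = |(deriv S.psi (S.lin ξ (S.T F φ' y)) - deriv S.psi (S.lin ξ (S.T F φ y))) *
          S.k i (S.T F φ' y) + deriv S.psi (S.lin ξ (S.T F φ y)) *
          (S.k i (S.T F φ' y) - S.k i (S.T F φ y))| := by ring_nf
      _ ≤ (2 * (q * S.B * ‖ξ‖ * |S.T F φ' y - S.T F φ y|)) * S.B +
          2 * (S.B * |S.T F φ' y - S.T F φ y|) := by
          refine (abs_add_le _ _).trans ?_
          rw [abs_mul, abs_mul]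
          gcongr
          exact f3.trans (by gcongr)
      _ ≤ (4 * (q * S.B * ‖ξ‖) * S.B + 2 * S.B) * |S.T F φ' y - S.T F φ y| := by
          have : 0 ≤ q * S.B * ‖ξ‖ * |S.T F φ' y - S.T F φ y| * S.B := by positivity
          linarith
      _ ≤ (4 * (q * S.B * ‖ξ‖) * S.B + 2 * S.B) * (S.env F y * ‖φ' - φ‖) := by gcongr
      _ = _ := by ring
  rw [N, N]
  have := abs_sub (S.M φ' i - S.M φ i)
    ((∫ y, deriv S.psi (S.lin ξ (S.T F φ' y)) * S.k i (S.T F φ' y)) -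
      ∫ y, deriv S.psi (S.lin ξ (S.T F φ y)) * S.k i (S.T F φ y))
  calc _ = |S.M φ' i - S.M φ i -
      ((∫ y, deriv S.psi (S.lin ξ (S.T F φ' y)) * S.k i (S.T F φ' y)) -
      ∫ y, deriv S.psi (S.lin ξ (S.T F φ y)) * S.k i (S.T F φ y))| := by ring_nf
    _ ≤ _ := by linarith

/-- First-order condition in `φ`. The supremum over `ξ` need not be differentiable in `φ`; it is
squeezed between its value at the minimiser and `h(φ, ξ̂) + C |φ - φ̂|²`. -/
lemma eventually_deriv_eq_zero (hA : IsUnit S.A) {Φ : Set (EuclideanSpace ℝ ι)}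
    (hΦ : Φ ∈ 𝓝 S.φ₀) : ∀ᶠ p in S.nhd,
    IsMinOn (fun φ => ⨆ ξ, S.crit p.1 φ ξ) Φ p.2.1 → IsMaxOn (S.crit p.1 p.2.1) univ p.2.2 →
    ∀ v, ∑ i, p.2.2 i * (fderiv ℝ S.M p.2.1 v i - S.G p.1 p.2.1 p.2.2 i v) = 0 := by
  obtain ⟨c, hc, H⟩ := eventually_iSup_crit_le hA
  obtain ⟨δ, hδ, Hδ⟩ := eventually_nhd_iff.1 H
  have hball : ∀ᶠ p in S.nhd, p.2.1 ∈ Metric.ball S.φ₀ δ :=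
    tendsto_par (Metric.ball_mem_nhds _ hδ)
  have hΦ' : ∀ᶠ p in S.nhd, p.2.1 ∈ interior Φ :=
    tendsto_par (isOpen_interior.mem_nhds (mem_interior_iff_mem_nhds.2 hΦ))
  filter_upwards [eventually_admissible, eventually_ball, eventually_lt_r₁, hball, hΦ',
    tendsto_dist₀.eventually_lt_const hδ, tendsto_norm_mult.eventually_lt_const hδ]
    with p hp hb hr hbδ hpΦ hdδ hξδ hmin hmax v
  have hN := N_eq_zero_of_isMaxOn hp hb hr hmax
  choose L hL using fun i => exists_N_lip hp hb hr i
  have hline : Tendsto (fun t : ℝ => p.2.1 + t • v) (𝓝 0) (𝓝 p.2.1) := by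
    have hc : Continuous fun t : ℝ => p.2.1 + t • v := by fun_prop
    simpa using hc.tendsto 0
  set L' := ∑ i, L i * ‖v‖ with hL'
  have hNle : ∀ᶠ t : ℝ in 𝓝 0, ∑ i, |S.N p.1 (p.2.1 + t • v) p.2.2 i| ≤ |t| * L' := by
    have h1 : ∀ᶠ φ in 𝓝 p.2.1, ∀ i, |S.N p.1 φ p.2.2 i - S.N p.1 p.2.1 p.2.2 i| ≤
      L i * ‖φ - p.2.1‖ := eventually_all.2 hL
    filter_upwards [hline.eventually h1] with t ht
    rw [hL', Finset.mul_sum]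
    refine Finset.sum_le_sum fun i _ => ?_
    have := ht i
    rw [hN i, sub_zero, add_sub_cancel_left, norm_smul, Real.norm_eq_abs] at this
    linarith
  have hsmall : ∀ᶠ t : ℝ in 𝓝 0, |t| * L' < c := by
    have hc' : Continuous fun t : ℝ => |t| * L' := by fun_prop
    exact hc'.continuousAt.eventually_lt_const (by simpa using hc)
  -- the gradient in `ξ` is `O(t)` at `φ̂ + t v`, so the supremum over `ξ` there is at most the value
  -- at the unchanged multiplier plus `O(t²)`
  have hmin' : IsLocalMin
      (fun t : ℝ => S.h p.1 (p.2.1 + t • v) p.2.2 + t ^ 2 * (L' ^ 2 / c)) 0 := by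
    filter_upwards [hNle, hsmall, hline.eventually (isOpen_interior.mem_nhds hpΦ),
      hline.eventually (Metric.isOpen_ball.mem_nhds hbδ)] with t h1 h2 h3 h4
    have h5 := Hδ p.1 (p.2.1 + t • v) p.2.2 hp hdδ (by simpa [dist_eq_norm] using h4) hξδ
      (h1.trans h2.le)
    have h6 : (⨆ ξ, S.crit p.1 p.2.1 ξ) ≤ ⨆ ξ, S.crit p.1 (p.2.1 + t • v) ξ :=
      hmin (interior_subset h3)
    have h7 : ((S.h p.1 p.2.1 p.2.2 : ℝ) : EReal) ≤ ⨆ ξ, S.crit p.1 p.2.1 ξ := by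
      rw [← crit_eq hp hb hr]
      exact le_iSup (fun ξ => S.crit p.1 p.2.1 ξ) p.2.2
    have h8 := EReal.coe_le_coe_iff.1 (h7.trans (h6.trans h5))
    have h9 : (∑ i, |S.N p.1 (p.2.1 + t • v) p.2.2 i|) ^ 2 / c ≤ t ^ 2 * (L' ^ 2 / c) := by
      rw [← mul_div_assoc]
      refine div_le_div_of_nonneg_right ?_ hc.le
      rw [← sq_abs t, ← mul_pow]
      exact pow_le_pow_left₀ (Finset.sum_nonneg fun i _ => abs_nonneg _) h1 2
    simp only [zero_smul, add_zero, ne_eq, OfNat.ofNat_ne_zero, not_false_eq_true, zero_pow,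
      zero_mul]
    linarith
  refine hmin'.hasDerivAt_eq_zero (((hasDerivAt_h_line hp hb hr v).add
    (((hasDerivAt_id (0 : ℝ)).pow 2).mul_const _)).congr_deriv ?_)
  simp

/-! ### Linearisation of the estimating equations -/

/-- First-order expansion of `M(φ) - ∫ k(T(F, φ))` at `φ₀`, uniform in `F`. -/
lemma eventually_res_near {c : ℝ} (hc : 0 < c) : ∀ᶠ p in S.nhd, ∀ i,
    |S.M p.2.1 i - (∫ y, S.k i (S.T p.1 p.2.1 y)) - S.res p.1 i - S.Jlin i (p.2.1 - S.φ₀)| ≤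
      c * ‖p.2.1 - S.φ₀‖ := by
  obtain ⟨δ, hδ, Hδ⟩ := eventually_nhd_iff.1 (eventually_G_near (S := S) hc)
  have hball : ∀ᶠ p in S.nhd, p.2.1 ∈ Metric.ball S.φ₀ (min δ S.ρ) :=
    tendsto_par (Metric.ball_mem_nhds _ (lt_min hδ S.ρ_pos))
  filter_upwards [eventually_admissible, hball, tendsto_dist₀.eventually_lt_const hδ]
    with p hp hb hd i
  set v := p.2.1 - S.φ₀ with hv
  have hvn : ‖v‖ < min δ S.ρ := by simpa [dist_eq_norm] using hb
  have hseg : ∀ t ∈ Icc (0 : ℝ) 1, ‖t • v‖ < min δ S.ρ := fun t ht => by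
    rw [norm_smul, Real.norm_of_nonneg ht.1]
    exact (mul_le_of_le_one_left (norm_nonneg _) ht.2).trans_lt hvn
  have hsegρ : ∀ t ∈ Icc (0 : ℝ) 1, S.φ₀ + t • v ∈ Metric.ball S.φ₀ S.ρ := fun t ht => by
    simpa [dist_eq_norm] using (hseg t ht).trans_le (min_le_right _ _)
  have hder : ∀ t ∈ Icc (0 : ℝ) 1, HasDerivAt
      (fun t : ℝ => S.M (S.φ₀ + t • v) i - (∫ y, S.k i (S.T p.1 (S.φ₀ + t • v) y)) - t * S.Jlin i v)
      (fderiv ℝ S.M (S.φ₀ + t • v) v i - S.G p.1 (S.φ₀ + t • v) 0 i v - S.Jlin i v) t := by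
    intro t ht
    have h1 := hasDerivAt_M_line i (hsegρ t ht)
    have h2 := hasDerivAt_integral_comp_T (S := S) (κ := S.k i) (κ' := deriv (S.k i)) (c := S.B)
      (S.k_diff i).continuous.measurable (continuous_deriv_k i).measurable
      (fun u _ => hasDerivAt_k i u) (S.dk_bound i) hp (hsegρ t ht)
      (integrable_k hp (hsegρ t ht) i)
    rw [G_zero]
    exact ((h1.sub h2).sub ((hasDerivAt_id t).mul_const _)).congr_deriv (by simp)
  have hbd : ∀ t ∈ Icc (0 : ℝ) 1,
      ‖fderiv ℝ S.M (S.φ₀ + t • v) v i - S.G p.1 (S.φ₀ + t • v) 0 i v - S.Jlin i v‖ ≤ c * ‖v‖ := by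
    intro t ht
    exact Hδ p.1 (S.φ₀ + t • v) 0 hp hd
      (by simpa using (hseg t ht).trans_le (min_le_left _ _)) (by simpa using hδ) i v
  have := (convex_Icc (0 : ℝ) 1).norm_image_sub_le_of_norm_hasDerivWithin_le
    (fun t ht => (hder t ht).hasDerivWithinAt) hbd (left_mem_Icc.2 zero_le_one)
    (right_mem_Icc.2 zero_le_one)
  simp only [one_smul, zero_smul, add_zero, one_mul, zero_mul, sub_zero, norm_one, mul_one,
    Real.norm_eq_abs] at this
  rw [hv, add_sub_cancel] at this
  rw [hv]
  refine le_trans (le_of_eq ?_) this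
  rw [res]
  ring_nf

/-- The linearised estimating equations: `A ξ - J (φ - φ₀) = g + o(|ξ| + |φ - φ₀|)`, where `g` is
the residual at the true parameter, and `Jᵗ ξ = o(|ξ|)`. -/
lemma eventually_linearised (hA : IsUnit S.A) {Φ : Set (EuclideanSpace ℝ ι)}
    (hΦ : Φ ∈ 𝓝 S.φ₀) {c : ℝ} (hc : 0 < c) : ∀ᶠ p in S.nhd,
    IsMinOn (fun φ => ⨆ ξ, S.crit p.1 φ ξ) Φ p.2.1 → IsMaxOn (S.crit p.1 p.2.1) univ p.2.2 →
    (∀ i, |∑ j, S.A i j * p.2.2 j - S.Jlin i (p.2.1 - S.φ₀) - S.res p.1 i| ≤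
      c * (‖p.2.2‖ + ‖p.2.1 - S.φ₀‖)) ∧
    ∀ v, |∑ i, p.2.2 i * S.Jlin i v| ≤ c * ‖p.2.2‖ * ‖v‖ := by
  filter_upwards [eventually_admissible, eventually_ball, eventually_lt_r₁,
    eventually_deriv_eq_zero hA hΦ, eventually_res_near hc, eventually_deriv_psi_near hc,
    eventually_G_near (show 0 < c / (q + 1) by positivity)] with p hp hb hr hD hres hψ hG hmin hmax
  refine ⟨fun i => ?_, fun v => ?_⟩
  · have h1 := N_eq_zero_of_isMaxOn hp hb hr hmax i
    have h2 := hres i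
    have h3 := hψ i
    have h4 : ∫ y, (deriv S.psi (S.lin p.2.2 (S.T p.1 p.2.1 y)) - 1) * S.k i (S.T p.1 p.2.1 y) =
        (∫ y, deriv S.psi (S.lin p.2.2 (S.T p.1 p.2.1 y)) * S.k i (S.T p.1 p.2.1 y)) -
        ∫ y, S.k i (S.T p.1 p.2.1 y) := by
      rw [← integral_sub (integrable_deriv_psi_mul hp hb hr (integrable_k hp hb i))
        (integrable_k hp hb i)]
      congr 1; ext y; ring
    rw [h4] at h3
    rw [N] at h1
    have h5 := abs_sub
      (S.M p.2.1 i - (∫ y, S.k i (S.T p.1 p.2.1 y)) - S.res p.1 i - S.Jlin i (p.2.1 - S.φ₀))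
      ((∫ y, deriv S.psi (S.lin p.2.2 (S.T p.1 p.2.1 y)) * S.k i (S.T p.1 p.2.1 y)) -
        (∫ y, S.k i (S.T p.1 p.2.1 y)) - ∑ j, S.A i j * p.2.2 j)
    calc _ = |S.M p.2.1 i - (∫ y, S.k i (S.T p.1 p.2.1 y)) - S.res p.1 i
          - S.Jlin i (p.2.1 - S.φ₀) -
          ((∫ y, deriv S.psi (S.lin p.2.2 (S.T p.1 p.2.1 y)) * S.k i (S.T p.1 p.2.1 y)) -
            (∫ y, S.k i (S.T p.1 p.2.1 y)) - ∑ j, S.A i j * p.2.2 j)| := by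
          congr 1
          linarith
      _ ≤ _ := by linarith
  · have h1 := hD hmin hmax v
    have h2 : ∑ i, p.2.2 i * S.Jlin i v = -∑ i, p.2.2 i *
        (fderiv ℝ S.M p.2.1 v i - S.G p.1 p.2.1 p.2.2 i v - S.Jlin i v) := by
      have : ∑ i, p.2.2 i * (fderiv ℝ S.M p.2.1 v i - S.G p.1 p.2.1 p.2.2 i v - S.Jlin i v) =
          ∑ i, p.2.2 i * (fderiv ℝ S.M p.2.1 v i - S.G p.1 p.2.1 p.2.2 i v) -
          ∑ i, p.2.2 i * S.Jlin i v := by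
        rw [← Finset.sum_sub_distrib]
        exact Finset.sum_congr rfl fun i _ => by ring
      rw [this, h1]; ring
    rw [h2, abs_neg]
    refine (Finset.abs_sum_le_sum_abs _ _).trans ((Finset.sum_le_sum
      (g := fun _ => ‖p.2.2‖ * (c / (q + 1) * ‖v‖)) fun i _ => ?_).trans ?_)
    · rw [abs_mul]
      exact mul_le_mul (abs_apply_le_norm _ i) (hG i v) (abs_nonneg _) (norm_nonneg _)
    · rw [Finset.sum_const, Finset.card_univ, Fintype.card_fin, nsmul_eq_mul]
      have h3 : (q : ℝ) * (c / (q + 1)) ≤ c := by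
        rw [mul_div_assoc', div_le_iff₀ (by positivity)]
        nlinarith
      calc (q : ℝ) * (‖p.2.2‖ * (c / (q + 1) * ‖v‖))
          = q * (c / (q + 1)) * (‖p.2.2‖ * ‖v‖) := by ring
        _ ≤ c * (‖p.2.2‖ * ‖v‖) := by gcongr
        _ = _ := by ring

end PluginProblem

end

section

/-! ### Solving the linearised equations -/

lemma exists_norm_mulVec_le {m n : Type*} [Fintype m] [Fintype n] (B : Matrix m n ℝ) :
    ∃ C, 0 ≤ C ∧ ∀ v, ‖B *ᵥ v‖ ≤ C * ‖v‖ :=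
  ⟨‖LinearMap.toContinuousLinearMap B.mulVecLin‖, norm_nonneg _, fun v =>
    (LinearMap.toContinuousLinearMap B.mulVecLin).le_opNorm v⟩

lemma exists_norm_toLp_le (n : Type*) [Fintype n] :
    ∃ C, 0 ≤ C ∧ ∀ v : n → ℝ, ‖(WithLp.toLp 2 v : EuclideanSpace ℝ n)‖ ≤ C * ‖v‖ :=
  ⟨‖((EuclideanSpace.equiv n ℝ).symm : (n → ℝ) →L[ℝ] EuclideanSpace ℝ n)‖, norm_nonneg _, fun v =>
    ((EuclideanSpace.equiv n ℝ).symm : (n → ℝ) →L[ℝ] EuclideanSpace ℝ n).le_opNorm v⟩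

variable {q : ℕ} {ι : Type} [Fintype ι] [DecidableEq ι]

/-- Exact solution of `A x - J δ = g + e₁`, `Jᵗ x = e₂`. -/
lemma block_solve {J : Matrix (Fin q) ι ℝ} {A : Matrix (Fin q) (Fin q) ℝ} (hA : IsUnit A)
    (hJ : IsUnit (Jᵀ * A⁻¹ * J)) (δ : ι → ℝ) (x g : Fin q → ℝ) :
    Sum.elim δ x - matHP J A *ᵥ g = matHP J A *ᵥ (A *ᵥ x - J *ᵥ δ - g) +
      Matrix.fromRows (sigmaTilde J A) (A⁻¹ * J * sigmaTilde J A) *ᵥ (Jᵀ *ᵥ x) := by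
  have hA' : A⁻¹ * A = 1 := Matrix.nonsing_inv_mul _ ((Matrix.isUnit_iff_isUnit_det _).1 hA)
  have hS : sigmaTilde J A * (Jᵀ * A⁻¹ * J) = 1 :=
    Matrix.nonsing_inv_mul _ ((Matrix.isUnit_iff_isUnit_det _).1 hJ)
  have h1 : matH J A * A = -(sigmaTilde J A * Jᵀ) := by
    rw [matH, Matrix.neg_mul, Matrix.mul_assoc _ A⁻¹ A, hA', Matrix.mul_one]
  have h2 : matH J A * J = -1 := by
    rw [matH, Matrix.neg_mul, Matrix.mul_assoc, Matrix.mul_assoc, ← Matrix.mul_assoc Jᵀ, hS]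
  have h3 : matP J A * A = 1 - A⁻¹ * J * sigmaTilde J A * Jᵀ := by
    rw [matP, Matrix.sub_mul, hA', Matrix.mul_assoc _ A⁻¹ A, hA', Matrix.mul_one]
  have h4 : matP J A * J = 0 := by
    have : A⁻¹ * J * sigmaTilde J A * Jᵀ * A⁻¹ * J =
        A⁻¹ * J * (sigmaTilde J A * (Jᵀ * A⁻¹ * J)) := by simp only [Matrix.mul_assoc]
    rw [matP, Matrix.sub_mul, this, hS, Matrix.mul_one, sub_self]
  rw [matHP, Matrix.fromRows_mulVec, Matrix.fromRows_mulVec, Matrix.fromRows_mulVec]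
  simp only [Matrix.mulVec_sub, Matrix.mulVec_mulVec, h1, h2, h3, h4]
  ext (j | i)
  · simp [Matrix.neg_mulVec]
    ring
  · simp [Matrix.sub_mulVec]
    ring

namespace PluginProblem

variable {S : PluginProblem ι q}

variable (S) in
/-- The Jacobian matrix at `φ₀` of `M(φ) - ∫ k(T(F₀, φ))`. -/
def J : Matrix (Fin q) ι ℝ := Matrix.of fun i j => S.Jlin i (EuclideanSpace.single j 1)

lemma Jlin_eq (i : Fin q) (v : EuclideanSpace ℝ ι) : S.Jlin i v = ∑ j, S.J i j * v j := by
  have h1 : ∀ v, S.Jlin i v = fderiv ℝ S.M S.φ₀ v i - S.G S.F₀ S.φ₀ 0 i v := fun v => by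
    rw [G_zero, Jlin]
  simp only [J, Matrix.of_apply, h1, sub_mul, Finset.sum_sub_distrib]
  rw [G_eq_sum admissible_F₀ φ₀_mem (by simpa using r₁_pos)]
  congr 1
  · conv_lhs => rw [sum_single_eq v, map_sum]
    simp [mul_comm]
  · exact Finset.sum_congr rfl fun j _ => mul_comm _ _

/-- The asymptotic linear expansion: a minimax point `(φ, ξ)` near `(φ₀, 0)` satisfies
`(φ - φ₀, ξ) = (H ; P) g + o(|g|)`, where `g` is the residual of the constraints at `φ₀`. -/
lemma eventually_expansion (hA : IsUnit S.A) (hJ : IsUnit (S.Jᵀ * S.A⁻¹ * S.J))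
    {Φ : Set (EuclideanSpace ℝ ι)} (hΦ : Φ ∈ 𝓝 S.φ₀) {c : ℝ} (hc : 0 < c) : ∀ᶠ p in S.nhd,
    IsMinOn (fun φ => ⨆ ξ, S.crit p.1 φ ξ) Φ p.2.1 → IsMaxOn (S.crit p.1 p.2.1) univ p.2.2 →
    ‖(WithLp.toLp 2 (Sum.elim (fun j => p.2.1 j - S.φ₀ j) p.2.2 - matHP S.J S.A *ᵥ S.res p.1) :
      EuclideanSpace ℝ (ι ⊕ Fin q))‖ ≤ c * ‖S.res p.1‖ := by
  obtain ⟨C₁, hC₁, H₁⟩ := exists_norm_mulVec_le (matHP S.J S.A)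
  obtain ⟨C₂, hC₂, H₂⟩ := exists_norm_mulVec_le
    (Matrix.fromRows (sigmaTilde S.J S.A) (S.A⁻¹ * S.J * sigmaTilde S.J S.A))
  obtain ⟨C₃, hC₃, H₃⟩ := exists_norm_toLp_le (ι ⊕ Fin q)
  -- the relative error `3 K c'` of the expansion is kept below `1 / 2` and `c / (2 K)`
  set K := C₃ * (C₁ + C₂) + C₃ * C₁ + 1 with hK
  have hKpos : 0 < K := by positivity
  obtain ⟨c', hc'0, hc'1, hc'2⟩ : ∃ c' > 0, 3 * K * c' ≤ 1 / 2 ∧ 6 * K * K * c' ≤ c := by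
    refine ⟨min (1 / (6 * K)) (c / (6 * K * K)), by positivity, ?_, ?_⟩
    · calc 3 * K * min (1 / (6 * K)) (c / (6 * K * K)) ≤ 3 * K * (1 / (6 * K)) :=
          mul_le_mul_of_nonneg_left (min_le_left _ _) (by positivity)
        _ = 1 / 2 := by field_simp; norm_num
    · calc 6 * K * K * min (1 / (6 * K)) (c / (6 * K * K)) ≤ 6 * K * K * (c / (6 * K * K)) :=
          mul_le_mul_of_nonneg_left (min_le_right _ _) (by positivity)
        _ = c := by field_simp
  filter_upwards [eventually_linearised hA hΦ hc'0] with p hp hmin hmax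
  obtain ⟨h1, h2⟩ := hp hmin hmax
  set δ : ι → ℝ := fun j => p.2.1 j - S.φ₀ j with hδ
  set Z : EuclideanSpace ℝ (ι ⊕ Fin q) := WithLp.toLp 2 (Sum.elim δ p.2.2) with hZ
  set g := S.res p.1 with hg
  set W : EuclideanSpace ℝ (ι ⊕ Fin q) := WithLp.toLp 2 (matHP S.J S.A *ᵥ g) with hW
  have hZW : (WithLp.toLp 2 (Sum.elim δ p.2.2 - matHP S.J S.A *ᵥ g) :
      EuclideanSpace ℝ (ι ⊕ Fin q)) = Z - W := rfl
  have hn1 : ‖p.2.2‖ ≤ ‖Z‖ := by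
    rw [EuclideanSpace.norm_eq, EuclideanSpace.norm_eq]
    refine Real.sqrt_le_sqrt ?_
    simp only [hZ, Fintype.sum_sum_type, Sum.elim_inl, Sum.elim_inr]
    exact le_add_of_nonneg_left (Finset.sum_nonneg fun _ _ => sq_nonneg _)
  have hn2 : ‖p.2.1 - S.φ₀‖ ≤ ‖Z‖ := by
    rw [EuclideanSpace.norm_eq, EuclideanSpace.norm_eq]
    refine Real.sqrt_le_sqrt ?_
    simp only [hZ, Fintype.sum_sum_type, Sum.elim_inl, Sum.elim_inr]
    exact le_add_of_nonneg_right (Finset.sum_nonneg fun _ _ => sq_nonneg _)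
  have e1 : ‖S.A *ᵥ p.2.2.ofLp - S.J *ᵥ δ - g‖ ≤ 2 * c' * ‖Z‖ := by
    refine (pi_norm_le_iff_of_nonneg (by positivity)).2 fun i => ?_
    have h3 := h1 i
    rw [Jlin_eq] at h3
    refine le_trans (le_of_eq ?_) (h3.trans ?_)
    · simp [Matrix.mulVec, dotProduct, hδ]
    · nlinarith
  have e2 : ‖S.Jᵀ *ᵥ p.2.2.ofLp‖ ≤ c' * ‖Z‖ := by
    refine (pi_norm_le_iff_of_nonneg (by positivity)).2 fun j => ?_
    have h3 := h2 (EuclideanSpace.single j 1)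
    refine le_trans (le_of_eq ?_) (h3.trans ?_)
    · simp [Matrix.mulVec, dotProduct, J, mul_comm]
    · simp only [PiLp.norm_single, norm_one, mul_one]
      exact mul_le_mul_of_nonneg_left hn1 hc'0.le
  have e3 : ‖Z - W‖ ≤ 3 * K * c' * ‖Z‖ := by
    rw [← hZW, block_solve hA hJ]
    refine (H₃ _).trans ?_
    have h4 := (norm_add_le (matHP S.J S.A *ᵥ (S.A *ᵥ p.2.2.ofLp - S.J *ᵥ δ - g))
      (Matrix.fromRows (sigmaTilde S.J S.A) (S.A⁻¹ * S.J * sigmaTilde S.J S.A) *ᵥ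
        (S.Jᵀ *ᵥ p.2.2.ofLp)))
    have h5 := (H₁ (S.A *ᵥ p.2.2.ofLp - S.J *ᵥ δ - g)).trans (mul_le_mul_of_nonneg_left e1 hC₁)
    have h6 := (H₂ (S.Jᵀ *ᵥ p.2.2.ofLp)).trans (mul_le_mul_of_nonneg_left e2 hC₂)
    refine (mul_le_mul_of_nonneg_left ((h4.trans (add_le_add h5 h6))) hC₃).trans ?_
    have h7 : 0 ≤ c' * ‖Z‖ := by positivity
    have h8 : C₃ * (2 * C₁ + C₂) ≤ 3 * K := by
      rw [hK]
      nlinarith [mul_nonneg hC₃ hC₁, mul_nonneg hC₃ hC₂]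
    calc C₃ * (C₁ * (2 * c' * ‖Z‖) + C₂ * (c' * ‖Z‖)) = C₃ * (2 * C₁ + C₂) * (c' * ‖Z‖) := by ring
      _ ≤ 3 * K * (c' * ‖Z‖) := mul_le_mul_of_nonneg_right h8 h7
      _ = _ := by ring
  have e4 : ‖W‖ ≤ K * ‖g‖ := by
    refine (H₃ _).trans ((mul_le_mul_of_nonneg_left (H₁ g) hC₃).trans ?_)
    rw [← mul_assoc]
    refine mul_le_mul_of_nonneg_right ?_ (norm_nonneg _)
    rw [hK]
    nlinarith [mul_nonneg hC₃ hC₁, mul_nonneg hC₃ hC₂]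
  have e5 : ‖Z‖ ≤ 2 * ‖W‖ := by
    have h9 := norm_add_le (Z - W) W
    rw [sub_add_cancel] at h9
    have := mul_le_mul_of_nonneg_right hc'1 (norm_nonneg Z)
    linarith
  rw [hZW]
  calc ‖Z - W‖ ≤ 3 * K * c' * ‖Z‖ := e3
    _ ≤ 3 * K * c' * (2 * (K * ‖g‖)) := by gcongr; linarith
    _ = 6 * K * K * c' * ‖g‖ := by ring
    _ ≤ c * ‖g‖ := by gcongr

end PluginProblem

end

section

/-! ### Integrated Legendre polynomials -/

lemma contDiff_legendre (r : ℕ) : ContDiff ℝ 1 (legendre r) := by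
  unfold legendre
  exact ContDiff.sum fun k _ => contDiff_const.mul (contDiff_id.pow k)

lemma hasDerivAt_K (r : ℕ) (t : ℝ) : HasDerivAt (K r) (legendre (r - 1) t) t :=
  (contDiff_legendre _).continuous.integral_hasStrictDerivAt 0 t |>.hasDerivAt

lemma deriv_K (r : ℕ) : deriv (K r) = legendre (r - 1) :=
  funext fun t => (hasDerivAt_K r t).deriv

lemma contDiff_K (r : ℕ) : ContDiff ℝ 1 (K r) := by
  rw [contDiff_one_iff_deriv, deriv_K]
  exact ⟨fun t => (hasDerivAt_K r t).differentiableAt, (contDiff_legendre _).continuous⟩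

lemma K_zero (r : ℕ) : K r 0 = 0 := by simp [K]

lemma legendre_eq_aeval (r : ℕ) (u : ℝ) :
    legendre r u = (-1) ^ r * Polynomial.aeval u (Polynomial.shiftedLegendre r) := by
  simp only [legendre, Polynomial.shiftedLegendre, map_sum, Finset.mul_sum]
  refine Finset.sum_congr rfl fun k hk => ?_
  have hk' : k ≤ r := Nat.lt_succ_iff.1 (Finset.mem_range.1 hk)
  have h1 : (r + k).choose k = (r + k).choose r := by
    rw [← Nat.choose_symm_add]
  have h2 : (-1 : ℝ) ^ (r - k) = (-1) ^ r * (-1) ^ k := by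
    obtain ⟨j, rfl⟩ := Nat.exists_eq_add_of_le hk'
    rw [Nat.add_sub_cancel_left, ← pow_add, show k + j + k = j + 2 * k by ring, pow_add, pow_mul]
    simp
  rw [h1, h2]
  simp
  ring

/-- By Rodrigues' formula, the shifted Legendre polynomials of positive degree have mean zero on
`[0, 1]`. -/
lemma integral_legendre {r : ℕ} (hr : r ≠ 0) : ∫ u in (0 : ℝ)..1, legendre r u = 0 := by
  obtain ⟨n, rfl⟩ := Nat.exists_eq_succ_of_ne_zero hr
  set p : Polynomial ℤ := Polynomial.X ^ (n + 1) * (1 - Polynomial.X) ^ (n + 1) with hp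
  set Q : Polynomial ℤ := Polynomial.derivative^[n] p with hQ
  have hrod : ((n + 1).factorial : Polynomial ℤ) * Polynomial.shiftedLegendre (n + 1) =
      Polynomial.derivative Q := by
    rw [Polynomial.factorial_mul_shiftedLegendre_eq, hQ]
    exact Function.iterate_succ_apply' _ _ _
  have hQ0 : Polynomial.aeval (0 : ℝ) Q = 0 := by
    have h1 : Polynomial.X ^ (n + 1 - n) ∣ Q :=
      Polynomial.pow_sub_dvd_iterate_derivative_of_pow_dvd n (Dvd.intro _ rfl)
    obtain ⟨c, hc⟩ := h1
    rw [hc]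
    simp
  have hQ1 : Polynomial.aeval (1 : ℝ) Q = 0 := by
    have h1 : (1 - Polynomial.X) ^ (n + 1 - n) ∣ Q :=
      Polynomial.pow_sub_dvd_iterate_derivative_of_pow_dvd n (Dvd.intro_left _ rfl)
    obtain ⟨c, hc⟩ := h1
    rw [hc]
    simp
  have hderiv : ∀ u : ℝ, HasDerivAt (fun u => Polynomial.aeval u Q)
      (((n + 1).factorial : ℝ) * Polynomial.aeval u (Polynomial.shiftedLegendre (n + 1))) u := by
    intro u
    refine (Q.hasDerivAt_aeval u).congr_deriv ?_
    rw [← hrod]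
    simp
  have h2 := intervalIntegral.integral_eq_sub_of_hasDerivAt (a := 0) (b := 1)
    (fun u _ => hderiv u) (Continuous.intervalIntegrable
      (continuous_const.mul (Polynomial.continuous_aeval _)) _ _)
  rw [hQ0, hQ1, sub_zero, intervalIntegral.integral_const_mul] at h2
  have h3 : ∫ u in (0 : ℝ)..1, Polynomial.aeval u (Polynomial.shiftedLegendre (n + 1)) = 0 :=
    (mul_eq_zero.1 h2).resolve_left (by positivity)
  simp only [legendre_eq_aeval]
  rw [intervalIntegral.integral_const_mul]
  simp [h3]

lemma K_one (r : ℕ) : K (r + 2) 1 = 0 := integral_legendre (Nat.succ_ne_zero r)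

lemma exists_bound_K {ι : Type*} [Fintype ι] (r : ι → ℕ) (R : ℝ) : ∃ B, 0 ≤ B ∧
    (∀ i u, |u| ≤ R → |K (r i) u| ≤ B) ∧ (∀ i u, |u| ≤ R → |legendre (r i - 1) u| ≤ B) ∧
    ∀ i u v, |u| ≤ R → |v| ≤ R →
      |legendre (r i - 1) u - legendre (r i - 1) v| ≤ B * |u - v| := by
  have h1 : ∀ i, ∃ B, ∀ u ∈ Icc (-R) R, ‖K (r i) u‖ ≤ B := fun i =>
    isCompact_Icc.exists_bound_of_continuousOn (contDiff_K _).continuous.continuousOn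
  have h2 : ∀ i, ∃ B, ∀ u ∈ Icc (-R) R, ‖legendre (r i - 1) u‖ ≤ B := fun i =>
    isCompact_Icc.exists_bound_of_continuousOn (contDiff_legendre _).continuous.continuousOn
  have h3 : ∀ i, ∃ B, ∀ u ∈ Icc (-R) R, ‖deriv (legendre (r i - 1)) u‖ ≤ B := fun i =>
    isCompact_Icc.exists_bound_of_continuousOn
      ((contDiff_legendre _).continuous_deriv le_rfl).continuousOn
  choose B₁ hB₁ using h1
  choose B₂ hB₂ using h2
  choose B₃ hB₃ using h3
  have hle : ∀ (b : ι → ℝ) i, b i ≤ ∑ i, |b i| := fun b i => (le_abs_self _).trans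
    (Finset.single_le_sum (f := fun i => |b i|) (fun i _ => abs_nonneg _) (Finset.mem_univ i))
  have hnn : ∀ b : ι → ℝ, 0 ≤ ∑ i, |b i| := fun b => Finset.sum_nonneg fun i _ => abs_nonneg _
  refine ⟨∑ i, |B₁ i| + ∑ i, |B₂ i| + ∑ i, |B₃ i|, by linarith [hnn B₁, hnn B₂, hnn B₃],
    fun i u hu => ?_, fun i u hu => ?_, fun i u v hu hv => ?_⟩
  · have := hB₁ i u (abs_le.1 hu)
    rw [Real.norm_eq_abs] at this
    linarith [hle B₁ i, hnn B₂, hnn B₃]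
  · have := hB₂ i u (abs_le.1 hu)
    rw [Real.norm_eq_abs] at this
    linarith [hle B₂ i, hnn B₁, hnn B₃]
  · have := (convex_Icc (-R) R).norm_image_sub_le_of_norm_deriv_le
      (f := legendre (r i - 1)) (C := B₃ i) (x := v) (y := u)
      (fun x _ => (contDiff_legendre _).differentiable (by simp) x)
      (fun x hx => hB₃ i x hx) (abs_le.1 hv) (abs_le.1 hu)
    simp only [Real.norm_eq_abs] at this
    exact this.trans (mul_le_mul_of_nonneg_right (by linarith [hle B₃ i, hnn B₁, hnn B₂])
      (abs_nonneg _))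

/-! ### Distribution functions -/

lemma measurable_cdf (P : Measure ℝ) : Measurable (cdf P) := (monotone_cdf P).measurable

/-- Integration against the quantile measure is integration of a function of the distribution
function, for integrands that vanish at `0` and `1`. -/
lemma quantileMeasure_integral (P : Measure ℝ) {k : ℝ → ℝ} (hk : Measurable k) (h0 : k 0 = 0)
    (h1 : k 1 = 0) :
    (Integrable k (quantileMeasure P) ↔ Integrable fun y => k (cdf P y)) ∧
      ∫ u, k u ∂quantileMeasure P = ∫ y, k (cdf P y) := by
  have hout : ∀ y, y ∉ {x : ℝ | 0 < cdf P x ∧ cdf P x < 1} → k (cdf P y) = 0 := by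
    intro y hy
    rcases (cdf_nonneg P y).eq_or_lt with h | h
    · rw [← h, h0]
    · rcases (cdf_le_one P y).eq_or_lt with h' | h'
      · rw [h', h1]
      · exact absurd ⟨h, h'⟩ hy
  constructor
  · rw [quantileMeasure, integrable_map_measure hk.aestronglyMeasurable
      (measurable_cdf P).aemeasurable]
    refine integrableOn_iff_integrable_of_support_subset fun y hy => ?_
    by_contra h
    exact hy (hout y h)
  · rw [quantileMeasure, integral_map (measurable_cdf P).aemeasurable hk.aestronglyMeasurable]
    exact setIntegral_eq_integral_of_forall_compl_eq_zero hout

/-- A step function at `x` is at finite `L¹` distance from a distribution function `F` as soon as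
`F (1 - F)` is integrable. -/
lemma integrable_step_sub_cdf {P : Measure ℝ}
    (hP : Integrable fun y => cdf P y * (1 - cdf P y)) (x : ℝ) :
    Integrable fun y => (Iic y).indicator (fun _ => (1 : ℝ)) x - cdf P y := by
  obtain ⟨a, ha⟩ := ((tendsto_cdf_atBot P).eventually_lt_const
    (show (0 : ℝ) < 1 / 2 by norm_num)).exists
  obtain ⟨b, hb⟩ := ((tendsto_cdf_atTop P).eventually_const_lt
    (show (1 / 2 : ℝ) < 1 by norm_num)).exists
  have hstep : (fun y => (Iic y).indicator (fun _ => (1 : ℝ)) x) =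
      (Ici x).indicator (fun _ => (1 : ℝ)) := by
    ext y
    simp [indicator_apply]
  -- outside a bounded interval the difference is at most `2 F (1 - F)`
  refine Integrable.mono' (g := fun y => 2 * (cdf P y * (1 - cdf P y)) +
    (Icc (min a x) (max b x)).indicator (fun _ => (1 : ℝ)) y) ((hP.const_mul 2).add ?_) ?_
    (ae_of_all _ fun y => ?_)
  · exact (integrable_indicator_iff measurableSet_Icc).2 (integrableOn_const (by simp))
  · refine Measurable.aestronglyMeasurable (Measurable.sub ?_ (measurable_cdf P))
    rw [hstep]
    exact measurable_const.indicator measurableSet_Ici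
  · have h0 := cdf_nonneg P y
    have h1 := cdf_le_one P y
    rw [Real.norm_eq_abs]
    by_cases hy : y ∈ Icc (min a x) (max b x)
    · rw [indicator_of_mem hy]
      have : |(Iic y).indicator (fun _ => (1 : ℝ)) x - cdf P y| ≤ 1 := by
        by_cases hx : x ∈ Iic y
        · rw [indicator_of_mem hx, abs_le]; constructor <;> linarith
        · rw [indicator_of_notMem hx, abs_le]; constructor <;> linarith
      nlinarith
    · rw [indicator_of_notMem hy]
      rcases lt_or_ge y (min a x) with h | h
      · have hx : x ∉ Iic y := not_le.2 (h.trans_le (min_le_right _ _))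
        have hF : cdf P y ≤ cdf P a := monotone_cdf P (h.le.trans (min_le_left _ _))
        rw [indicator_of_notMem hx, zero_sub, abs_neg, abs_of_nonneg h0]
        nlinarith
      · have h' : max b x < y := by
          by_contra hcon
          exact hy ⟨h, not_lt.1 hcon⟩
        have hx : x ∈ Iic y := ((le_max_right _ _).trans h'.le : x ≤ y)
        have hF : cdf P b ≤ cdf P y := monotone_cdf P ((le_max_left _ _).trans h'.le)
        rw [indicator_of_mem hx, abs_of_nonneg (by linarith)]
        nlinarith

lemma integrable_cdf_mul_of_sqrt {P : Measure ℝ}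
    (hP : Integrable fun y => √(cdf P y * (1 - cdf P y))) :
    Integrable fun y => cdf P y * (1 - cdf P y) := by
  refine Integrable.mono' hP ((measurable_cdf P).mul
    (measurable_const.sub (measurable_cdf P))).aestronglyMeasurable (ae_of_all _ fun y => ?_)
  have h0 := cdf_nonneg P y
  have h1 := cdf_le_one P y
  have h2 : 0 ≤ cdf P y * (1 - cdf P y) := mul_nonneg h0 (by linarith)
  rw [Real.norm_of_nonneg h2]
  refine Real.le_sqrt_of_sq_le ?_
  have h3 : cdf P y * (1 - cdf P y) ≤ 1 := mul_le_one₀ h1 (by linarith) (by linarith)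
  nlinarith [mul_le_mul_of_nonneg_left h3 h2]

lemma cdf_mixture {PT P P₀ : Measure ℝ} {a : ℝ} (ha : a ∈ Ioo (0 : ℝ) 1)
    [IsProbabilityMeasure PT] [IsProbabilityMeasure P] [IsProbabilityMeasure P₀]
    (h : PT = ENNReal.ofReal a • P + ENNReal.ofReal (1 - a) • P₀) (y : ℝ) :
    cdf PT y = a * cdf P y + (1 - a) * cdf P₀ y := by
  rw [cdf_eq_real, cdf_eq_real, cdf_eq_real, h,
    measureReal_add_apply (by simp [ENNReal.mul_eq_top]) (by simp [ENNReal.mul_eq_top])]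
  simp [measureReal_ennreal_smul_apply, ENNReal.toReal_ofReal ha.1.le,
    ENNReal.toReal_ofReal (sub_nonneg.2 ha.2.le)]

end

section

/-! ### The semiparametric mixture model as a plug-in problem -/

variable {d s : ℕ}

/-- The projection `φ ↦ λ` as a continuous linear map. -/
def lamL (d s : ℕ) : Par d s →L[ℝ] ℝ := EuclideanSpace.proj (Sum.inl ())

/-- The projection `φ ↦ θ` as a continuous linear map. -/
def thetaL (d s : ℕ) : Par d s →L[ℝ] EuclideanSpace ℝ (Fin d) :=
  ((EuclideanSpace.equiv (Fin d) ℝ).symm : (Fin d → ℝ) →L[ℝ] EuclideanSpace ℝ (Fin d)).comp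
    (ContinuousLinearMap.pi fun j => EuclideanSpace.proj (Sum.inr (Sum.inl j)))

/-- The projection `φ ↦ α` as a continuous linear map. -/
def alphaL (d s : ℕ) : Par d s →L[ℝ] EuclideanSpace ℝ (Fin s) :=
  ((EuclideanSpace.equiv (Fin s) ℝ).symm : (Fin s → ℝ) →L[ℝ] EuclideanSpace ℝ (Fin s)).comp
    (ContinuousLinearMap.pi fun j => EuclideanSpace.proj (Sum.inr (Sum.inr j)))

lemma lamL_apply (φ : Par d s) : lamL d s φ = φ.lam := rfl

lemma thetaL_apply (φ : Par d s) : thetaL d s φ = φ.theta := rfl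

lemma alphaL_apply (φ : Par d s) : alphaL d s φ = φ.alpha := rfl

lemma abs_lam_le (v : Par d s) : |v.lam| ≤ ‖v‖ := PiLp.norm_apply_le v (Sum.inl ())

lemma norm_theta_le (v : Par d s) : ‖v.theta‖ ≤ ‖v‖ := by
  rw [EuclideanSpace.norm_eq, EuclideanSpace.norm_eq]
  refine Real.sqrt_le_sqrt ?_
  rw [Fintype.sum_sum_type, Fintype.sum_sum_type]
  have h1 : 0 ≤ ∑ a, ‖v (Sum.inl a)‖ ^ 2 := Finset.sum_nonneg fun _ _ => sq_nonneg _
  have h2 : 0 ≤ ∑ a, ‖v (Sum.inr (Sum.inr a))‖ ^ 2 := Finset.sum_nonneg fun _ _ => sq_nonneg _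
  simp only [Par.theta]
  linarith

lemma alphaL_surjective : Function.Surjective (alphaL d s) := by
  intro a
  refine ⟨WithLp.toLp 2 (Sum.elim (fun _ => 0) (Sum.elim (fun _ => 0) fun k => a k)), ?_⟩
  ext k
  rfl

/-- The derivative of `F₀(y|φ)` in `φ`. -/
def derivF0 (P₁ : EuclideanSpace ℝ (Fin d) → Measure ℝ) (F : ℝ → ℝ) (φ : Par d s) (y : ℝ) :
    Par d s →L[ℝ] ℝ :=
  (1 / (1 - φ.lam) ^ 2 * (F y - cdf (P₁ φ.theta) y)) • lamL d s -
    (φ.lam / (1 - φ.lam)) • (innerSL ℝ (gradF1 P₁ y φ.theta)).comp (thetaL d s)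

variable {P₁ : EuclideanSpace ℝ (Fin d) → Measure ℝ} {F : ℝ → ℝ} {φ φ' φstar : Par d s}

lemma derivF0_apply (y : ℝ) (v : Par d s) :
    derivF0 P₁ F φ y v = 1 / (1 - φ.lam) ^ 2 * (F y - cdf (P₁ φ.theta) y) * v.lam -
      φ.lam / (1 - φ.lam) * inner ℝ (gradF1 P₁ y φ.theta) v.theta := by
  simp [derivF0, lamL_apply, thetaL_apply]

lemma hasFDerivAt_cdf {y : ℝ} {θ : EuclideanSpace ℝ (Fin d)}
    (h : DifferentiableAt ℝ (fun t => (cdf (P₁ t) y : ℝ)) θ) :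
    HasFDerivAt (fun t => (cdf (P₁ t) y : ℝ)) (innerSL ℝ (gradF1 P₁ y θ)) θ := by
  have := h.hasGradientAt.hasFDerivAt
  exact this

lemma hasFDerivAt_cdf_theta {y : ℝ}
    (h : DifferentiableAt ℝ (fun t => (cdf (P₁ t) y : ℝ)) φ.theta) :
    HasFDerivAt (fun φ : Par d s => (cdf (P₁ φ.theta) y : ℝ))
      ((innerSL ℝ (gradF1 P₁ y φ.theta)).comp (thetaL d s)) φ := by
  have := (hasFDerivAt_cdf h).comp φ ((thetaL d s).hasFDerivAt (x := φ))
  exact this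

lemma hasFDerivAt_F0 (hlam : φ.lam < 1) {y : ℝ}
    (h : DifferentiableAt ℝ (fun t => (cdf (P₁ t) y : ℝ)) φ.theta) :
    HasFDerivAt (fun φ => F0 P₁ F φ y) (derivF0 P₁ F φ y) φ := by
  have hne : 1 - φ.lam ≠ 0 := by linarith
  have ha : HasDerivAt (fun a : ℝ => 1 / (1 - a)) (1 / (1 - φ.lam) ^ 2) φ.lam := by
    simp only [one_div]
    exact (((hasDerivAt_id φ.lam).const_sub 1).inv hne).congr_deriv (by simp)
  have hb : HasDerivAt (fun a : ℝ => a / (1 - a)) (1 / (1 - φ.lam) ^ 2) φ.lam := by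
    exact ((hasDerivAt_id φ.lam).div ((hasDerivAt_id φ.lam).const_sub 1) hne).congr_deriv
      (by simp)
  have hL : HasFDerivAt (fun φ : Par d s => φ.lam) (lamL d s) φ := (lamL d s).hasFDerivAt
  have ha' := (ha.comp_hasFDerivAt φ hL).mul_const (F y)
  have hb' := (hb.comp_hasFDerivAt φ hL).mul (hasFDerivAt_cdf_theta h)
  refine (ha'.sub hb').congr_fderiv ?_
  ext v
  simp [derivF0_apply, lamL_apply, thetaL_apply]
  ring

lemma measurable_F0 (hF : Measurable F) : Measurable (F0 P₁ F φ) :=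
  (hF.const_mul _).sub ((measurable_cdf _).const_mul _)

/-- The conditions on a neighbourhood of radius `ρ` of the true parameter: the proportion stays
below `1 - c`, and `B₁` dominates the gradient of the parametric distribution function. -/
structure LocallyRegular (P₁ : EuclideanSpace ℝ (Fin d) → Measure ℝ) (φstar : Par d s)
    (B₁ : ℝ → ℝ) (ρ c : ℝ) : Prop where
  ρ_pos : 0 < ρ
  ρ_le : ρ ≤ 1
  c_pos : 0 < c
  c_le : c ≤ 1
  int : Integrable B₁
  lam : ∀ φ ∈ Metric.ball φstar ρ, 0 < φ.lam ∧ c ≤ 1 - φ.lam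
  diff : ∀ φ ∈ Metric.ball φstar ρ, ∀ y,
    DifferentiableAt ℝ (fun t => (cdf (P₁ t) y : ℝ)) φ.theta
  grad_le : ∀ φ ∈ Metric.ball φstar ρ, ∀ y, ‖gradF1 P₁ y φ.theta‖ ≤ B₁ y
  grad_cont : ∀ y, ContinuousAt (gradF1 P₁ y) φstar.theta

namespace LocallyRegular

variable {B₁ : ℝ → ℝ} {ρ c : ℝ} (hR : LocallyRegular P₁ φstar B₁ ρ c)
include hR

lemma center_mem : φstar ∈ Metric.ball φstar ρ := Metric.mem_ball_self hR.ρ_pos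

lemma bound_nonneg (y : ℝ) : 0 ≤ B₁ y :=
  (norm_nonneg _).trans (hR.grad_le φstar hR.center_mem y)

lemma lam_lt_one (hφ : φ ∈ Metric.ball φstar ρ) : φ.lam < 1 := by
  linarith [(hR.lam φ hφ).2, hR.c_pos]

lemma coeff_le (hφ : φ ∈ Metric.ball φstar ρ) :
    |1 / (1 - φ.lam)| ≤ 1 / c ∧ |1 / (1 - φ.lam) ^ 2| ≤ 1 / c ^ 2 ∧
      |φ.lam / (1 - φ.lam)| ≤ 1 / c := by
  obtain ⟨h0, h1⟩ := hR.lam φ hφ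
  have hc := hR.c_pos
  have hp : 0 < 1 - φ.lam := by linarith
  refine ⟨?_, ?_, ?_⟩
  · rw [abs_of_pos (by positivity)]
    exact one_div_le_one_div_of_le hc h1
  · rw [abs_of_pos (by positivity)]
    exact one_div_le_one_div_of_le (by positivity) (by gcongr)
  · rw [abs_of_pos (by positivity)]
    exact div_le_div₀ zero_le_one (by linarith) hc h1

lemma abs_cdf_sub_le (hφ : φ ∈ Metric.ball φstar ρ) (y : ℝ) :
    |cdf (P₁ φ.theta) y - cdf (P₁ φstar.theta) y| ≤ B₁ y * ‖φ - φstar‖ := by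
  have := (convex_ball φstar ρ).norm_image_sub_le_of_norm_hasFDerivWithin_le
    (f := fun φ : Par d s => (cdf (P₁ φ.theta) y : ℝ)) (C := B₁ y)
    (fun x hx => (hasFDerivAt_cdf_theta (hR.diff x hx y)).hasFDerivWithinAt)
    (fun x hx => ?_) hR.center_mem hφ
  · simpa using this
  · refine ContinuousLinearMap.opNorm_le_bound _ (hR.bound_nonneg y) fun v => ?_
    refine (norm_inner_le_norm (𝕜 := ℝ) (gradF1 P₁ y x.theta) v.theta).trans ?_
    exact mul_le_mul (hR.grad_le x hx y) (norm_theta_le v) (norm_nonneg _) (hR.bound_nonneg y)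

lemma measurable_gradF1 (hφ : φ ∈ Metric.ball φstar ρ) :
    Measurable fun y => gradF1 P₁ y φ.theta := by
  have h1 : Measurable fun y => WithLp.ofLp (gradF1 P₁ y φ.theta) := by
    refine measurable_pi_lambda _ fun j => ?_
    refine measurable_of_hasDerivAt (f := fun t y =>
      cdf (P₁ (φ.theta + t • EuclideanSpace.single j 1)) y)
      (Eventually.of_forall fun t => measurable_cdf _) fun y => ?_
    have hl : HasDerivAt (fun t : ℝ => φ.theta + t • EuclideanSpace.single j (1 : ℝ))
        (EuclideanSpace.single j 1) 0 := by
      simpa using ((hasDerivAt_id (0 : ℝ)).smul_const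
        (EuclideanSpace.single j (1 : ℝ))).const_add φ.theta
    have hf : HasFDerivAt (fun t => (cdf (P₁ t) y : ℝ)) (innerSL ℝ (gradF1 P₁ y φ.theta))
        (φ.theta + (0 : ℝ) • EuclideanSpace.single j (1 : ℝ)) := by
      simpa using hasFDerivAt_cdf (hR.diff φ hφ y)
    refine (hf.comp_hasDerivAt (0 : ℝ) hl).congr_deriv ?_
    simp [EuclideanSpace.inner_single_right]
  exact (WithLp.measurable_toLp 2 _).comp h1

lemma integrable_gradF1_sub (hφ : φ ∈ Metric.ball φstar ρ) :
    Integrable fun y => ‖gradF1 P₁ y φ.theta - gradF1 P₁ y φstar.theta‖ := by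
  refine Integrable.mono' (hR.int.const_mul 2) ((hR.measurable_gradF1 hφ).sub
    (hR.measurable_gradF1 hR.center_mem)).norm.aestronglyMeasurable (ae_of_all _ fun y => ?_)
  rw [norm_norm]
  linarith [norm_sub_le (gradF1 P₁ y φ.theta) (gradF1 P₁ y φstar.theta), hR.grad_le φ hφ y,
    hR.grad_le φstar hR.center_mem y]

lemma tendsto_integral_gradF1_sub :
    Tendsto (fun φ : Par d s => ∫ y, ‖gradF1 P₁ y φ.theta - gradF1 P₁ y φstar.theta‖)
      (𝓝 φstar) (𝓝 0) := by
  have hball : ∀ᶠ φ in 𝓝 φstar, φ ∈ Metric.ball φstar ρ := Metric.ball_mem_nhds _ hR.ρ_pos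
  rw [show (0 : ℝ) = ∫ _y : ℝ, (0 : ℝ) by simp]
  refine tendsto_integral_filter_of_dominated_convergence (fun y => 2 * B₁ y)
    (hball.mono fun φ hφ => (hR.integrable_gradF1_sub hφ).aestronglyMeasurable)
    (hball.mono fun φ hφ => ae_of_all _ fun y => ?_) (hR.int.const_mul 2)
    (ae_of_all _ fun y => ?_)
  · rw [norm_norm]
    linarith [norm_sub_le (gradF1 P₁ y φ.theta) (gradF1 P₁ y φstar.theta), hR.grad_le φ hφ y,
      hR.grad_le φstar hR.center_mem y]
  · have h1 : ContinuousAt (fun φ : Par d s => gradF1 P₁ y φ.theta) φstar :=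
      ContinuousAt.comp (f := fun φ : Par d s => φ.theta) (hR.grad_cont y)
        (thetaL d s).continuous.continuousAt
    have h2 := (h1.sub (continuousAt_const (y := gradF1 P₁ y φstar.theta))).norm
    simpa [ContinuousAt] using h2

lemma abs_F0_le (hF : ∀ y, F y ∈ Icc (0 : ℝ) 1) (hφ : φ ∈ Metric.ball φstar ρ) (y : ℝ) :
    |F0 P₁ F φ y| ≤ 2 / c := by
  obtain ⟨h1, -, h3⟩ := hR.coeff_le hφ
  have hc : 0 < 1 / c := by have := hR.c_pos; positivity
  have hF1 : |F y| ≤ 1 := abs_le.2 ⟨by linarith [(hF y).1], (hF y).2⟩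
  have hG1 : |cdf (P₁ φ.theta) y| ≤ 1 :=
    abs_le.2 ⟨by linarith [cdf_nonneg (P₁ φ.theta) y], cdf_le_one _ y⟩
  unfold F0
  refine (abs_sub _ _).trans ?_
  rw [abs_mul, abs_mul, show 2 / c = 1 / c * 1 + 1 / c * 1 by ring]
  exact add_le_add (mul_le_mul h1 hF1 (abs_nonneg _) hc.le)
    (mul_le_mul h3 hG1 (abs_nonneg _) hc.le)

lemma norm_derivF0_le {G : ℝ → ℝ} (hφ : φ ∈ Metric.ball φstar ρ) (y : ℝ) :
    ‖derivF0 P₁ F φ y‖ ≤ 1 / c ^ 2 * |F y - G y| +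
      (1 / c ^ 2 * (|G y - cdf (P₁ φstar.theta) y| + B₁ y) + 1 / c * B₁ y) := by
  obtain ⟨-, h2, h3⟩ := hR.coeff_le hφ
  have hc := hR.c_pos
  have hB := hR.bound_nonneg y
  have hρ : ‖φ - φstar‖ ≤ 1 := by
    rw [← dist_eq_norm]
    exact (Metric.mem_ball.1 hφ).le.trans hR.ρ_le
  have hF : |F y - cdf (P₁ φ.theta) y| ≤
      |F y - G y| + |G y - cdf (P₁ φstar.theta) y| + B₁ y := by
    have h4 := hR.abs_cdf_sub_le hφ y
    have h5 : B₁ y * ‖φ - φstar‖ ≤ B₁ y := mul_le_of_le_one_right hB hρ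
    have h6 := abs_add_three (F y - G y) (G y - cdf (P₁ φstar.theta) y)
      (-(cdf (P₁ φ.theta) y - cdf (P₁ φstar.theta) y))
    rw [abs_neg] at h6
    have h7 : F y - G y + (G y - cdf (P₁ φstar.theta) y) +
      -(cdf (P₁ φ.theta) y - cdf (P₁ φstar.theta) y) = F y - cdf (P₁ φ.theta) y := by ring
    rw [h7] at h6
    linarith
  refine ContinuousLinearMap.opNorm_le_bound _ (by positivity) fun v => ?_
  rw [derivF0_apply, Real.norm_eq_abs]
  refine (abs_sub _ _).trans ?_
  rw [abs_mul, abs_mul, abs_mul]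
  have h8 : |inner ℝ (gradF1 P₁ y φ.theta) v.theta| ≤ B₁ y * ‖v‖ :=
    (abs_real_inner_le_norm _ _).trans
      (mul_le_mul (hR.grad_le φ hφ y) (norm_theta_le v) (norm_nonneg _) hB)
  calc |1 / (1 - φ.lam) ^ 2| * |F y - cdf (P₁ φ.theta) y| * |v.lam| +
      |φ.lam / (1 - φ.lam)| * |inner ℝ (gradF1 P₁ y φ.theta) v.theta|
      ≤ 1 / c ^ 2 * (|F y - G y| + |G y - cdf (P₁ φstar.theta) y| + B₁ y) * ‖v‖ +
        1 / c * (B₁ y * ‖v‖) := by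
        gcongr
        exact abs_lam_le v
    _ = _ := by ring

/-- `L¹`-continuity of the derivative of `F₀(y|φ)` in `(F, φ)`. The modulus `η` collects the change
of the coefficients and of the gradient of the parametric part; the latter is continuous only
pointwise, so its contribution tends to `0` by dominated convergence. -/
lemma exists_derivF0_near {G : ℝ → ℝ} (hG : Integrable fun y => G y - cdf (P₁ φstar.theta) y)
    (v : Par d s) : ∃ (η : Par d s → ℝ) (L : ℝ), Tendsto η (𝓝 φstar) (𝓝 0) ∧
      ∀ F, (Integrable fun y => F y - G y) → ∀ φ ∈ Metric.ball φstar ρ,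
        ∫ y, |derivF0 P₁ F φ y v - derivF0 P₁ G φstar y v| ≤
          L * (∫ y, |F y - G y|) + η φ := by
  have hc := hR.c_pos
  have hne : 1 - φstar.lam ≠ 0 := by linarith [hR.lam_lt_one hR.center_mem]
  refine ⟨fun φ => ‖v‖ * (1 / c ^ 2 * ‖φ - φstar‖ * (∫ y, B₁ y) +
    |1 / (1 - φ.lam) ^ 2 - 1 / (1 - φstar.lam) ^ 2| * (∫ y, |G y - cdf (P₁ φstar.theta) y|) +
    1 / c * (∫ y, ‖gradF1 P₁ y φ.theta - gradF1 P₁ y φstar.theta‖) +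
    |φ.lam / (1 - φ.lam) - φstar.lam / (1 - φstar.lam)| * (∫ y, B₁ y)),
    ‖v‖ * (1 / c ^ 2), ?_, fun F hF φ hφ => ?_⟩
  · have hlam : ContinuousAt (fun φ : Par d s => φ.lam) φstar :=
      (lamL d s).continuous.continuousAt
    have h1 : Tendsto (fun φ => ‖φ - φstar‖) (𝓝 φstar) (𝓝 0) := by
      have : Continuous fun φ => ‖φ - φstar‖ := by fun_prop
      simpa using this.tendsto φstar
    have h2 : Tendsto (fun φ : Par d s => |1 / (1 - φ.lam) ^ 2 - 1 / (1 - φstar.lam) ^ 2|)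
        (𝓝 φstar) (𝓝 0) := by
      have : ContinuousAt (fun φ : Par d s => |1 / (1 - φ.lam) ^ 2 - 1 / (1 - φstar.lam) ^ 2|)
          φstar := by
        refine ((continuousAt_const.div ((continuousAt_const.sub hlam).pow 2)
          (pow_ne_zero 2 hne)).sub continuousAt_const).abs
      simpa [ContinuousAt] using this
    have h3 : Tendsto (fun φ : Par d s => |φ.lam / (1 - φ.lam) - φstar.lam / (1 - φstar.lam)|)
        (𝓝 φstar) (𝓝 0) := by
      have : ContinuousAt (fun φ : Par d s =>
          |φ.lam / (1 - φ.lam) - φstar.lam / (1 - φstar.lam)|) φstar :=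
        ((hlam.div (continuousAt_const.sub hlam) hne).sub continuousAt_const).abs
      simpa [ContinuousAt] using this
    have := (((((h1.const_mul (1 / c ^ 2)).mul_const (∫ y, B₁ y)).add
      (h2.mul_const (∫ y, |G y - cdf (P₁ φstar.theta) y|))).add
      (hR.tendsto_integral_gradF1_sub.const_mul (1 / c))).add
      (h3.mul_const (∫ y, B₁ y))).const_mul ‖v‖
    simpa using this
  · set a := |1 / (1 - φ.lam) ^ 2 - 1 / (1 - φstar.lam) ^ 2| with ha
    set b := |φ.lam / (1 - φ.lam) - φstar.lam / (1 - φstar.lam)| with hb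
    obtain ⟨-, hc2, hc3⟩ := hR.coeff_le hφ
    have hi1 : Integrable fun y => 1 / c ^ 2 * |F y - G y| := hF.abs.const_mul _
    have hi2 : Integrable fun y => 1 / c ^ 2 * ‖φ - φstar‖ * B₁ y := hR.int.const_mul _
    have hi3 : Integrable fun y => a * |G y - cdf (P₁ φstar.theta) y| := hG.abs.const_mul _
    have hi4 : Integrable fun y => 1 / c * ‖gradF1 P₁ y φ.theta - gradF1 P₁ y φstar.theta‖ :=
      (hR.integrable_gradF1_sub hφ).const_mul _
    have hi5 : Integrable fun y => b * B₁ y := hR.int.const_mul _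
    have hi12 : Integrable fun y => 1 / c ^ 2 * |F y - G y| +
      1 / c ^ 2 * ‖φ - φstar‖ * B₁ y := hi1.add hi2
    have hi123 : Integrable fun y => 1 / c ^ 2 * |F y - G y| +
      1 / c ^ 2 * ‖φ - φstar‖ * B₁ y + a * |G y - cdf (P₁ φstar.theta) y| := hi12.add hi3
    have hi1234 : Integrable fun y => 1 / c ^ 2 * |F y - G y| +
      1 / c ^ 2 * ‖φ - φstar‖ * B₁ y + a * |G y - cdf (P₁ φstar.theta) y| +
      1 / c * ‖gradF1 P₁ y φ.theta - gradF1 P₁ y φstar.theta‖ := hi123.add hi4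
    have hi : Integrable fun y => 1 / c ^ 2 * |F y - G y| +
      1 / c ^ 2 * ‖φ - φstar‖ * B₁ y + a * |G y - cdf (P₁ φstar.theta) y| +
      1 / c * ‖gradF1 P₁ y φ.theta - gradF1 P₁ y φstar.theta‖ + b * B₁ y := hi1234.add hi5
    refine (integral_mono_of_nonneg (ae_of_all _ fun y => abs_nonneg _) (hi.const_mul ‖v‖)
      (ae_of_all _ fun y => ?_)).trans_eq ?_
    · have hB := hR.bound_nonneg y
      have e1 := hR.abs_cdf_sub_le hφ y
      have e2 : |inner ℝ (gradF1 P₁ y φ.theta - gradF1 P₁ y φstar.theta) v.theta| ≤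
          ‖gradF1 P₁ y φ.theta - gradF1 P₁ y φstar.theta‖ * ‖v‖ :=
        (abs_real_inner_le_norm _ _).trans
          (mul_le_mul_of_nonneg_left (norm_theta_le v) (norm_nonneg _))
      have e3 : |inner ℝ (gradF1 P₁ y φstar.theta) v.theta| ≤ B₁ y * ‖v‖ :=
        (abs_real_inner_le_norm _ _).trans
          (mul_le_mul (hR.grad_le φstar hR.center_mem y) (norm_theta_le v) (norm_nonneg _) hB)
      have e4 := abs_lam_le v
      have hsplit : derivF0 P₁ F φ y v - derivF0 P₁ G φstar y v =
          1 / (1 - φ.lam) ^ 2 * (F y - G y) * v.lam +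
          -(1 / (1 - φ.lam) ^ 2 * (cdf (P₁ φ.theta) y - cdf (P₁ φstar.theta) y) * v.lam) +
          (1 / (1 - φ.lam) ^ 2 - 1 / (1 - φstar.lam) ^ 2) *
            (G y - cdf (P₁ φstar.theta) y) * v.lam +
          -(φ.lam / (1 - φ.lam) *
            inner ℝ (gradF1 P₁ y φ.theta - gradF1 P₁ y φstar.theta) v.theta) +
          -((φ.lam / (1 - φ.lam) - φstar.lam / (1 - φstar.lam)) *
            inner ℝ (gradF1 P₁ y φstar.theta) v.theta) := by
        rw [derivF0_apply, derivF0_apply, inner_sub_left]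
        ring
      simp only
      rw [hsplit]
      refine ((abs_add_le _ _).trans (add_le_add_left ((abs_add_le _ _).trans
        (add_le_add_left (abs_add_three _ _ _) _)) _)).trans ?_
      simp only [abs_neg, abs_mul]
      rw [← ha, ← hb]
      calc _ ≤ 1 / c ^ 2 * |F y - G y| * ‖v‖ + 1 / c ^ 2 * (B₁ y * ‖φ - φstar‖) * ‖v‖ +
            a * |G y - cdf (P₁ φstar.theta) y| * ‖v‖ +
            1 / c * (‖gradF1 P₁ y φ.theta - gradF1 P₁ y φstar.theta‖ * ‖v‖) +
            b * (B₁ y * ‖v‖) := by gcongr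
        _ = _ := by ring
    · rw [integral_const_mul, integral_add hi1234 hi5, integral_add hi123 hi4,
        integral_add hi12 hi3, integral_add hi1 hi2]
      simp only [integral_const_mul]
      ring

end LocallyRegular

/-- The mixture model is a plug-in problem whose true nuisance function is the distribution function
of the observations. -/
lemma exists_pluginProblem {ℓ : ℕ} {f : ℝ → ℝ≥0∞} (hf : IsDivergenceGenerator f)
    (hψ_fin : ∀ᶠ t in 𝓝 (0 : ℝ), conjugate f t ≠ ⊤)
    (hψ_C2 : ContDiffAt ℝ 2 (fun t => (conjugate f t).toReal) 0)
    (hψ_norm : iteratedDeriv 2 (fun t => (conjugate f t).toReal) 0 = 1)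
    {Θ : Set (EuclideanSpace ℝ (Fin d))} {𝒜 : Set (EuclideanSpace ℝ (Fin s))}
    {Φ : Set (Par d s)} (hΦ : ∀ φ ∈ Φ, φ.lam ∈ Ioo (0 : ℝ) 1 ∧ φ.theta ∈ Θ ∧ φ.alpha ∈ 𝒜)
    (hP₁ : ∀ θ ∈ Θ, IsProbabilityMeasure (P₁ θ))
    {m : EuclideanSpace ℝ (Fin s) → EuclideanSpace ℝ (Fin (ℓ - 1))}
    (hφstar : φstar ∈ interior Φ) {PT P₀ : Measure ℝ} [IsProbabilityMeasure PT]
    [IsProbabilityMeasure P₀]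
    (hmix : PT = ENNReal.ofReal φstar.lam • P₁ φstar.theta + ENNReal.ofReal (1 - φstar.lam) • P₀)
    (hconstr : quantileMeasure P₀ ∈ constraintClass (quantileMeasure P₀) (m φstar.alpha))
    (hm : ContDiffOn ℝ 2 m 𝒜)
    (hF₁_diff : ∀ᶠ θ in 𝓝 φstar.theta, ∀ y,
      DifferentiableAt ℝ (fun t => (cdf (P₁ t) y : ℝ)) θ ∧ DifferentiableAt ℝ (gradF1 P₁ y) θ)
    (hB₁ : ∃ B₁ : ℝ → ℝ, Integrable B₁ ∧
      ∀ᶠ θ in 𝓝 φstar.theta, ∀ y, ‖gradF1 P₁ y θ‖ ≤ B₁ y)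
    (hdiff_int : Integrable (fun y : ℝ => cdf PT y - cdf (P₁ φstar.theta) y)) :
    ∃ S : PluginProblem (ParIdx d s) (ℓ - 1), S.T = F0 P₁ ∧ S.F₀ = cdf PT ∧ S.φ₀ = φstar ∧
      (S.k = fun i : Fin (ℓ - 1) => K (i + 2)) ∧ S.crit = criterion f P₁ m ∧
      (∀ i, S.M φstar i = ∫ y, K (i + 2) (F0 P₁ (cdf PT) φstar y)) ∧
      S.J = Jphixi P₁ m (cdf PT) φstar ∧ S.A = Jxixi ℓ P₁ (cdf PT) φstar := by
  obtain ⟨r, κ, hψ⟩ := exists_isLocalConjugate hf.one hψ_fin hψ_C2 hψ_norm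
  obtain ⟨B₁, hB₁_int, hB₁⟩ := hB₁
  have hΦn : Φ ∈ 𝓝 φstar := mem_interior_iff_mem_nhds.1 hφstar
  have hmem := hΦ φstar (mem_of_mem_nhds hΦn)
  have hlam : Tendsto (fun φ : Par d s => φ.lam) (𝓝 φstar) (𝓝 φstar.lam) :=
    (lamL d s).continuous.tendsto φstar
  have hth : Tendsto (fun φ : Par d s => φ.theta) (𝓝 φstar) (𝓝 φstar.theta) :=
    (thetaL d s).continuous.tendsto φstar
  have hal : Tendsto (fun φ : Par d s => φ.alpha) (𝓝 φstar) (𝓝 φstar.alpha) :=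
    (alphaL d s).continuous.tendsto φstar
  have h𝒜 : 𝒜 ∈ 𝓝 φstar.alpha := by
    refine mem_of_superset (((alphaL d s).isOpenMap alphaL_surjective).image_mem_nhds hΦn) ?_
    rintro - ⟨φ, hφ, rfl⟩
    exact (hΦ φ hφ).2.2
  have hmC : ∀ᶠ a in 𝓝 φstar.alpha, DifferentiableAt ℝ m a := by
    filter_upwards [(hm.contDiffAt h𝒜).eventually (by simp)] with a ha
    exact ha.differentiableAt (by simp)
  -- near `λ*` the denominators `1 - λ` stay above half the value `1 - λ*`
  set c := (1 - φstar.lam) / 2 with hc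
  have hc0 : 0 < c := by linarith [hmem.1.2]
  obtain ⟨ρ', hρ', hball⟩ := Metric.eventually_nhds_iff_ball.1
    (((hlam.eventually (lt_mem_nhds hmem.1.1)).and
      (hlam.eventually (gt_mem_nhds (show φstar.lam < 1 - c by linarith)))).and
      ((hth.eventually (hF₁_diff.and hB₁)).and (hal.eventually hmC)))
  set ρ := min ρ' 1 with hρ
  have hρ0 : 0 < ρ := lt_min hρ' one_pos
  have hsub : Metric.ball φstar ρ ⊆ Metric.ball φstar ρ' :=
    Metric.ball_subset_ball (min_le_left _ _)
  have hR : LocallyRegular P₁ φstar B₁ ρ c :=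
    { ρ_pos := hρ0
      ρ_le := min_le_right _ _
      c_pos := hc0
      c_le := by linarith [hmem.1.1]
      int := hB₁_int
      lam := fun φ hφ => ⟨(hball φ (hsub hφ)).1.1, by linarith [(hball φ (hsub hφ)).1.2]⟩
      diff := fun φ hφ y => ((hball φ (hsub hφ)).2.1.1 y).1
      grad_le := fun φ hφ y => (hball φ (hsub hφ)).2.1.2 y
      grad_cont := fun y => (hF₁_diff.self_of_nhds y).2.continuousAt }
  have hfd : ∀ F, ∀ φ ∈ Metric.ball φstar ρ, ∀ y,
      HasFDerivAt (fun φ => F0 P₁ F φ y) (derivF0 P₁ F φ y) φ := fun F φ hφ y =>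
    hasFDerivAt_F0 (hR.lam_lt_one hφ) (hR.diff φ hφ y)
  have := hP₁ φstar.theta hmem.2.1
  have hF₀ : ∀ y, F0 P₁ (cdf PT) φstar y = cdf P₀ y := by
    intro y
    have hne : 1 - φstar.lam ≠ 0 := by linarith [hmem.1.2]
    rw [F0, cdf_mixture hmem.1 hmix]
    field_simp
    ring
  have hMd : ∀ φ ∈ Metric.ball φstar ρ,
      HasFDerivAt (fun φ : Par d s => m φ.alpha) ((fderiv ℝ m φ.alpha).comp (alphaL d s)) φ :=
    fun φ hφ => by
      have := ((hball φ (hsub hφ)).2.2).hasFDerivAt.comp φ ((alphaL d s).hasFDerivAt (x := φ))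
      exact this
  have hMC : ContDiffAt ℝ 2 (fun φ : Par d s => m φ.alpha) φstar := by
    have : ContDiffAt ℝ 2 (m ∘ alphaL d s) φstar :=
      (hm.contDiffAt h𝒜).comp φstar (alphaL d s).contDiff.contDiffAt
    exact this
  have hk_int : ∀ i : Fin (ℓ - 1),
      Integrable (fun y => K (i + 2) (F0 P₁ (cdf PT) φstar y)) ∧
        m φstar.alpha i = ∫ y, K (i + 2) (F0 P₁ (cdf PT) φstar y) := by
    intro i
    obtain ⟨h1, h2⟩ := hconstr.2.2 i
    obtain ⟨h3, h4⟩ := quantileMeasure_integral P₀ (contDiff_K (i + 2)).continuous.measurable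
      (K_zero _) (K_one _)
    simp only [hF₀]
    exact ⟨h3.1 h1, by rw [← h2, h4]⟩
  obtain ⟨B, hB0, hKB, hLB, hLL⟩ := exists_bound_K (fun i : Fin (ℓ - 1) => (i : ℕ) + 2) (2 / c)
  have hcle : 1 / c ≤ 1 / c ^ 2 :=
    one_div_le_one_div_of_le (by positivity) (pow_le_of_le_one hc0.le hR.c_le (by simp))
  have hF₀mem : ∀ y, cdf PT y ∈ Icc (0 : ℝ) 1 := fun y => ⟨cdf_nonneg PT y, cdf_le_one PT y⟩
  have hDstar : ∀ y, fderiv ℝ (fun φ => F0 P₁ (cdf PT) φ y) φstar = derivF0 P₁ (cdf PT) φstar y :=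
    fun y => (hfd _ _ hR.center_mem y).fderiv
  let S : PluginProblem (ParIdx d s) (ℓ - 1) :=
    { T := F0 P₁
      F₀ := cdf PT
      φ₀ := φstar
      M := fun φ : Par d s => m φ.alpha
      k := fun i => K (i + 2)
      ψ := conjugate f
      ρ := ρ
      R := 2 / c
      C := 1 / c ^ 2
      B := B
      r := r
      κ := κ
      g := fun y => 1 / c ^ 2 * (|cdf PT y - cdf (P₁ φstar.theta) y| + B₁ y) + 1 / c * B₁ y
      hψ := hψ
      ρ_pos := hρ0
      B_nonneg := hB0
      F₀_meas := measurable_cdf PT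
      F₀_mem := hF₀mem
      g_int := ((hdiff_int.abs.add hB₁_int).const_mul _).add (hB₁_int.const_mul _)
      T_meas := fun F hF φ _ => measurable_F0 hF.meas
      T_bound := fun F hF φ hφ y => hR.abs_F0_le hF.mem hφ y
      T_diff := fun F _ φ hφ y => (hfd F φ hφ y).differentiableAt
      T_deriv_le := fun F _ φ hφ y => by
        rw [(hfd F φ hφ y).fderiv]
        exact hR.norm_derivF0_le hφ y
      T_base := fun F _ y => by
        have h1 : F0 P₁ F φstar y - F0 P₁ (cdf PT) φstar y =
            1 / (1 - φstar.lam) * (F y - cdf PT y) := by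
          unfold F0
          ring
        rw [h1, abs_mul]
        exact mul_le_mul_of_nonneg_right ((hR.coeff_le hR.center_mem).1.trans hcle) (abs_nonneg _)
      T_cont := fun v => by
        obtain ⟨η, L, hη, h⟩ := hR.exists_derivF0_near hdiff_int v
        refine ⟨η, L, hη, fun F hF φ hφ => ?_⟩
        simp only [hDstar, (hfd F φ hφ _).fderiv]
        exact h F hF.int φ hφ
      k_diff := fun i => contDiff_K _
      k_bound := hKB
      dk_bound := fun i => by
        rw [deriv_K]
        exact hLB i
      dk_lip := fun i => by
        rw [deriv_K]
        exact hLL i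
      k_int := fun i => (hk_int i).1
      M_diff := fun φ hφ => (hMd φ hφ).differentiableAt
      M_cont := (hMC.fderiv_right (m := 1) (by norm_num)).continuousAt }
  refine ⟨S, rfl, rfl, rfl, rfl, rfl, fun i => (hk_int i).2, ?_, rfl⟩
  ext i j
  have hJ : S.J i j = fderiv ℝ (fun φ : Par d s => m φ.alpha) φstar
      (EuclideanSpace.single j 1) i - ∫ y, deriv (K (i + 2)) (F0 P₁ (cdf PT) φstar y) *
        fderiv ℝ (fun φ => F0 P₁ (cdf PT) φ y) φstar (EuclideanSpace.single j 1) := rfl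
  rw [hJ, (hMd φstar hR.center_mem).fderiv]
  simp only [hDstar, derivF0_apply, ContinuousLinearMap.comp_apply, alphaL_apply]
  have ha : ∀ v : Par d s, v.alpha = WithLp.toLp 2 fun k => v (Sum.inr (Sum.inr k)) := fun _ => rfl
  have ht : ∀ v : Par d s, v.theta = WithLp.toLp 2 fun k => v (Sum.inr (Sum.inl k)) := fun _ => rfl
  have hl : ∀ v : Par d s, v.lam = v (Sum.inl ()) := fun _ => rfl
  set e : Par d s := EuclideanSpace.single j 1 with he
  rcases j with ⟨⟩ | j | k
  · have h1 : e.alpha = 0 := by ext; simp [ha, he]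
    have h2 : e.theta = 0 := by ext; simp [ht, he]
    have h3 : e.lam = 1 := by simp [hl, he]
    simp [Jphixi, h1, h2, h3, mul_comm, mul_sub]
  · have h1 : e.alpha = 0 := by ext; simp [ha, he]
    have h2 : e.theta = EuclideanSpace.single j 1 := by
      ext i
      simp [ht, he]
    have h3 : e.lam = 0 := by simp [hl, he]
    simp only [Jphixi, h1, h2, h3, Matrix.of_apply, Sum.elim_inl, Sum.elim_inr, map_zero,
      mul_zero, zero_sub, EuclideanSpace.inner_single_right]
    rw [← integral_const_mul, PiLp.zero_apply, zero_sub, ← integral_neg]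
    refine integral_congr_ae (ae_of_all _ fun y => ?_)
    simp
    ring
  · have h1 : e.alpha = EuclideanSpace.single k 1 := by
      ext i
      simp [ha, he]
    have h2 : e.theta = 0 := by ext; simp [ht, he]
    have h3 : e.lam = 0 := by simp [hl, he]
    simp [Jphixi, h1, h2, h3]

end

section

/-! ### Centred indicators and influence functions -/

/-- The centred indicator `1{x ≤ y} - F(y)`, where `F` is the distribution function of `P`. -/
def centredInd (P : Measure ℝ) (x y : ℝ) : ℝ := (Iic y).indicator (fun _ => (1 : ℝ)) x - cdf P y

/-- The influence function `x ↦ ∫ w(y) (1{x ≤ y} - F(y)) dy` of the linear functional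
`G ↦ ∫ w G` at the distribution function `F` of `P`. -/
def influence (P : Measure ℝ) (w : ℝ → ℝ) (x : ℝ) : ℝ := ∫ y, w y * centredInd P x y

/-- The Cauchy–Schwarz inequality for square integrable functions. -/
lemma integral_abs_mul_le_sqrt {α : Type*} [MeasurableSpace α] {μ : Measure α} {f g : α → ℝ}
    (hf : MemLp f 2 μ) (hg : MemLp g 2 μ) :
    ∫ a, |f a * g a| ∂μ ≤ √(∫ a, f a ^ 2 ∂μ) * √(∫ a, g a ^ 2 ∂μ) := by
  have h2 : (2 : ℝ≥0∞) = ENNReal.ofReal 2 := by simp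
  have := integral_mul_norm_le_Lp_mul_Lq (p := 2) (q := 2) Real.HolderConjugate.two_two
    (h2 ▸ hf) (h2 ▸ hg)
  simpa [abs_mul, Real.sqrt_eq_rpow] using this

section

variable {P : Measure ℝ}

lemma measurable_centredInd : Measurable (Function.uncurry (centredInd P)) := by
  have h1 : (fun p : ℝ × ℝ => (Iic p.2).indicator (fun _ => (1 : ℝ)) p.1) =
      {p : ℝ × ℝ | p.1 ≤ p.2}.indicator fun _ => 1 := by
    ext p
    simp [indicator_apply]
  have h2 : Measurable fun p : ℝ × ℝ => (Iic p.2).indicator (fun _ => (1 : ℝ)) p.1 := by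
    rw [h1]
    exact measurable_const.indicator (measurableSet_le measurable_fst measurable_snd)
  exact h2.sub ((measurable_cdf P).comp measurable_snd)

lemma measurable_centredInd_left (y : ℝ) : Measurable fun x => centredInd P x y :=
  measurable_centredInd.comp (measurable_id.prodMk measurable_const)

lemma abs_centredInd_le (x y : ℝ) : |centredInd P x y| ≤ 1 := by
  have h0 := cdf_nonneg P y
  have h1 := cdf_le_one P y
  rw [abs_le, centredInd, indicator_apply]
  split_ifs <;> constructor <;> linarith

variable [IsProbabilityMeasure P]

lemma memLp_centredInd (y : ℝ) : MemLp (fun x => centredInd P x y) 2 P :=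
  MemLp.of_bound (measurable_centredInd_left y).aestronglyMeasurable 1
    (ae_of_all _ fun x => abs_centredInd_le x y)

lemma integrable_centredInd_left (y : ℝ) : Integrable (fun x => centredInd P x y) P :=
  (memLp_centredInd y).integrable (by simp)

lemma integrable_centredInd_mul (y z : ℝ) :
    Integrable (fun x => centredInd P x y * centredInd P x z) P :=
  (memLp_centredInd y).integrable_mul (memLp_centredInd z)

lemma integral_centredInd (y : ℝ) : ∫ x, centredInd P x y ∂P = 0 := by
  unfold centredInd
  rw [integral_sub ((integrable_const 1).indicator measurableSet_Iic) (integrable_const _),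
    integral_indicator measurableSet_Iic]
  simp [cdf_eq_real]

lemma integral_centredInd_mul (y z : ℝ) :
    ∫ x, centredInd P x y * centredInd P x z ∂P = cdf P (min y z) - cdf P y * cdf P z := by
  have h1 : ∀ x, centredInd P x y * centredInd P x z =
      centredInd P x (min y z) + cdf P (min y z) - cdf P z * centredInd P x y -
        cdf P y * centredInd P x z - cdf P y * cdf P z := by
    intro x
    have : (Iic (min y z)).indicator (fun _ => (1 : ℝ)) x =
        (Iic y).indicator (fun _ => (1 : ℝ)) x * (Iic z).indicator (fun _ => (1 : ℝ)) x := by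
      by_cases hy : x ≤ y <;> by_cases hz : x ≤ z <;> simp [hy, hz]
    simp only [centredInd, this]
    ring
  simp only [h1]
  have i1 : ∀ t, Integrable (fun x => centredInd P x t) P := integrable_centredInd_left
  rw [integral_sub, integral_sub, integral_sub, integral_add, integral_const_mul,
    integral_const_mul, integral_centredInd, integral_centredInd, integral_centredInd]
  · simp
  · exact i1 _
  · exact integrable_const _
  · exact (i1 _).add (integrable_const _)
  · exact (i1 _).const_mul _
  · exact ((i1 _).add (integrable_const _)).sub ((i1 _).const_mul _)
  · exact (i1 _).const_mul _
  · exact (((i1 _).add (integrable_const _)).sub ((i1 _).const_mul _)).sub ((i1 _).const_mul _)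
  · exact integrable_const _

lemma integral_centredInd_sq (y : ℝ) :
    ∫ x, centredInd P x y ^ 2 ∂P = cdf P y * (1 - cdf P y) := by
  simp only [pow_two, integral_centredInd_mul, min_self]
  ring

lemma integral_abs_centredInd_le (y : ℝ) :
    ∫ x, |centredInd P x y| ∂P ≤ √(cdf P y * (1 - cdf P y)) := by
  have := integral_abs_mul_le_sqrt (μ := P) (memLp_centredInd y) (memLp_const (1 : ℝ))
  simpa [integral_centredInd_sq] using this

lemma integral_abs_centredInd_mul_le (y z : ℝ) :
    ∫ x, |centredInd P x y * centredInd P x z| ∂P ≤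
      √(cdf P y * (1 - cdf P y)) * √(cdf P z * (1 - cdf P z)) := by
  have := integral_abs_mul_le_sqrt (μ := P) (memLp_centredInd y) (memLp_centredInd z)
  simpa only [integral_centredInd_sq] using this

variable {w w' : ℝ → ℝ} {b b' : ℝ} (hP : Integrable fun y => √(cdf P y * (1 - cdf P y)))
  (hw : Measurable w) (hwb : ∀ y, |w y| ≤ b) (hw' : Measurable w') (hwb' : ∀ y, |w' y| ≤ b')

include hP hw hwb

lemma integrable_mul_centredInd :
    Integrable (Function.uncurry fun x y => w y * centredInd P x y) (P.prod volume) := by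
  have hm : Measurable (Function.uncurry fun x y => w y * centredInd P x y) :=
    (hw.comp measurable_snd).mul measurable_centredInd
  refine (integrable_prod_iff' hm.aestronglyMeasurable).2
    ⟨ae_of_all _ fun y => (integrable_centredInd_left (P := P) y).const_mul (w y), ?_⟩
  refine Integrable.mono' (hP.const_mul b)
    hm.stronglyMeasurable.norm.integral_prod_left'.aestronglyMeasurable (ae_of_all _ fun y => ?_)
  rw [Real.norm_of_nonneg (integral_nonneg fun _ => norm_nonneg _)]
  simp only [Function.uncurry, Real.norm_eq_abs, abs_mul]
  rw [integral_const_mul]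
  exact mul_le_mul (hwb y) (integral_abs_centredInd_le y)
    (integral_nonneg fun _ => abs_nonneg _) ((abs_nonneg _).trans (hwb y))

lemma integral_influence : ∫ x, influence P w x ∂P = 0 := by
  unfold influence
  rw [integral_integral_swap (integrable_mul_centredInd hP hw hwb)]
  simp [integral_const_mul, integral_centredInd]

include hw' hwb'

lemma integrable_mul_mul_centredInd : Integrable (fun p : ℝ × ℝ × ℝ =>
    w p.2.1 * centredInd P p.1 p.2.1 * (w' p.2.2 * centredInd P p.1 p.2.2))
    (P.prod (volume.prod volume)) := by
  have hm : Measurable (fun p : ℝ × ℝ × ℝ =>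
      w p.2.1 * centredInd P p.1 p.2.1 * (w' p.2.2 * centredInd P p.1 p.2.2)) := by
    have m1 : Measurable fun p : ℝ × ℝ × ℝ => centredInd P p.1 p.2.1 :=
      measurable_centredInd.comp (measurable_fst.prodMk measurable_snd.fst)
    have m2 : Measurable fun p : ℝ × ℝ × ℝ => centredInd P p.1 p.2.2 :=
      measurable_centredInd.comp (measurable_fst.prodMk measurable_snd.snd)
    exact ((hw.comp measurable_snd.fst).mul m1).mul ((hw'.comp measurable_snd.snd).mul m2)
  refine (integrable_prod_iff' hm.aestronglyMeasurable).2 ⟨ae_of_all _ fun p => ?_, ?_⟩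
  · refine ((integrable_centredInd_mul p.1 p.2).const_mul (w p.1 * w' p.2)).congr
      (ae_of_all _ fun x => ?_)
    simp only
    ring
  · refine Integrable.mono' ((hP.mul_prod hP).const_mul (b * b'))
      hm.stronglyMeasurable.norm.integral_prod_left'.aestronglyMeasurable
      (ae_of_all _ fun p => ?_)
    rw [Real.norm_of_nonneg (integral_nonneg fun _ => norm_nonneg _)]
    have h1 : ∀ x, ‖w p.1 * centredInd P x p.1 * (w' p.2 * centredInd P x p.2)‖ =
        |w p.1| * |w' p.2| * |centredInd P x p.1 * centredInd P x p.2| := by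
      intro x
      rw [Real.norm_eq_abs, ← abs_mul, ← abs_mul]
      ring_nf
    simp only [h1]
    rw [integral_const_mul]
    exact mul_le_mul (mul_le_mul (hwb _) (hwb' _) (abs_nonneg _) ((abs_nonneg _).trans (hwb 0)))
      (integral_abs_centredInd_mul_le _ _) (integral_nonneg fun _ => abs_nonneg _)
      (mul_nonneg ((abs_nonneg _).trans (hwb 0)) ((abs_nonneg _).trans (hwb' 0)))

lemma integrable_influence_mul :
    Integrable (fun x => influence P w x * influence P w' x) P := by
  refine (integrable_mul_mul_centredInd hP hw hwb hw' hwb').integral_prod_left.congr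
    (ae_of_all _ fun x => ?_)
  exact integral_prod_mul (fun y => w y * centredInd P x y) fun y => w' y * centredInd P x y

/-- The covariance of two influence functions is obtained by integrating the covariance function
`F(min(x, y)) - F(x) F(y)` of the empirical process. -/
lemma integral_influence_mul :
    ∫ x, influence P w x * influence P w' x ∂P =
      ∫ x, ∫ y, (cdf P (min x y) - cdf P x * cdf P y) * w x * w' y := by
  have hi := integrable_mul_mul_centredInd hP hw hwb hw' hwb'
  have h1 : ∀ x, influence P w x * influence P w' x =
      ∫ p : ℝ × ℝ, w p.1 * centredInd P x p.1 * (w' p.2 * centredInd P x p.2)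
        ∂(volume.prod volume) := fun x =>
    (integral_prod_mul (fun y => w y * centredInd P x y) fun y => w' y * centredInd P x y).symm
  have h2 : ∀ p : ℝ × ℝ, ∫ x, w p.1 * centredInd P x p.1 * (w' p.2 * centredInd P x p.2) ∂P =
      (cdf P (min p.1 p.2) - cdf P p.1 * cdf P p.2) * w p.1 * w' p.2 := by
    intro p
    rw [← integral_centredInd_mul, mul_assoc, ← integral_mul_const]
    refine integral_congr_ae (ae_of_all _ fun x => ?_)
    simp only
    ring
  simp only [h1]
  rw [integral_integral_swap (f := fun x (p : ℝ × ℝ) =>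
    w p.1 * centredInd P x p.1 * (w' p.2 * centredInd P x p.2)) hi]
  simp only [h2]
  have h3 := hi.integral_prod_right
  simp only [h2] at h3
  exact integral_prod _ h3

end

lemma measurable_influence {P : Measure ℝ} {w : ℝ → ℝ} (hw : Measurable w) :
    Measurable (influence P w) := by
  have hm : Measurable (Function.uncurry fun x y => w y * centredInd P x y) :=
    (hw.comp measurable_snd).mul measurable_centredInd
  exact hm.stronglyMeasurable.integral_prod_right'.measurable

/-! ### The empirical distribution function -/

section

variable {Ω : Type*} {X : ℕ → Ω → ℝ} {P : Measure ℝ} {n : ℕ}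

lemma empCdf_sub (hn : n ≠ 0) (ω : Ω) (y : ℝ) :
    empCdf X n ω y - cdf P y = (n : ℝ)⁻¹ * ∑ i ∈ Finset.range n, centredInd P (X i ω) y := by
  have : (n : ℝ) ≠ 0 := Nat.cast_ne_zero.2 hn
  simp only [centredInd, Finset.sum_sub_distrib, empCdf, Finset.sum_const, Finset.card_range,
    nsmul_eq_mul]
  field_simp

lemma integrable_centredInd_right (hP : Integrable fun y => √(cdf P y * (1 - cdf P y))) (x : ℝ) :
    Integrable (centredInd P x) :=
  integrable_step_sub_cdf (integrable_cdf_mul_of_sqrt hP) x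

lemma admissible_empCdf (hP : Integrable fun y => √(cdf P y * (1 - cdf P y))) (hn : n ≠ 0)
    (ω : Ω) : Admissible (cdf P) (empCdf X n ω) := by
  have hint : Integrable (fun y => empCdf X n ω y - cdf P y) := by
    simp only [empCdf_sub hn]
    exact (integrable_finsetSum _ fun i _ => integrable_centredInd_right hP _).const_mul _
  have hind : ∀ i y, (Iic y).indicator (fun _ => (1 : ℝ)) (X i ω) ∈ Icc (0 : ℝ) 1 := fun i y => by
    rw [indicator_apply]
    split_ifs <;> simp
  refine ⟨?_, fun y => ⟨?_, ?_⟩, hint⟩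
  · refine Measurable.const_mul (Finset.measurable_fun_sum _ fun i _ => ?_) _
    have : (fun y => (Iic y).indicator (fun _ => (1 : ℝ)) (X i ω)) =
        (Ici (X i ω)).indicator fun _ => 1 := by
      ext y
      simp [indicator_apply]
    rw [this]
    exact measurable_const.indicator measurableSet_Ici
  · exact mul_nonneg (by positivity) (Finset.sum_nonneg fun i _ => (hind i y).1)
  · have h1 : ∑ i ∈ Finset.range n, (Iic y).indicator (fun _ => (1 : ℝ)) (X i ω) ≤ n := by
      simpa using Finset.sum_le_card_nsmul (Finset.range n) _ (1 : ℝ) fun i _ => (hind i y).2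
    have h2 : (0 : ℝ) < n := Nat.cast_pos.2 (Nat.pos_of_ne_zero hn)
    rw [empCdf, inv_mul_le_iff₀ h2, mul_one]
    exact h1

lemma integral_mul_empCdf_sub (hP : Integrable fun y => √(cdf P y * (1 - cdf P y))) (hn : n ≠ 0)
    {w : ℝ → ℝ} {b : ℝ} (hw : Measurable w) (hwb : ∀ y, |w y| ≤ b) (ω : Ω) :
    ∫ y, w y * (empCdf X n ω y - cdf P y) =
      (n : ℝ)⁻¹ * ∑ i ∈ Finset.range n, influence P w (X i ω) := by
  unfold influence
  rw [← integral_finsetSum, ← integral_const_mul]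
  · refine integral_congr_ae (ae_of_all _ fun y => ?_)
    simp only
    rw [empCdf_sub hn, Finset.mul_sum, Finset.mul_sum, Finset.mul_sum]
    refine Finset.sum_congr rfl fun i _ => ?_
    ring
  · intro i _
    exact (integrable_centredInd_right hP _).bdd_mul hw.aestronglyMeasurable
      (ae_of_all _ fun y => hwb y)

variable [MeasurableSpace Ω] {μ : Measure Ω} (hXm : ∀ i, Measurable (X i))

include hXm

lemma measurable_empCdf_sub :
    Measurable (Function.uncurry fun ω y => empCdf X n ω y - cdf P y) := by
  rcases eq_or_ne n 0 with rfl | hn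
  · simp only [empCdf, Finset.range_zero, Finset.sum_empty, mul_zero, zero_sub]
    exact ((measurable_cdf P).comp measurable_snd).neg
  · simp only [empCdf_sub hn]
    refine Measurable.const_mul (Finset.measurable_fun_sum _ fun i _ => ?_) _
    exact measurable_centredInd.comp (((hXm i).comp measurable_fst).prodMk measurable_snd)

lemma memLp_empCdf_sub [IsProbabilityMeasure μ] (hn : n ≠ 0) (y : ℝ) :
    MemLp (fun ω => empCdf X n ω y - cdf P y) 2 μ := by
  simp only [empCdf_sub hn]
  have h1 : ∀ i, MemLp (fun ω => centredInd P (X i ω) y) 2 μ := fun i =>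
    MemLp.of_bound ((measurable_centredInd_left y).comp (hXm i)).aestronglyMeasurable 1
      (ae_of_all _ fun ω => abs_centredInd_le _ _)
  exact (memLp_finsetSum (Finset.range n) fun i _ => h1 i).const_mul _

variable [IsProbabilityMeasure μ] [IsProbabilityMeasure P]
  (hXi : iIndepFun X μ) (hXl : ∀ i, HasLaw (X i) P μ)

include hXi hXl

lemma integral_empCdf_sub_sq (hn : n ≠ 0) (y : ℝ) :
    ∫ ω, (empCdf X n ω y - cdf P y) ^ 2 ∂μ = cdf P y * (1 - cdf P y) / n := by
  have hn' : (n : ℝ) ≠ 0 := Nat.cast_ne_zero.2 hn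
  set Z : ℕ → Ω → ℝ := fun i ω => centredInd P (X i ω) y with hZ
  have hZm : ∀ i, Measurable (Z i) := fun i => (measurable_centredInd_left y).comp (hXm i)
  have hZ2 : ∀ i, MemLp (Z i) 2 μ := fun i =>
    MemLp.of_bound (hZm i).aestronglyMeasurable 1 (ae_of_all _ fun ω => abs_centredInd_le _ _)
  have hZ0 : ∀ i, ∫ ω, Z i ω ∂μ = 0 := fun i => by
    have := (hXl i).integral_comp (f := fun x => centredInd P x y)
      (measurable_centredInd_left y).aestronglyMeasurable
    rw [integral_centredInd] at this
    exact this
  have hZv : ∀ i, Var[Z i; μ] = cdf P y * (1 - cdf P y) := fun i => by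
    rw [variance_of_integral_eq_zero (hZm i).aemeasurable (hZ0 i), ← integral_centredInd_sq]
    exact (hXl i).integral_comp (f := fun x => centredInd P x y ^ 2)
      ((measurable_centredInd_left y).pow_const 2).aestronglyMeasurable
  have hsum0 : ∫ ω, (∑ i ∈ Finset.range n, Z i) ω ∂μ = 0 := by
    simp only [Finset.sum_apply]
    rw [integral_finsetSum _ fun i _ => (hZ2 i).integrable (by simp)]
    simp [hZ0]
  have hvar : Var[∑ i ∈ Finset.range n, Z i; μ] = n * (cdf P y * (1 - cdf P y)) := by
    rw [IndepFun.variance_sum (fun i _ => hZ2 i)]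
    · simp [hZv]
    · intro i _ j _ hij
      exact (hXi.indepFun hij).comp (measurable_centredInd_left y) (measurable_centredInd_left y)
  rw [variance_of_integral_eq_zero (Finset.aemeasurable_sum _ fun i _ => (hZm i).aemeasurable)
    hsum0] at hvar
  simp only [empCdf_sub hn, mul_pow]
  rw [integral_const_mul]
  simp only [Finset.sum_apply, hZ] at hvar
  rw [hvar]
  field_simp

lemma integrable_dist_empCdf (hP : Integrable fun y => √(cdf P y * (1 - cdf P y))) (hn : n ≠ 0) :
    Integrable (fun ω => ∫ y, |empCdf X n ω y - cdf P y|) μ ∧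
      ∫ ω, (∫ y, |empCdf X n ω y - cdf P y|) ∂μ ≤ (√n)⁻¹ * ∫ y, √(cdf P y * (1 - cdf P y)) := by
  have hm : Measurable (Function.uncurry fun ω y => |empCdf X n ω y - cdf P y|) :=
    (measurable_empCdf_sub hXm).abs
  have hle : ∀ y, ∫ ω, |empCdf X n ω y - cdf P y| ∂μ ≤
      (√n)⁻¹ * √(cdf P y * (1 - cdf P y)) := by
    intro y
    have := integral_abs_mul_le_sqrt (memLp_empCdf_sub (μ := μ) (P := P) hXm hn y)
      (memLp_const (1 : ℝ))
    rw [integral_empCdf_sub_sq hXm hXi hXl hn y] at this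
    simpa [Real.sqrt_div' _ (Nat.cast_nonneg n), div_eq_inv_mul] using this
  have hi : Integrable (Function.uncurry fun ω y => |empCdf X n ω y - cdf P y|)
      (μ.prod volume) := by
    refine (integrable_prod_iff' hm.aestronglyMeasurable).2 ⟨ae_of_all _ fun y => ?_, ?_⟩
    · exact ((memLp_empCdf_sub hXm hn y).integrable (by simp)).abs
    · refine Integrable.mono' (hP.const_mul (√n)⁻¹)
        hm.stronglyMeasurable.norm.integral_prod_left'.aestronglyMeasurable
        (ae_of_all _ fun y => ?_)
      rw [Real.norm_of_nonneg (integral_nonneg fun _ => norm_nonneg _)]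
      simpa [Function.uncurry] using hle y
  refine ⟨hi.integral_prod_left, ?_⟩
  rw [integral_integral_swap hi, ← integral_const_mul]
  exact integral_mono hi.integral_prod_right (hP.const_mul _) hle

lemma integrable_sq_empCdf (hP : Integrable fun y => √(cdf P y * (1 - cdf P y))) (hn : n ≠ 0) :
    Integrable (fun ω => ∫ y, (empCdf X n ω y - cdf P y) ^ 2) μ ∧
      ∫ ω, (∫ y, (empCdf X n ω y - cdf P y) ^ 2) ∂μ =
        (∫ y, cdf P y * (1 - cdf P y)) / n := by
  have hm : Measurable (Function.uncurry fun ω y => (empCdf X n ω y - cdf P y) ^ 2) :=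
    (measurable_empCdf_sub hXm).pow_const 2
  have heq : ∀ y, ∫ ω, (empCdf X n ω y - cdf P y) ^ 2 ∂μ = cdf P y * (1 - cdf P y) / n :=
    fun y => integral_empCdf_sub_sq hXm hXi hXl hn y
  have hi : Integrable (Function.uncurry fun ω y => (empCdf X n ω y - cdf P y) ^ 2)
      (μ.prod volume) := by
    refine (integrable_prod_iff' hm.aestronglyMeasurable).2 ⟨ae_of_all _ fun y => ?_, ?_⟩
    · exact (memLp_empCdf_sub hXm hn y).integrable_sq
    · refine ((integrable_cdf_mul_of_sqrt hP).div_const (n : ℝ)).congr (ae_of_all _ fun y => ?_)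
      simp [Function.uncurry, heq]
  refine ⟨hi.integral_prod_left, ?_⟩
  rw [integral_integral_swap hi]
  simp only [heq, integral_div]

end

end

section

/-! ### A multivariate central limit theorem -/

section

variable {Ω : Type*} [MeasurableSpace Ω] {μ : Measure Ω}

lemma charFun_map_eq {E : Type*} [NormedAddCommGroup E] [InnerProductSpace ℝ E]
    [MeasurableSpace E] [BorelSpace E] {U : Ω → E} (hU : AEMeasurable U μ) (t : E) :
    charFun (μ.map U) t = charFun (μ.map fun ω => inner ℝ (U ω) t) 1 := by
  have h1 : AEMeasurable (fun ω => inner ℝ (U ω) t) μ :=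
    (Continuous.measurable (f := fun x : E => inner ℝ x t) (by fun_prop)).comp_aemeasurable hU
  rw [charFun_apply, charFun_apply, integral_map hU, integral_map h1]
  · simp
  · exact Continuous.aestronglyMeasurable (by fun_prop)
  · exact Continuous.aestronglyMeasurable (by fun_prop)

variable [IsProbabilityMeasure μ]

/-- The central limit theorem in `ℝ^κ`, reduced to the real line by the Cramér–Wold device. -/
lemma tendstoInDistribution_inv_sqrt_smul_sum {κ : Type*} [Fintype κ] [DecidableEq κ]
    {V : ℕ → Ω → EuclideanSpace ℝ κ} {C : Matrix κ κ ℝ} (hC : C.PosSemidef)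
    (hV : iIndepFun V μ) (hid : ∀ i, IdentDistrib (V i) (V 0) μ μ)
    (hL2 : ∀ t : EuclideanSpace ℝ κ, MemLp (fun ω => inner ℝ (V 0 ω) t) 2 μ)
    (h0 : ∀ t : EuclideanSpace ℝ κ, ∫ ω, inner ℝ (V 0 ω) t ∂μ = 0)
    (h2 : ∀ t : EuclideanSpace ℝ κ, ∫ ω, (inner ℝ (V 0 ω) t) ^ 2 ∂μ = t.ofLp ⬝ᵥ C *ᵥ t.ofLp) :
    TendstoInDistribution (fun (n : ℕ) ω => (√n)⁻¹ • ∑ k ∈ Finset.range n, V k ω) atTop id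
      (fun _ => μ) (multivariateGaussian 0 C) := by
  have hVm : ∀ i, AEMeasurable (V i) μ := fun i => (hid i).aemeasurable_fst
  have hSm : ∀ n : ℕ, AEMeasurable (fun ω => (√n)⁻¹ • ∑ k ∈ Finset.range n, V k ω) μ := fun n =>
    (Finset.aemeasurable_fun_sum (Finset.range n) fun i _ => hVm i).const_smul ((√n)⁻¹ : ℝ)
  refine ⟨hSm, aemeasurable_id, ?_⟩
  refine ProbabilityMeasure.tendsto_iff_tendsto_charFun.2 fun t => ?_
  have hmt : Measurable fun x : EuclideanSpace ℝ κ => inner ℝ x t :=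
    Continuous.measurable (by fun_prop)
  have hvar : Var[fun ω => inner ℝ (V 0 ω) t; μ] = t.ofLp ⬝ᵥ C *ᵥ t.ofLp := by
    rw [variance_of_integral_eq_zero (hL2 t).aemeasurable (h0 t), h2]
  have h1d := tendstoInDistribution_inv_sqrt_mul_sum_sub (P := μ)
    (X := fun i ω => inner ℝ (V i ω) t) (Y := id)
    (P' := gaussianReal 0 Var[fun ω => inner ℝ (V 0 ω) t; μ].toNNReal) HasLaw.id (hL2 t)
    (hV.comp (fun _ x => inner ℝ x t) fun _ => hmt) (fun i => (hid i).comp hmt)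
  have h3 := ProbabilityMeasure.tendsto_iff_tendsto_charFun.1 h1d.tendsto 1
  simp only [ProbabilityMeasure.coe_mk, Measure.map_id, charFun_gaussianReal, hvar, h0] at h3
  simp only [ProbabilityMeasure.coe_mk, Measure.map_id, charFun_multivariateGaussian hC]
  have hnn : 0 ≤ t.ofLp ⬝ᵥ C *ᵥ t.ofLp := by
    rw [← h2]
    exact integral_nonneg fun _ => sq_nonneg _
  refine Tendsto.congr (fun n => ?_) (h3.trans_eq ?_)
  · rw [charFun_map_eq (hSm n)]
    congr 2
    ext ω
    simp [inner_smul_left, sum_inner]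
  · simp [Real.coe_toNNReal _ hnn]

/-- A sequence of random vectors tends to `0` in probability if, for every `c > 0`, it is bounded by
`c R + R'` outside events of vanishing probability, where `R` is bounded in `L¹` and `R'` tends to
`0` in `L¹`. -/
lemma tendstoInMeasure_zero_of_bound {E : Type*} [SeminormedAddCommGroup E] {D : ℕ → Ω → E}
    {R R' : ℕ → Ω → ℝ} {C : ℝ} {C' : ℕ → ℝ} (hR : ∀ n ω, 0 ≤ R n ω) (hR' : ∀ n ω, 0 ≤ R' n ω)
    (hRi : ∀ᶠ n in atTop, Integrable (R n) μ ∧ ∫ ω, R n ω ∂μ ≤ C)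
    (hRi' : ∀ᶠ n in atTop, Integrable (R' n) μ ∧ ∫ ω, R' n ω ∂μ ≤ C' n)
    (hC' : Tendsto C' atTop (𝓝 0))
    (hD : ∀ c > 0, Tendsto (fun n => μ.real {ω | ¬ ‖D n ω‖ ≤ c * R n ω + R' n ω}) atTop (𝓝 0)) :
    TendstoInMeasure μ D atTop 0 := by
  rw [tendstoInMeasure_iff_measureReal_norm]
  intro ε hε
  have hC : 0 ≤ C := by
    obtain ⟨n, hn⟩ := hRi.exists
    exact (integral_nonneg (hR n)).trans hn.2
  have hbound : ∀ c > 0, ∀ᶠ n in atTop, μ.real {ω | ε ≤ ‖D n ω - 0‖} ≤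
      μ.real {ω | ¬ ‖D n ω‖ ≤ c * R n ω + R' n ω} + 2 * c * C / ε + 2 * C' n / ε := by
    intro c hc
    filter_upwards [hRi, hRi'] with n hn hn'
    have hsub : {ω | ε ≤ ‖D n ω - 0‖} ⊆ {ω | ¬ ‖D n ω‖ ≤ c * R n ω + R' n ω} ∪
        {ω | ε / (2 * c) ≤ R n ω} ∪ {ω | ε / 2 ≤ R' n ω} := by
      intro ω hω
      by_contra hcon
      simp only [mem_union, mem_ofPred_eq, not_or, not_le] at hcon
      obtain ⟨⟨h1, h2⟩, h3⟩ := hcon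
      have h4 : c * R n ω < ε / 2 := by
        rw [lt_div_iff₀ (by positivity)] at h2
        linarith
      have h5 : ε ≤ ‖D n ω - 0‖ := hω
      rw [sub_zero] at h5
      linarith
    have hM1 := mul_meas_ge_le_integral_of_nonneg (ae_of_all _ (hR n)) hn.1 (ε / (2 * c))
    have hM2 := mul_meas_ge_le_integral_of_nonneg (ae_of_all _ (hR' n)) hn'.1 (ε / 2)
    have hM1' : μ.real {ω | ε / (2 * c) ≤ R n ω} ≤ 2 * c * C / ε := by
      rw [le_div_iff₀ hε]
      have := hM1.trans hn.2
      rw [div_mul_eq_mul_div, div_le_iff₀ (by positivity)] at this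
      linarith
    have hM2' : μ.real {ω | ε / 2 ≤ R' n ω} ≤ 2 * C' n / ε := by
      rw [le_div_iff₀ hε]
      linarith [hM2.trans hn'.2]
    calc _ ≤ _ := measureReal_mono hsub
      _ ≤ _ := measureReal_union_le _ _
      _ ≤ _ := add_le_add (measureReal_union_le _ _) le_rfl
      _ ≤ _ := by linarith
  rw [Metric.tendsto_nhds]
  intro δ hδ
  -- the constant makes the contribution of `R` at most `δ / 2`
  set c := δ * ε / (4 * (C + 1)) with hc
  have hc0 : 0 < c := by positivity
  have hcle : 2 * c * C / ε ≤ δ / 2 := by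
    rw [hc, div_le_iff₀ hε]
    have : δ * ε / (4 * (C + 1)) * (C + 1) = δ * ε / 4 := by field_simp
    nlinarith [show 0 < δ * ε / (4 * (C + 1)) by positivity]
  have hlim : Tendsto (fun n => μ.real {ω | ¬ ‖D n ω‖ ≤ c * R n ω + R' n ω} + 2 * C' n / ε)
      atTop (𝓝 0) := by
    simpa using (hD c hc0).add ((hC'.const_mul 2).div_const ε)
  filter_upwards [hbound c hc0, hlim.eventually (gt_mem_nhds (half_pos hδ))] with n h1 h2
  rw [Real.dist_eq, sub_zero, abs_of_nonneg measureReal_nonneg]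
  simp only [Pi.zero_apply]
  linarith

end

/-! ### The limit law of minimax estimators -/

namespace PluginProblem

variable {ι : Type} [Fintype ι] {q : ℕ} (S : PluginProblem ι q)

/-- The weights `a k'(T(F₀, φ₀))` of the linearisation of `F ↦ ∫ k(T(F, φ₀))` at `F₀`, where `a`
is the slope of `T` in the nuisance function. -/
def weight (a : ℝ) (i : Fin q) (y : ℝ) : ℝ := a * deriv (S.k i) (S.T S.F₀ S.φ₀ y)

/-- The covariance matrix of the influence functions of the constraints, in terms of the covariance
function of the empirical process. -/
def cov (a : ℝ) : Matrix (Fin q) (Fin q) ℝ := Matrix.of fun i j =>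
  ∫ x, ∫ y, (S.F₀ (min x y) - S.F₀ x * S.F₀ y) * S.weight a i x * S.weight a j y

variable {S} {a : ℝ} {F : ℝ → ℝ}

lemma measurable_weight (i : Fin q) : Measurable (S.weight a i) :=
  ((continuous_deriv_k i).measurable.comp (S.T_meas _ admissible_F₀ _ φ₀_mem)).const_mul a

lemma abs_weight_le (i : Fin q) (y : ℝ) : |S.weight a i y| ≤ |a| * S.B := by
  rw [weight, abs_mul]
  exact mul_le_mul_of_nonneg_left
    (S.dk_bound i _ (S.T_bound _ admissible_F₀ _ φ₀_mem y)) (abs_nonneg _)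

section

variable (hM : ∀ i, S.M S.φ₀ i = ∫ y, S.k i (S.T S.F₀ S.φ₀ y))
include hM

lemma res_eq (hF : Admissible S.F₀ F) (i : Fin q) :
    S.res F i = -∫ y, (S.k i (S.T F S.φ₀ y) - S.k i (S.T S.F₀ S.φ₀ y)) := by
  rw [integral_sub (integrable_k hF φ₀_mem i) (S.k_int i), res, hM]
  ring

variable (hT : ∀ F y, S.T F S.φ₀ y - S.T S.F₀ S.φ₀ y = a * (F y - S.F₀ y))
include hT

lemma abs_res_le (hF : Admissible S.F₀ F) (i : Fin q) :
    |S.res F i| ≤ S.B * |a| * S.dist₀ F := by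
  rw [res_eq hM hF, abs_neg, dist₀, ← integral_const_mul]
  refine abs_integral_le_integral_abs.trans (integral_mono (integrable_k_sub hF φ₀_mem i).abs
    (hF.int.abs.const_mul _) fun y => ?_)
  have := k_lip i (S.T_bound _ hF _ φ₀_mem y) (S.T_bound _ admissible_F₀ _ φ₀_mem y)
  rwa [hT, abs_mul, ← mul_assoc] at this

/-- The residual of the constraints at the true parameter is linear in `F - F₀` up to a quadratic
error. -/
lemma abs_res_add_le (hF : Admissible S.F₀ F) (i : Fin q) :
    |S.res F i + ∫ y, S.weight a i y * (F y - S.F₀ y)| ≤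
      S.B * a ^ 2 * ∫ y, (F y - S.F₀ y) ^ 2 := by
  have hsq : Integrable fun y => (F y - S.F₀ y) ^ 2 := by
    refine Integrable.mono' hF.int.abs ((hF.meas.sub S.F₀_meas).pow_const 2).aestronglyMeasurable
      (ae_of_all _ fun y => ?_)
    have h1 : |F y - S.F₀ y| ≤ 1 := abs_le.2
      ⟨by linarith [(hF.mem y).1, (S.F₀_mem y).2], by linarith [(hF.mem y).2, (S.F₀_mem y).1]⟩
    rw [norm_pow, Real.norm_eq_abs, pow_two]
    exact mul_le_of_le_one_left (abs_nonneg _) h1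
  have hw : Integrable fun y => S.weight a i y * (F y - S.F₀ y) :=
    hF.int.bdd_mul (measurable_weight i).aestronglyMeasurable
      (ae_of_all _ fun y => abs_weight_le i y)
  rw [res_eq hM hF, neg_add_eq_sub, ← integral_sub hw (integrable_k_sub hF φ₀_mem i),
    ← integral_const_mul]
  refine abs_integral_le_integral_abs.trans (integral_mono
    (hw.sub (integrable_k_sub hF φ₀_mem i)).abs (hsq.const_mul _) fun y => ?_)
  have := k_taylor i (S.T_bound _ hF _ φ₀_mem y) (S.T_bound _ admissible_F₀ _ φ₀_mem y)
  rw [hT, abs_sub_comm, sq_abs, mul_pow] at this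
  calc _ = |deriv (S.k i) (S.T S.F₀ S.φ₀ y) * (a * (F y - S.F₀ y)) -
        (S.k i (S.T F S.φ₀ y) - S.k i (S.T S.F₀ S.φ₀ y))| := by
        simp only [weight]
        ring_nf
    _ ≤ _ := this
    _ = _ := by ring

end

section

variable {P : Measure ℝ} [IsProbabilityMeasure P] (hF₀ : S.F₀ = cdf P)
  (hP : Integrable fun y => √(cdf P y * (1 - cdf P y)))

include hP

lemma memLp_influence (i : Fin q) : MemLp (influence P (S.weight a i)) 2 P := by
  rw [memLp_two_iff_integrable_sq (measurable_influence (measurable_weight i)).aestronglyMeasurable]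
  simp only [pow_two]
  exact integrable_influence_mul hP (measurable_weight i) (abs_weight_le i) (measurable_weight i)
    (abs_weight_le i)

lemma integral_sum_influence (c : Fin q → ℝ) :
    ∫ x, ∑ i, c i * influence P (S.weight a i) x ∂P = 0 := by
  rw [integral_finsetSum _ fun i _ => ((memLp_influence hP i).integrable (by simp)).const_mul _]
  simp [integral_const_mul, integral_influence hP (measurable_weight _) (abs_weight_le _)]

include hF₀

lemma integral_sum_influence_sq (c : Fin q → ℝ) :
    ∫ x, (∑ i, c i * influence P (S.weight a i) x) ^ 2 ∂P = c ⬝ᵥ S.cov a *ᵥ c := by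
  have hi : ∀ i j, Integrable
      (fun x => influence P (S.weight a i) x * influence P (S.weight a j) x) P := fun i j =>
    integrable_influence_mul hP (measurable_weight i) (abs_weight_le i) (measurable_weight j)
      (abs_weight_le j)
  have hcov : ∀ i j, ∫ x, influence P (S.weight a i) x * influence P (S.weight a j) x ∂P =
      S.cov a i j := fun i j => by
    rw [integral_influence_mul hP (measurable_weight i) (abs_weight_le i) (measurable_weight j)
      (abs_weight_le j)]
    simp [cov, hF₀]
  have hexp : ∀ x, (∑ i, c i * influence P (S.weight a i) x) ^ 2 = ∑ i, ∑ j, c i * c j *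
      (influence P (S.weight a i) x * influence P (S.weight a j) x) := fun x => by
    rw [pow_two, Finset.sum_mul_sum]
    exact Finset.sum_congr rfl fun i _ => Finset.sum_congr rfl fun j _ => by ring
  simp only [hexp]
  rw [integral_finsetSum _ fun i _ => integrable_finsetSum _ fun j _ => (hi i j).const_mul _]
  simp only [dotProduct, Matrix.mulVec, Finset.mul_sum]
  refine Finset.sum_congr rfl fun i _ => ?_
  rw [integral_finsetSum _ fun j _ => (hi i j).const_mul _]
  refine Finset.sum_congr rfl fun j _ => ?_
  rw [integral_const_mul, hcov]
  ring

lemma posSemidef_cov : (S.cov a).PosSemidef := by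
  refine Matrix.PosSemidef.of_dotProduct_mulVec_nonneg ?_ fun x => ?_
  · ext i j
    have h1 : ∀ i j, S.cov a i j =
        ∫ x, influence P (S.weight a i) x * influence P (S.weight a j) x ∂P := fun i j => by
      rw [integral_influence_mul hP (measurable_weight i) (abs_weight_le i) (measurable_weight j)
        (abs_weight_le j)]
      simp [cov, hF₀]
    simp [h1, mul_comm]
  · rw [star_trivial, ← integral_sum_influence_sq hF₀ hP]
    exact integral_nonneg fun _ => sq_nonneg _

variable [DecidableEq ι]

lemma posSemidef_limitCov : (limitCov S.J S.A (S.cov a)).PosSemidef := by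
  have := (posSemidef_cov (a := a) hF₀ hP).mul_mul_conjTranspose_same (matHP S.J S.A)
  simpa [limitCov, Matrix.conjTranspose_eq_transpose_of_trivial] using this

omit [DecidableEq ι] hF₀ hP in
lemma inner_toLp_neg_mulVec {κ : Type*} [Fintype κ] (B : Matrix κ (Fin q) ℝ) (u : Fin q → ℝ)
    (t : EuclideanSpace ℝ κ) :
    inner ℝ (WithLp.toLp 2 (-(B *ᵥ u)) : EuclideanSpace ℝ κ) t =
      ∑ i, (-(t.ofLp ᵥ* B)) i * u i := by
  rw [EuclideanSpace.inner_eq_star_dotProduct]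
  simp only [star_trivial]
  rw [dotProduct_neg, Matrix.dotProduct_mulVec, ← neg_dotProduct]
  rfl

/-- The leading term of the expansion of the estimator is asymptotically normal. -/
lemma tendstoInDistribution_score {Ω : Type*} [MeasurableSpace Ω] {μ : Measure Ω}
    [IsProbabilityMeasure μ] {X : ℕ → Ω → ℝ} (hXi : iIndepFun X μ)
    (hXl : ∀ i, HasLaw (X i) P μ) :
    TendstoInDistribution (fun (n : ℕ) ω => (√n)⁻¹ • ∑ k ∈ Finset.range n,
      (WithLp.toLp 2 (-(matHP S.J S.A *ᵥ fun i => influence P (S.weight a i) (X k ω))) :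
        EuclideanSpace ℝ (ι ⊕ Fin q))) atTop id (fun _ => μ)
      (multivariateGaussian 0 (limitCov S.J S.A (S.cov a))) := by
  set g : ℝ → EuclideanSpace ℝ (ι ⊕ Fin q) := fun x =>
    WithLp.toLp 2 (-(matHP S.J S.A *ᵥ fun i => influence P (S.weight a i) x)) with hg
  have hgm : Measurable g := by
    refine (WithLp.measurable_toLp 2 _).comp (measurable_pi_lambda _ fun j => ?_)
    simp only [Pi.neg_apply, Matrix.mulVec, dotProduct]
    exact (Finset.measurable_fun_sum _ fun i _ =>
      (measurable_influence (measurable_weight i)).const_mul _).neg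
  have hgt : ∀ t : EuclideanSpace ℝ (ι ⊕ Fin q), Measurable fun x => inner ℝ (g x) t := fun t =>
    hgm.inner measurable_const
  have hinner : ∀ x (t : EuclideanSpace ℝ (ι ⊕ Fin q)), inner ℝ (g x) t =
      ∑ i, (-(t.ofLp ᵥ* matHP S.J S.A)) i * influence P (S.weight a i) x := fun x t =>
    inner_toLp_neg_mulVec _ _ t
  refine tendstoInDistribution_inv_sqrt_smul_sum (V := fun k ω => g (X k ω))
    (posSemidef_limitCov hF₀ hP) (hXi.comp (fun _ => g) fun _ => hgm)
    (fun i => ((hXl i).identDistrib (hXl 0)).comp hgm) (fun t => ?_) (fun t => ?_) fun t => ?_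
  · have h1 : MemLp (fun x => inner ℝ (g x) t) 2 P := by
      simp only [hinner]
      exact memLp_finsetSum _ fun i _ => (memLp_influence hP i).const_mul _
    rw [← (hXl 0).map_eq] at h1
    exact h1.comp_of_map (hXl 0).aemeasurable
  · rw [show (fun ω => inner ℝ (g (X 0 ω)) t) = (fun x => inner ℝ (g x) t) ∘ X 0 from rfl,
      (hXl 0).integral_comp (hgt t).aestronglyMeasurable]
    simp only [hinner]
    exact integral_sum_influence hP _
  · rw [show (fun ω => (inner ℝ (g (X 0 ω)) t) ^ 2) = (fun x => (inner ℝ (g x) t) ^ 2) ∘ X 0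
      from rfl, (hXl 0).integral_comp ((hgt t).pow_const 2).aestronglyMeasurable]
    simp only [hinner]
    rw [integral_sum_influence_sq hF₀ hP, limitCov, ← Matrix.mulVec_mulVec,
      ← Matrix.mulVec_mulVec, Matrix.mulVec_transpose, Matrix.dotProduct_mulVec t.ofLp]
    simp [Matrix.mulVec_neg]

end

end PluginProblem

end

section

namespace PluginProblem

variable {ι : Type} {q : ℕ}

/-- Splitting of the rescaled error into the error of the expansion of the estimator and the error
of the linearisation of the residual `g`. -/
lemma rescaled_error_eq (B : Matrix (ι ⊕ Fin q) (Fin q) ℝ) {n : ℕ} (hn : n ≠ 0) (δ : ι → ℝ)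
    (ξ g : Fin q → ℝ) (y : ℕ → Fin q → ℝ) :
    (WithLp.toLp 2 (Sum.elim (fun i => √(n : ℝ) * δ i) fun i => √(n : ℝ) * ξ i) :
      WithLp 2 (ι ⊕ Fin q → ℝ)) -
        (√(n : ℝ))⁻¹ • ∑ k ∈ Finset.range n, WithLp.toLp 2 (-(B *ᵥ y k)) =
      √(n : ℝ) • WithLp.toLp 2 (Sum.elim δ ξ - B *ᵥ g) +
        √(n : ℝ) • WithLp.toLp 2 (B *ᵥ fun i => g i + (n : ℝ)⁻¹ * ∑ k ∈ Finset.range n, y k i) := by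
  have hn' : (0 : ℝ) < n := Nat.cast_pos.2 (Nat.pos_of_ne_zero hn)
  have h1 : (B *ᵥ fun i => g i + (n : ℝ)⁻¹ * ∑ k ∈ Finset.range n, y k i) =
      B *ᵥ g + (n : ℝ)⁻¹ • ∑ k ∈ Finset.range n, B *ᵥ y k := by
    have : (fun i => g i + (n : ℝ)⁻¹ * ∑ k ∈ Finset.range n, y k i) =
        g + (n : ℝ)⁻¹ • ∑ k ∈ Finset.range n, y k := by
      ext i
      simp
    rw [this]
    have h2 := map_sum B.mulVecLin y (Finset.range n)
    simp only [Matrix.mulVecLin_apply] at h2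
    rw [Matrix.mulVec_add, Matrix.mulVec_smul, h2]
  have h3 : (√(n : ℝ))⁻¹ = √(n : ℝ) * (n : ℝ)⁻¹ := by
    have : √(n : ℝ) ≠ 0 := (Real.sqrt_pos.2 hn').ne'
    field_simp
    exact (Real.sq_sqrt hn'.le).symm
  rw [h1, h3]
  ext j
  rcases j with j | j <;>
  · simp
    ring

variable [Fintype ι] [DecidableEq ι] {S : PluginProblem ι q} {a : ℝ}
  {Ω : Type*} [MeasurableSpace Ω] {μ : Measure Ω} [IsProbabilityMeasure μ]
  {P : Measure ℝ} [IsProbabilityMeasure P] {X : ℕ → Ω → ℝ}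

/-- A minimax estimator that is consistent is asymptotically normal. -/
theorem tendstoInDistribution_minimax (hA : IsUnit S.A) (hJ : IsUnit (S.Jᵀ * S.A⁻¹ * S.J))
    {Φ : Set (EuclideanSpace ℝ ι)} (hΦ : Φ ∈ 𝓝 S.φ₀) (hF₀ : S.F₀ = cdf P)
    (hM : ∀ i, S.M S.φ₀ i = ∫ y, S.k i (S.T S.F₀ S.φ₀ y))
    (hT : ∀ F y, S.T F S.φ₀ y - S.T S.F₀ S.φ₀ y = a * (F y - S.F₀ y))
    (hP : Integrable fun y => √(cdf P y * (1 - cdf P y)))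
    (hXm : ∀ i, Measurable (X i)) (hXi : iIndepFun X μ) (hXl : ∀ i, HasLaw (X i) P μ)
    {φhat : ℕ → Ω → EuclideanSpace ℝ ι} {ξhat : ℕ → Ω → EuclideanSpace ℝ (Fin q)}
    (hφm : ∀ n, AEMeasurable (φhat n) μ) (hξm : ∀ n, AEMeasurable (ξhat n) μ)
    (hest : ∀ᶠ n in atTop, ∀ᵐ ω ∂μ,
      IsMinOn (fun φ => ⨆ ξ, S.crit (empCdf X n ω) φ ξ) Φ (φhat n ω) ∧
      IsMaxOn (S.crit (empCdf X n ω) (φhat n ω)) univ (ξhat n ω))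
    (hφc : TendstoInMeasure μ φhat atTop (fun _ => S.φ₀))
    (hξc : TendstoInMeasure μ ξhat atTop (fun _ => 0)) :
    TendstoInDistribution
      (fun (n : ℕ) (ω : Ω) => (WithLp.toLp 2 (Sum.elim
        (fun i => √(n : ℝ) * (φhat n ω i - S.φ₀ i)) (fun i => √(n : ℝ) * ξhat n ω i)) :
          EuclideanSpace ℝ (ι ⊕ Fin q)))
      atTop id (fun _ => μ) (multivariateGaussian 0 (limitCov S.J S.A (S.cov a))) := by
  refine tendstoInDistribution_of_tendstoInMeasure_sub _ _
    (tendstoInDistribution_score hF₀ hP hXi hXl) ?_ fun n => ?_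
  swap
  · refine (WithLp.measurable_toLp 2 _).comp_aemeasurable (aemeasurable_pi_lambda _ fun j => ?_)
    rcases j with j | j
    · exact (((EuclideanSpace.proj (𝕜 := ℝ) j).continuous.measurable.comp_aemeasurable
        (hφm n)).sub_const _).const_mul _
    · exact ((EuclideanSpace.proj (𝕜 := ℝ) j).continuous.measurable.comp_aemeasurable
        (hξm n)).const_mul _
  obtain ⟨C₁, hC₁, H₁⟩ := exists_norm_mulVec_le (matHP S.J S.A)
  obtain ⟨C₂, hC₂, H₂⟩ := exists_norm_toLp_le (ι ⊕ Fin q)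
  have hdist : ∀ n ω, S.dist₀ (empCdf X n ω) = ∫ y, |empCdf X n ω y - cdf P y| := fun n ω => by
    rw [dist₀, hF₀]
  have hB := S.B_nonneg
  have hne : ∀ᶠ n : ℕ in atTop, n ≠ 0 := eventually_ne_atTop 0
  have hadm : ∀ n ω, n ≠ 0 → Admissible S.F₀ (empCdf X n ω) := fun n ω hn => by
    rw [hF₀]
    exact admissible_empCdf hP hn ω
  have hsqrt : Tendsto (fun n : ℕ => (√(n : ℝ))⁻¹) atTop (𝓝 0) :=
    tendsto_inv_atTop_zero.comp (Real.tendsto_sqrt_atTop.comp tendsto_natCast_atTop_atTop)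
  refine tendstoInMeasure_zero_of_bound
    (R := fun n ω => √(n : ℝ) * (S.B * |a|) * ∫ y, |empCdf X n ω y - cdf P y|)
    (R' := fun n ω => √(n : ℝ) * (C₂ * (C₁ * (S.B * a ^ 2))) *
      ∫ y, (empCdf X n ω y - cdf P y) ^ 2)
    (C := S.B * |a| * ∫ y, √(cdf P y * (1 - cdf P y)))
    (C' := fun n => (√(n : ℝ))⁻¹ * (C₂ * (C₁ * (S.B * a ^ 2)) * ∫ y, cdf P y * (1 - cdf P y)))
    (fun n ω => mul_nonneg (by positivity) (integral_nonneg fun _ => abs_nonneg _))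
    (fun n ω => mul_nonneg (by positivity) (integral_nonneg fun _ => sq_nonneg _))
    ?_ ?_ ?_ fun c hc => ?_
  · filter_upwards [hne] with n hn
    obtain ⟨h1, h2⟩ := integrable_dist_empCdf hXm hXi hXl hP hn
    refine ⟨h1.const_mul _, ?_⟩
    have hn' : (0 : ℝ) < √(n : ℝ) := Real.sqrt_pos.2 (Nat.cast_pos.2 (Nat.pos_of_ne_zero hn))
    rw [integral_const_mul]
    calc _ ≤ √(n : ℝ) * (S.B * |a|) * ((√n)⁻¹ * ∫ y, √(cdf P y * (1 - cdf P y))) :=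
          mul_le_mul_of_nonneg_left h2 (by positivity)
      _ = _ := by field_simp
  · filter_upwards [hne] with n hn
    obtain ⟨h1, h2⟩ := integrable_sq_empCdf hXm hXi hXl hP hn
    refine ⟨h1.const_mul _, ?_⟩
    have hn0 : (0 : ℝ) < n := Nat.cast_pos.2 (Nat.pos_of_ne_zero hn)
    have hn' : (0 : ℝ) < √(n : ℝ) := Real.sqrt_pos.2 hn0
    rw [integral_const_mul, h2]
    refine le_of_eq ?_
    nth_rewrite 2 [← Real.sq_sqrt hn0.le]
    field_simp
  · simpa using hsqrt.mul_const _
  -- the expansion holds as soon as the empirical distribution function and the estimators are close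
  -- to their limits
  obtain ⟨δ, hδ, hexp⟩ := eventually_nhd_iff.1 (eventually_expansion hA hJ hΦ hc)
  have hW : Tendsto (fun n => μ.real {ω | δ ≤ ∫ y, |empCdf X n ω y - cdf P y|}) atTop (𝓝 0) := by
    have hlim : Tendsto (fun n : ℕ => (√(n : ℝ))⁻¹ * (∫ y, √(cdf P y * (1 - cdf P y))) / δ)
        atTop (𝓝 0) := by
      simpa using (hsqrt.mul_const (∫ y, √(cdf P y * (1 - cdf P y)))).div_const δ
    refine squeeze_zero' (Eventually.of_forall fun n => measureReal_nonneg) ?_ hlim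
    filter_upwards [hne] with n hn
    obtain ⟨h1, h2⟩ := integrable_dist_empCdf hXm hXi hXl hP hn
    have := mul_meas_ge_le_integral_of_nonneg
      (ae_of_all _ fun ω => integral_nonneg fun y => abs_nonneg _) h1 δ
    rw [le_div_iff₀ hδ, mul_comm]
    exact this.trans h2
  have hφ0 := tendstoInMeasure_iff_measureReal_norm.1 hφc δ hδ
  have hξ0 := tendstoInMeasure_iff_measureReal_norm.1 hξc δ hδ
  have hsum := (hW.add hφ0).add hξ0
  simp only [add_zero] at hsum
  refine squeeze_zero' (Eventually.of_forall fun n => measureReal_nonneg) ?_ hsum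
  filter_upwards [hne, hest] with n hn hestn
  have hnull : μ.real {ω | ¬ (IsMinOn (fun φ => ⨆ ξ, S.crit (empCdf X n ω) φ ξ) Φ (φhat n ω) ∧
      IsMaxOn (S.crit (empCdf X n ω) (φhat n ω)) univ (ξhat n ω))} = 0 := by
    rw [measureReal_def, ae_iff.1 hestn, ENNReal.toReal_zero]
  refine (measureReal_mono (s₂ := {ω | δ ≤ ∫ y, |empCdf X n ω y - cdf P y|} ∪
    {ω | δ ≤ ‖φhat n ω - S.φ₀‖} ∪ {ω | δ ≤ ‖ξhat n ω - 0‖} ∪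
    {ω | ¬ (IsMinOn (fun φ => ⨆ ξ, S.crit (empCdf X n ω) φ ξ) Φ (φhat n ω) ∧
      IsMaxOn (S.crit (empCdf X n ω) (φhat n ω)) univ (ξhat n ω))}) fun ω hω => ?_).trans
    ((measureReal_union_le _ _).trans ?_)
  · by_contra hcon
    simp only [mem_union, mem_ofPred_eq, not_or, not_le, not_not, sub_zero] at hcon
    obtain ⟨⟨⟨h1, h2⟩, h3⟩, hmin, hmax⟩ := hcon
    refine hω ?_
    rw [← hdist] at h1
    have hF := hadm n ω hn
    have h4 := hexp (empCdf X n ω) (φhat n ω) (ξhat n ω) hF h1 h2 h3 hmin hmax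
    have h5 : ‖S.res (empCdf X n ω)‖ ≤ S.B * |a| * S.dist₀ (empCdf X n ω) :=
      (pi_norm_le_iff_of_nonneg (mul_nonneg (by positivity) dist₀_nonneg)).2 fun i =>
        abs_res_le hM hT hF i
    have h6 : ‖fun i => S.res (empCdf X n ω) i +
        (n : ℝ)⁻¹ * ∑ k ∈ Finset.range n, influence P (S.weight a i) (X k ω)‖ ≤
        S.B * a ^ 2 * ∫ y, (empCdf X n ω y - cdf P y) ^ 2 := by
      refine (pi_norm_le_iff_of_nonneg (mul_nonneg (by positivity)
        (integral_nonneg fun _ => sq_nonneg _))).2 fun i => ?_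
      rw [← integral_mul_empCdf_sub hP hn (measurable_weight i) (abs_weight_le i), ← hF₀]
      exact abs_res_add_le hM hT hF i
    have h7 := rescaled_error_eq (matHP S.J S.A) hn (fun i => φhat n ω i - S.φ₀ i)
      (ξhat n ω).ofLp (S.res (empCdf X n ω))
      fun k i => influence P (S.weight a i) (X k ω)
    refine (congrArg norm h7).trans_le ((norm_add_le _ _).trans ?_)
    rw [norm_smul, norm_smul, Real.norm_of_nonneg (Real.sqrt_nonneg _)]
    refine add_le_add ?_ ?_
    · calc _ ≤ √(n : ℝ) * (c * (S.B * |a| * S.dist₀ (empCdf X n ω))) := by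
            gcongr
            exact h4.trans (mul_le_mul_of_nonneg_left h5 hc.le)
        _ = _ := by
            rw [hdist]
            ring
    · calc _ ≤ √(n : ℝ) * (C₂ * (C₁ * (S.B * a ^ 2 *
              ∫ y, (empCdf X n ω y - cdf P y) ^ 2))) := by
            gcongr
            exact (H₂ _).trans (mul_le_mul_of_nonneg_left
              ((H₁ _).trans (mul_le_mul_of_nonneg_left h6 hC₁)) hC₂)
        _ = _ := by ring
  · rw [hnull, add_zero]
    exact (measureReal_union_le _ _).trans (add_le_add (measureReal_union_le _ _) le_rfl)

end PluginProblem

end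

end LMomMixture

end


theorem mainTheorem1
    {d s ℓ : ℕ}
    -- the divergence generator; its conjugate is `C²` near `0`, normalised by `ψ''(0) = 1`
    (f : ℝ → ℝ≥0∞) (hf : LMomMixture.IsDivergenceGenerator f)
    (hψ_fin : ∀ᶠ t in 𝓝 (0 : ℝ), LMomMixture.conjugate f t ≠ ⊤)
    (hψ_C2 : ContDiffAt ℝ 2 (fun t => (LMomMixture.conjugate f t).toReal) 0)
    (hψ_norm : iteratedDeriv 2 (fun t => (LMomMixture.conjugate f t).toReal) 0 = 1)
    -- parameter sets, parametric component, constraint function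
    (Θ : Set (EuclideanSpace ℝ (Fin d))) (𝒜 : Set (EuclideanSpace ℝ (Fin s)))
    (Φ : Set (LMomMixture.Par d s))
    (hΦ : ∀ φ ∈ Φ, φ.lam ∈ Ioo (0 : ℝ) 1 ∧ φ.theta ∈ Θ ∧ φ.alpha ∈ 𝒜)
    (P₁ : EuclideanSpace ℝ (Fin d) → Measure ℝ) (hP₁ : ∀ θ ∈ Θ, IsProbabilityMeasure (P₁ θ))
    (m : EuclideanSpace ℝ (Fin s) → EuclideanSpace ℝ (Fin (ℓ - 1)))
    -- the true law is a mixture whose second component satisfies the L-moment constraints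
    (φstar : LMomMixture.Par d s) (hφstar : φstar ∈ interior Φ)
    (PT P₀ : Measure ℝ) [IsProbabilityMeasure PT] [IsProbabilityMeasure P₀]
    (hmix : PT = ENNReal.ofReal φstar.lam • P₁ φstar.theta + ENNReal.ofReal (1 - φstar.lam) • P₀)
    (hconstr : LMomMixture.quantileMeasure P₀ ∈
      LMomMixture.constraintClass (LMomMixture.quantileMeasure P₀) (m φstar.alpha))
    -- the i.i.d. sample
    {Ω : Type*} [MeasurableSpace Ω] (μ : Measure Ω) [IsProbabilityMeasure μ]
    (X : ℕ → Ω → ℝ) (hX_indep : iIndepFun X μ) (hX_law : ∀ i, HasLaw (X i) PT μ)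
    -- moment and integrability conditions
    (hX_int : ∀ i, Integrable (X i) μ)
    (hF_sqrt : Integrable (fun y : ℝ => √(cdf PT y * (1 - cdf PT y))))
    (hF_cov : Integrable
      (fun p : ℝ × ℝ => cdf PT (min p.1 p.2) - cdf PT p.1 * cdf PT p.2) (volume.prod volume))
    -- the estimator: `ξhat n ω` maximises `H_n(φhat n ω, ·)`, and
    -- `φhat n ω` minimises `φ ↦ sup_ξ H_n(φ, ξ)` over `Φ`
    (φhat : ℕ → Ω → LMomMixture.Par d s) (ξhat : ℕ → Ω → EuclideanSpace ℝ (Fin (ℓ - 1)))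
    (hφhat_meas : ∀ n, AEMeasurable (φhat n) μ) (hξhat_meas : ∀ n, AEMeasurable (ξhat n) μ)
    (hest : ∀ᶠ n in atTop, ∀ᵐ ω ∂μ, φhat n ω ∈ Φ ∧
      IsMinOn (fun φ => ⨆ ξ, LMomMixture.criterion f P₁ m (LMomMixture.empCdf X n ω) φ ξ)
        Φ (φhat n ω) ∧
      IsMaxOn (LMomMixture.criterion f P₁ m (LMomMixture.empCdf X n ω) (φhat n ω))
        univ (ξhat n ω))
    -- consistency
    (hφ_cons : TendstoInMeasure μ φhat atTop (fun _ => φstar))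
    (hξ_cons : TendstoInMeasure μ ξhat atTop (fun _ => 0))
    -- smoothness and domination
    (hm : ContDiffOn ℝ 2 m 𝒜)
    (hF₁_diff : ∀ᶠ θ in 𝓝 φstar.theta, ∀ y,
      DifferentiableAt ℝ (fun t => (cdf (P₁ t) y : ℝ)) θ ∧
      DifferentiableAt ℝ (LMomMixture.gradF1 P₁ y) θ)
    (hB₁ : ∃ B₁ : ℝ → ℝ, Integrable B₁ ∧
      ∀ᶠ θ in 𝓝 φstar.theta, ∀ y, ‖LMomMixture.gradF1 P₁ y θ‖ ≤ B₁ y)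
    -- `‖v vᵗ‖ = ‖v‖ ^ 2`
    (hB₂₂ : ∃ B₂₂ : ℝ → ℝ, Integrable B₂₂ ∧
      ∀ᶠ θ in 𝓝 φstar.theta, ∀ y, ‖LMomMixture.gradF1 P₁ y θ‖ ^ 2 ≤ B₂₂ y)
    (hB₂₁ : ∃ B₂₁ : ℝ → ℝ, Integrable B₂₁ ∧
      ∀ᶠ θ in 𝓝 φstar.theta, ∀ y, ‖fderiv ℝ (LMomMixture.gradF1 P₁ y) θ‖ ≤ B₂₁ y)
    (hdiff_int : Integrable (fun y : ℝ => cdf PT y - cdf (P₁ φstar.theta) y))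
    -- the matrices
    (J : Matrix (Fin (ℓ - 1)) (LMomMixture.ParIdx d s) ℝ)
    (hJ : J = LMomMixture.Jphixi P₁ m (cdf PT) φstar)
    (A : Matrix (Fin (ℓ - 1)) (Fin (ℓ - 1)) ℝ)
    (hA : A = LMomMixture.Jxixi ℓ P₁ (cdf PT) φstar)
    (hA_inv : IsUnit A) (hJAJ_inv : IsUnit (Jᵀ * A⁻¹ * J)) :
    (LMomMixture.limitCov J A (LMomMixture.covSigma ℓ P₁ (cdf PT) φstar)).PosSemidef ∧
    TendstoInDistribution
      (fun (n : ℕ) (ω : Ω) => (WithLp.toLp 2 (Sum.elim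
        (fun i => √(n : ℝ) * (φhat n ω i - φstar i))
        (fun i => √(n : ℝ) * ξhat n ω i)) :
          EuclideanSpace ℝ (LMomMixture.ParIdx d s ⊕ Fin (ℓ - 1))))
      atTop id (fun _ => μ)
      (multivariateGaussian 0
        (LMomMixture.limitCov J A (LMomMixture.covSigma ℓ P₁ (cdf PT) φstar))) := by
  obtain ⟨S, hST, hSF, rfl, hSk, hScrit, hSM, hSJ, hSA⟩ := LMomMixture.exists_pluginProblem hf
    hψ_fin hψ_C2 hψ_norm hΦ hP₁ hφstar hmix hconstr hm hF₁_diff hB₁ hdiff_int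
  set a : ℝ := 1 / (1 - LMomMixture.Par.lam S.φ₀) with ha
  have hcov : LMomMixture.covSigma ℓ P₁ (cdf PT) S.φ₀ = S.cov a := by
    ext i j
    simp only [LMomMixture.covSigma, LMomMixture.PluginProblem.cov,
      LMomMixture.PluginProblem.weight, Matrix.of_apply, hST, hSF, hSk, LMomMixture.deriv_K]
    rw [← integral_const_mul]
    refine integral_congr_ae (ae_of_all _ fun x => ?_)
    simp only
    rw [← integral_const_mul]
    refine integral_congr_ae (ae_of_all _ fun y => ?_)
    rw [← one_div_pow, ← ha]
    simp only [Nat.add_succ_sub_one]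
    ring
  have hT : ∀ F y, S.T F S.φ₀ y - S.T S.F₀ S.φ₀ y = a * (F y - S.F₀ y) := fun F y => by
    rw [hST, LMomMixture.F0, LMomMixture.F0]
    ring
  have hM : ∀ i, S.M S.φ₀ i = ∫ y, S.k i (S.T S.F₀ S.φ₀ y) := fun i => by
    rw [hSM, hSk, hST, hSF]
  subst hJ hA
  rw [← hSJ, ← hSA] at hJAJ_inv
  rw [← hSA] at hA_inv
  rw [hcov, ← hSJ, ← hSA]
  refine ⟨LMomMixture.PluginProblem.posSemidef_limitCov hSF hF_sqrt, ?_⟩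
  -- measurable versions of the observations have almost surely the same empirical distribution
  -- functions
  set X' : ℕ → Ω → ℝ := fun i => (hX_law i).aemeasurable.mk (X i) with hX'
  have hXX' : ∀ i, X i =ᵐ[μ] X' i := fun i => (hX_law i).aemeasurable.ae_eq_mk
  have hemp : ∀ᵐ ω ∂μ, ∀ n, LMomMixture.empCdf X n ω = LMomMixture.empCdf X' n ω := by
    filter_upwards [ae_all_iff.2 hXX'] with ω hω n
    ext y
    simp only [LMomMixture.empCdf, hω]
  refine LMomMixture.PluginProblem.tendstoInDistribution_minimax (X := X') hA_inv hJAJ_inv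
    (mem_interior_iff_mem_nhds.1 hφstar) hSF hM hT hF_sqrt
    (fun i => (hX_law i).aemeasurable.measurable_mk) (hX_indep.congr hXX')
    (fun i => (hX_law i).congr (hXX' i).symm) hφhat_meas hξhat_meas ?_ hφ_cons hξ_cons
  filter_upwards [hest] with n hn
  filter_upwards [hn, hemp] with ω hω hω'
  rw [hScrit, ← hω' n]
  exact hω.2
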